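/- Let $\mathbb T^3=\mathbb R^3/\mathbb Z^3$. Let $h\in C^3((0,\infty),[0,\infty))$ (no convexity is assumed) and $p(r)=r h'(r)-h(r)$. Let $T,\mu,C_\kappa>0$ and $\lambda\in\mathbb R$ with $\lambda+\tfrac23\mu>0$, and put $\sigma[u]=\lambda\,(\operatorname{div}u)\,\mathbb I+\mu(\nabla u+(\nabla u)^T)$. Let $\rho_0\in C^3(\mathbb T^3,(0,\infty))$, $u_0\in C^2(\mathbb T^3,\mathbb R^3)$, and let $c_\rho,C_\rho,c_m,K>0$ be constants. Consider the Navier–Stokes–Korteweg system $$\rho_t+\operatorname{div}(\rho u)=0,\qquad (\rho u)_t+\operatorname{div}(\rho u\otimes u)+\nabla p(\rho)=\operatorname{div}\sigma[u]+C_\kappa\,\rho\nabla\Delta\rho \tag{1}$$ and, for $\alpha>0$, the lower-order model $$\rho^\alpha_t+\operatorname{div}(\rho^\alpha u^\alpha)=0,\quad (\rho^\alpha u^\alpha)_t+\operatorname{div}(\rho^\alpha u^\alpha\otimes u^\alpha)+\nabla\big(p(\rho^\alpha)+C_\kappa\tfrac{\alpha}{2}(\rho^\alpha)^2\big)=\operatorname{div}\sigma[u^\alpha]+C_\kappa\alpha\,\rho^\alpha\nabla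 c^\alpha,\quad c^\alpha-\tfrac1\alpha\Delta c^\alpha=\rho^\alpha. \tag{2}$$ A strong solution of (1) is a pair $(\rho,u)$ satisfying (1) pointwise on $(0,T)\times\mathbb T^3$ with $\rho>0$, $\rho\in C^0([0,T],C^3)\cap C^1((0,T),C^1)$ and $u\in C^0([0,T],C^2)\cap C^1((0,T),C^0)$. A strong solution of (2) is a triple satisfying (2) pointwise with $\rho^\alpha,c^\alpha>0$, $\rho^\alpha\in C^0([0,T],C^1)\cap C^1((0,T),C^0)$, $u^\alpha\in C^0([0,T],C^2)\cap C^1((0,T),C^0)$ and $c^\alpha\in C^0([0,T],C^3)\cap C^1((0,T),C^2)$. Then there are constants $C>0$ and $\alpha_1>0$, depending only on $T,\lambda,\mu,C_\kappa,h,\rho_0,u_0,c_\rho,C_\rho,c_m$ and $K$, such that the following holds. Let $(\rho,u)$ be a strong solution of (1) with initial data $(\rho_0,u_0)$, let $\alpha\ge\alpha_1$, and let $(\rho^\alpha,u^\alpha,c^\alpha)$ be a strong solution of (2) whose initial data $\rho^\alpha_0\in C^3(\mathbb T^3,(0,\infty))$, $u^\alpha_0\in C^2(\mathbb T^3,\mathbb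 R^3)$ satisfy $$\int_{\mathbb T^3}(\rho^\alpha_0-\rho_0)\,dx=0,\quad \|\rho^\alpha_0-\rho_0\|_{H^1(\mathbb T^3)}\le K\alpha^{-1/2},\quad \|\rho^\alpha_0\|_{H^3(\mathbb T^3)}\le K,\quad \|u^\alpha_0-u_0\|_{L^2(\mathbb T^3)}\le K\alpha^{-1/2}.$$ Assume that $c_\rho\le\rho,\rho^\alpha\le C_\rho$ and $|\rho u|,|\rho^\alpha u^\alpha|\le c_m$ on $[0,T]\times\mathbb T^3$. Then $$\frac{C_\kappa}{2}\|\rho-c^\alpha\|^2_{L^\infty(0,T;H^1(\mathbb T^3))}+\frac{C_\kappa\alpha}{2}\|\rho^\alpha-c^\alpha\|^2_{L^\infty(0,T;L^2(\mathbb T^3))}+\frac{c_\rho}{2}\|u^\alpha-u\|^2_{L^\infty(0,T;L^2(\mathbb T^3))}\le\frac{C}{\alpha}.$$ -/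

import Mathlib

open MeasureTheory Set Filter Topology
open scoped ENNReal

namespace NSK

/-- Points of the universal cover `ℝ³` of the torus `𝕋³ = ℝ³ / ℤ³`. Functions on `𝕋³` are functions
on `ℝ³` that are 1-periodic in every coordinate. Only the topology, the linear structure and the
Lebesgue measure of this space are used. -/
abbrev Space := Fin 3 → ℝ

/-- Values of velocity fields, with the Euclidean norm. -/
abbrev Vec := EuclideanSpace ℝ (Fin 3)

/-- Lebesgue measure of `𝕋³`: that of the unit cube (its faces are null sets). -/
noncomputable def torusMeasure : Measure Space := volume.restrict (Icc (0 : Space) 1)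

section Regularity

variable {F : Type} [NormedAddCommGroup F] [NormedSpace ℝ F]

/-- `f ∈ C^k(𝕋³, F)`. -/
def TorusCk (k : ℕ) (f : Space → F) : Prop :=
  ContDiff ℝ k f ∧ ∀ i : Fin 3, Function.Periodic f (Pi.single i 1)

/-- Convergence `g s → f` along `l` in `C^k(𝕋³, F)`: all derivatives of order at most `k`
converge uniformly. -/
def TendstoCk (k : ℕ) (g : ℝ → Space → F) (l : Filter ℝ) (f : Space → F) : Prop :=
  ∀ j ≤ k, TendstoUniformly (fun s => iteratedFDeriv ℝ j (g s)) (iteratedFDeriv ℝ j f) l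

/-- `f ∈ C⁰(I, C^k(𝕋³, F))`. -/
def C0Time (I : Set ℝ) (k : ℕ) (f : ℝ → Space → F) : Prop :=
  (∀ t ∈ I, TorusCk k (f t)) ∧ ∀ t ∈ I, TendstoCk k f (𝓝[I] t) (f t)

/-- `f ∈ C¹(I, C^k(𝕋³, F))`: the difference quotients in time converge in `C^k(𝕋³, F)` to a
function `f'` that belongs to `C⁰(I, C^k(𝕋³, F))`. -/
def C1Time (I : Set ℝ) (k : ℕ) (f : ℝ → Space → F) : Prop :=
  (∀ t ∈ I, TorusCk k (f t)) ∧
    ∃ f' : ℝ → Space → F, C0Time I k f' ∧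
      ∀ t ∈ I, TendstoCk k (fun s x => (s - t)⁻¹ • (f s x - f t x)) (𝓝[I \ {t}] t) (f' t)

end Regularity

section Operators

/-- The partial derivative `∂_i f`. -/
noncomputable def pd (i : Fin 3) (f : Space → ℝ) (x : Space) : ℝ :=
  fderiv ℝ f x (Pi.single i 1)

/-- The divergence of a vector field. -/
noncomputable def divergence (v : Space → Vec) (x : Space) : ℝ :=
  ∑ i, pd i (fun y => v y i) x

/-- The Laplacian of a scalar field. -/
noncomputable def laplace (f : Space → ℝ) (x : Space) : ℝ :=
  ∑ i, pd i (pd i f) x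

/-- The entry `(i, j)` of the Navier-Stokes stress
`σ[v] = lam (div v) 𝕀 + mu (∇v + (∇v)ᵀ)`. -/
noncomputable def stress (lam mu : ℝ) (v : Space → Vec) (i j : Fin 3) (x : Space) : ℝ :=
  lam * divergence v x * (if i = j then 1 else 0)
    + mu * (pd j (fun y => v y i) x + pd i (fun y => v y j) x)

/-- The pressure `p(r) = r h'(r) - h(r)` belonging to the energy density `h`. -/
noncomputable def pressure (h : ℝ → ℝ) (r : ℝ) : ℝ := r * deriv h r - h r

end Operators

section Norms

/-- The norm of `H^k(𝕋³)` of a function with classical derivatives up to order `k`: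
the square root of the sum of `‖∂_{i₁} ⋯ ∂_{i_j} f‖²_{L²}` over all `j ≤ k` and all `i₁, …, i_j`. -/
noncomputable def sobolevNorm (k : ℕ) (f : Space → ℝ) : ℝ≥0∞ :=
  (∑ j ∈ Finset.range (k + 1), ∑ i : Fin j → Fin 3,
    eLpNorm (fun x => iteratedFDeriv ℝ j f x (fun l => Pi.single (i l) 1)) 2 torusMeasure ^ 2)
      ^ (1 / 2 : ℝ)

/-- The norm of `L²(𝕋³)`. -/
noncomputable def l2Norm {F : Type} [NormedAddCommGroup F] (f : Space → F) : ℝ≥0∞ :=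
  eLpNorm f 2 torusMeasure

/-- The norm of `L^∞(0,T)` of a nonnegative function of time. -/
noncomputable def supTime (T : ℝ) (g : ℝ → ℝ≥0∞) : ℝ≥0∞ :=
  essSup g (volume.restrict (Ioo 0 T))

end Norms

/-- `(ρ, u)` is a strong solution on `[0,T] × 𝕋³` of the Navier-Stokes-Korteweg system
`ρ_t + div(ρu) = 0`, `(ρu)_t + div(ρu ⊗ u) + ∇p(ρ) = div σ[u] + Ck ρ∇Δρ`
with initial data `(ρ₀, u₀)`. -/
structure IsStrongNSK (h : ℝ → ℝ) (lam mu Ck T : ℝ) (ρ₀ : Space → ℝ) (u₀ : Space → Vec)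
    (ρ : ℝ → Space → ℝ) (u : ℝ → Space → Vec) : Prop where
  rho_C0 : C0Time (Icc 0 T) 3 ρ
  rho_C1 : C1Time (Ioo 0 T) 1 ρ
  rho_pos : ∀ t ∈ Icc 0 T, ∀ x, 0 < ρ t x
  u_C0 : C0Time (Icc 0 T) 2 u
  u_C1 : C1Time (Ioo 0 T) 0 u
  mass : ∀ t ∈ Ioo 0 T, ∀ x,
    deriv (fun s => ρ s x) t + divergence (fun y => ρ t y • u t y) x = 0
  momentum : ∀ t ∈ Ioo 0 T, ∀ x, ∀ i : Fin 3,
    deriv (fun s => ρ s x * u s x i) t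
        + ∑ j, pd j (fun y => ρ t y * u t y i * u t y j) x
        + pd i (fun y => pressure h (ρ t y)) x
      = ∑ j, pd j (stress lam mu (u t) i j) x + Ck * ρ t x * pd i (laplace (ρ t)) x
  rho_init : ρ 0 = ρ₀
  u_init : u 0 = u₀

/-- `(ρ, u, c)` is a strong solution on `[0,T] × 𝕋³` of the lower-order model with parameter `α`
`ρ_t + div(ρu) = 0`,
`(ρu)_t + div(ρu ⊗ u) + ∇(p(ρ) + Ck (α/2) ρ²) = div σ[u] + Ck α ρ∇c`, `c - (1/α) Δc = ρ`
with initial data `(ρ₀, u₀)`. -/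
structure IsStrongLowerOrder (h : ℝ → ℝ) (lam mu Ck T α : ℝ) (ρ₀ : Space → ℝ) (u₀ : Space → Vec)
    (ρ : ℝ → Space → ℝ) (u : ℝ → Space → Vec) (c : ℝ → Space → ℝ) : Prop where
  rho_C0 : C0Time (Icc 0 T) 1 ρ
  rho_C1 : C1Time (Ioo 0 T) 0 ρ
  rho_pos : ∀ t ∈ Icc 0 T, ∀ x, 0 < ρ t x
  u_C0 : C0Time (Icc 0 T) 2 u
  u_C1 : C1Time (Ioo 0 T) 0 u
  c_C0 : C0Time (Icc 0 T) 3 c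
  c_C1 : C1Time (Ioo 0 T) 2 c
  c_pos : ∀ t ∈ Icc 0 T, ∀ x, 0 < c t x
  mass : ∀ t ∈ Ioo 0 T, ∀ x,
    deriv (fun s => ρ s x) t + divergence (fun y => ρ t y • u t y) x = 0
  momentum : ∀ t ∈ Ioo 0 T, ∀ x, ∀ i : Fin 3,
    deriv (fun s => ρ s x * u s x i) t
        + ∑ j, pd j (fun y => ρ t y * u t y i * u t y j) x
        + pd i (fun y => pressure h (ρ t y) + Ck * (α / 2) * ρ t y ^ 2) x
      = ∑ j, pd j (stress lam mu (u t) i j) x + Ck * α * ρ t x * pd i (c t) x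
  screened : ∀ t ∈ Icc 0 T, ∀ x, c t x - 1 / α * laplace (c t) x = ρ t x
  rho_init : ρ 0 = ρ₀
  u_init : u 0 = u₀

/-- Bounds on density and momentum on `[0,T] × 𝕋³`: `c_ρ ≤ ρ ≤ C_ρ` and `|ρu| ≤ c_m`. -/
def UniformBounds (T cρ Cρ cm : ℝ) (ρ : ℝ → Space → ℝ) (u : ℝ → Space → Vec) : Prop :=
  ∀ t ∈ Icc 0 T, ∀ x, cρ ≤ ρ t x ∧ ρ t x ≤ Cρ ∧ ‖ρ t x • u t x‖ ≤ cm

/-- The initial data `(ρ₀α, u₀α)` of the lower-order model lie in `C³ × C²`, have the same mass as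
`(ρ₀, u₀)`, and are close to them to order `α^{-1/2}`, all with the constant `K`. -/
structure CloseInitialData (K α : ℝ) (ρ₀ : Space → ℝ) (u₀ : Space → Vec)
    (ρ₀α : Space → ℝ) (u₀α : Space → Vec) : Prop where
  rho_reg : TorusCk 3 ρ₀α
  rho_pos : ∀ x, 0 < ρ₀α x
  u_reg : TorusCk 2 u₀α
  same_mass : ∫ x, (ρ₀α x - ρ₀ x) ∂torusMeasure = 0
  rho_close : sobolevNorm 1 (fun x => ρ₀α x - ρ₀ x) ≤ ENNReal.ofReal (K * α ^ (-(1 / 2) : ℝ))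
  rho_bound : sobolevNorm 3 ρ₀α ≤ ENNReal.ofReal K
  u_close : l2Norm (fun x => u₀α x - u₀ x) ≤ ENNReal.ofReal (K * α ^ (-(1 / 2) : ℝ))

end NSK

/-! The two flows are compared by a relative energy. Write a, U, c for the lower-order solution, b,
u for the reference solution, v = U - u, r = a - b, and let d = (1 - α⁻¹Δ)⁻¹ b be the screened
reference density, so that w = c - d solves the screened Poisson equation with datum r. The energy
is the integral of ½ a|v|² + Ck (½ α (w - r)² + ½ |∇w|²) + ½ r². The potential h does not enter it,
so convexity plays no role: the pressure difference is Lipschitz in r, it meets div v after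
integration by parts, and viscosity absorbs that product because σ[v] : ∇v ≥ (lam + 2/3 mu)(div v)².
The summand ½ r² controls what remains.

Since Δc = α(c - a), the artificial pressure and the coupling force add up to Ck a∇Δc. The capillary
accelerations of the two systems therefore differ by Ck ∇Δw + Ck ∇e with the consistency error e =
Δd - Δb. The first part exchanges kinetic and capillary energy and cancels up to quadratic terms.
For the second, Δb is Lipschitz because b is C³ in space; hence e = O(α^(-1/2)), while ∇e is merely
bounded. So a v·∇e is split into r v·∇e, which is quadratic in the differences, and b v·∇e, which is
integrated by parts to -e div(bv). This gives E' ≤ A E + B/α (`integral_energy_rate_le`,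
`relEnergyRate_integral_le`), and Gronwall's inequality gives E(t) ≤ C (E(0) + 1/α)
(`exists_relEnergy_le`). Testing the screened equation with w - r bounds E(0) by the distance of the
initial data (`relEnergy_le_of_close`), and b - d = -α⁻¹Δd = O(1/α) in C¹ allows d to be replaced by
b (`exists_error_le`).

The resolvent (1 - δ²Δ)⁻¹ is realised as an average of translates against a probability measure, the
law of R Z with Z Gaussian and R Rayleigh. Its commutation with derivatives, its contraction in the
sup norm and its O(δ) error on Lipschitz functions are then immediate.

The constant found in this way depends on the reference solution. `exists_uniform_error_le` removes
the dependence: if lower-order solutions exist for arbitrarily large α, they converge to every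
reference solution with the given data, so all of these agree and the constant of one of them serves
for all; otherwise a large α₁ makes the claim vacuous. -/

namespace NSK

/-! ### Calculus of periodic functions -/

section TorusCalculus

variable {F G : Type} [NormedAddCommGroup F] [NormedSpace ℝ F] [NormedAddCommGroup G]
  [NormedSpace ℝ G]

lemma TorusCk.of_le {k l : ℕ} {f : Space → F} (hf : TorusCk k f) (h : l ≤ k) : TorusCk l f :=
  ⟨hf.1.of_le (by exact_mod_cast h), hf.2⟩

lemma TorusCk.continuous {k : ℕ} {f : Space → F} (hf : TorusCk k f) : Continuous f :=
  hf.1.continuous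

lemma TorusCk.differentiable {k : ℕ} {f : Space → F} (hf : TorusCk k f) (hk : 1 ≤ k) :
    Differentiable ℝ f :=
  hf.1.differentiable (by exact_mod_cast (by omega : k ≠ 0))

lemma TorusCk.zero_iff {f : Space → F} :
    TorusCk 0 f ↔ Continuous f ∧ ∀ i : Fin 3, Function.Periodic f (Pi.single i 1) := by
  unfold TorusCk
  rw [Nat.cast_zero, contDiff_zero]

lemma TorusCk.clm {k : ℕ} {f : Space → F} (hf : TorusCk k f) (L : F →L[ℝ] G) :
    TorusCk k (fun x => L (f x)) :=
  ⟨L.contDiff.comp hf.1, fun i x => by simp only [hf.2 i x]⟩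

lemma TorusCk.fderiv {k : ℕ} {f : Space → F} (hf : TorusCk (k + 1) f) :
    TorusCk k (fderiv ℝ f) := by
  refine ⟨hf.1.fderiv_right (by push_cast; rfl), fun i x => ?_⟩
  have h : (fun y => f (y + Pi.single i 1)) = f := funext (hf.2 i)
  calc _root_.fderiv ℝ f (x + Pi.single i 1)
      = _root_.fderiv ℝ (fun y => f (y + Pi.single i 1)) x := (fderiv_comp_add_right _).symm
    _ = _ := by rw [h]

lemma TorusCk.pd {k : ℕ} {f : Space → ℝ} (hf : TorusCk (k + 1) f) (i : Fin 3) :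
    TorusCk k (pd i f) :=
  hf.fderiv.clm (ContinuousLinearMap.apply ℝ ℝ (Pi.single i (1 : ℝ)))

variable {k : ℕ} {f g : Space → ℝ}

lemma TorusCk.add (hf : TorusCk k f) (hg : TorusCk k g) : TorusCk k (fun x => f x + g x) :=
  ⟨hf.1.add hg.1, fun i x => by simp only [hf.2 i x, hg.2 i x]⟩

lemma TorusCk.sub (hf : TorusCk k f) (hg : TorusCk k g) : TorusCk k (fun x => f x - g x) :=
  ⟨hf.1.sub hg.1, fun i x => by simp only [hf.2 i x, hg.2 i x]⟩

lemma TorusCk.mul (hf : TorusCk k f) (hg : TorusCk k g) : TorusCk k (fun x => f x * g x) :=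
  ⟨hf.1.mul hg.1, fun i x => by simp only [hf.2 i x, hg.2 i x]⟩

lemma TorusCk.const (c : ℝ) : TorusCk k (fun _ : Space => c) :=
  ⟨contDiff_const, fun _ _ => rfl⟩

lemma TorusCk.const_mul (c : ℝ) (hf : TorusCk k f) : TorusCk k (fun x => c * f x) :=
  (TorusCk.const c).mul hf

lemma TorusCk.pow (hf : TorusCk k f) (n : ℕ) : TorusCk k (fun x => f x ^ n) :=
  ⟨hf.1.pow n, fun i x => by simp only [hf.2 i x]⟩

lemma TorusCk.sum {ι : Type} {s : Finset ι} {f : ι → Space → ℝ} (hf : ∀ i ∈ s, TorusCk k (f i)) :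
    TorusCk k (fun x => ∑ i ∈ s, f i x) :=
  ⟨ContDiff.sum fun i hi => (hf i hi).1,
    fun j x => Finset.sum_congr rfl fun i hi => (hf i hi).2 j x⟩

lemma TorusCk.comp {φ : ℝ → ℝ} {s : Set ℝ} (hφ : ContDiffOn ℝ k φ s)
    (hf : TorusCk k f) (hfs : ∀ x, f x ∈ s) : TorusCk k (fun x => φ (f x)) :=
  ⟨hφ.comp_contDiff hf.1 hfs, fun i x => by simp only [hf.2 i x]⟩

lemma TorusCk.laplace (hf : TorusCk (k + 2) f) : TorusCk k (laplace f) :=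
  TorusCk.sum fun i _ => TorusCk.pd (k := k) (TorusCk.pd (k := k + 1) hf i) i

lemma pd_add {i : Fin 3} (hf : Differentiable ℝ f) (hg : Differentiable ℝ g) :
    pd i (fun y => f y + g y) = fun x => pd i f x + pd i g x := by
  funext x
  simp only [pd]
  rw [fderiv_fun_add (hf x) (hg x)]
  rfl

lemma pd_sub {i : Fin 3} (hf : Differentiable ℝ f) (hg : Differentiable ℝ g) :
    pd i (fun y => f y - g y) = fun x => pd i f x - pd i g x := by
  funext x
  simp only [pd]
  rw [fderiv_fun_sub (hf x) (hg x)]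
  rfl

lemma pd_mul {i : Fin 3} (hf : Differentiable ℝ f) (hg : Differentiable ℝ g) :
    pd i (fun y => f y * g y) = fun x => pd i f x * g x + f x * pd i g x := by
  funext x
  simp only [pd]
  rw [fderiv_fun_mul (hf x) (hg x)]
  simp only [add_apply, FunLike.coe_smul, Pi.smul_apply, smul_eq_mul]
  ring

lemma pd_const_mul {i : Fin 3} (c : ℝ) (hf : Differentiable ℝ f) :
    pd i (fun y => c * f y) = fun x => c * pd i f x := by
  funext x
  simp only [pd]
  rw [fderiv_const_mul (hf x)]
  rfl

lemma pd_sum {ι : Type} {s : Finset ι} {f : ι → Space → ℝ} {i : Fin 3}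
    (hf : ∀ j ∈ s, Differentiable ℝ (f j)) :
    pd i (fun y => ∑ j ∈ s, f j y) = fun x => ∑ j ∈ s, pd i (f j) x := by
  funext x
  simp only [pd]
  rw [fderiv_fun_sum fun j hj => hf j hj x]
  simp

lemma pd_comm (hf : ContDiff ℝ 2 f) (i j : Fin 3) : pd i (pd j f) = pd j (pd i f) := by
  have key : ∀ i j : Fin 3, ∀ x, pd i (pd j f) x
      = fderiv ℝ (fderiv ℝ f) x (Pi.single i 1) (Pi.single j 1) := by
    intro i j x
    have hd : DifferentiableAt ℝ (fderiv ℝ f) x :=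
      ((hf.fderiv_right (m := 1) (by norm_num)).differentiable (by norm_num)) x
    change fderiv ℝ (fun y => fderiv ℝ f y (Pi.single j 1)) x (Pi.single i 1) = _
    rw [fderiv_clm_apply hd (differentiableAt_const _)]
    simp
  funext x
  rw [key, key]
  exact (hf.contDiffAt.isSymmSndFDerivAt (by simp)).eq _ _

end TorusCalculus

/-! ### Integration over the torus -/

section TorusIntegral

instance : IsFiniteMeasure torusMeasure :=
  ⟨by rw [torusMeasure, Measure.restrict_apply_univ]; exact isCompact_Icc.measure_lt_top⟩

instance : IsProbabilityMeasure torusMeasure :=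
  ⟨by
    rw [torusMeasure, Measure.restrict_apply_univ, Real.volume_Icc_pi]
    simp⟩

variable {F : Type} [NormedAddCommGroup F]

lemma integrable_torus {f : Space → F} (hf : Continuous f) : Integrable f torusMeasure :=
  hf.continuousOn.integrableOn_compact isCompact_Icc

/-- A periodic function takes all its values on the unit cube. -/
lemma exists_mem_Icc_eq {X : Type} {f : Space → X}
    (hf : ∀ i : Fin 3, Function.Periodic f (Pi.single i 1)) (x : Space) :
    f (fun i => Int.fract (x i)) = f x := by
  have hz : ∀ (i : Fin 3) (n : ℤ) (y : Space), f (y + Pi.single i (n : ℝ)) = f y := by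
    intro i n y
    have h := (hf i).zsmul n y
    have e : n • (Pi.single i (1 : ℝ) : Space) = Pi.single i (n : ℝ) := by
      rw [← Pi.single_smul]; simp
    rwa [e] at h
  have e : x = (((fun i => Int.fract (x i)) + Pi.single 0 ((⌊x 0⌋ : ℤ) : ℝ))
      + Pi.single 1 ((⌊x 1⌋ : ℤ) : ℝ)) + Pi.single 2 ((⌊x 2⌋ : ℤ) : ℝ) := by
    funext j
    fin_cases j <;> simp [Int.fract_add_floor]
  conv_rhs => rw [e]
  rw [hz, hz, hz]

lemma fract_mem_Icc (x : Space) : (fun i => Int.fract (x i)) ∈ Icc (0 : Space) 1 :=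
  ⟨fun _ => Int.fract_nonneg _, fun _ => (Int.fract_lt_one _).le⟩

lemma TorusCk.exists_bound {k : ℕ} [NormedSpace ℝ F] {f : Space → F} (hf : TorusCk k f) :
    ∃ M, ∀ x, ‖f x‖ ≤ M := by
  obtain ⟨M, hM⟩ := isCompact_Icc.exists_bound_of_continuousOn (s := Icc (0 : Space) 1)
    hf.continuous.continuousOn
  exact ⟨M, fun x => by
    rw [← exists_mem_Icc_eq hf.2 x]; exact hM _ (fract_mem_Icc x)⟩

/-- The integral of a divergence over the torus vanishes. -/
lemma integral_sum_pd_eq_zero {V : Fin 3 → Space → ℝ} (hV : ∀ i, TorusCk 1 (V i)) :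
    ∫ x, ∑ i, pd i (V i) x ∂torusMeasure = 0 := by
  have h := integral_divergence_of_hasFDerivAt_off_countable' (n := 2) (0 : Space) 1
    (fun i => zero_le_one) V (fun i => fderiv ℝ (V i)) ∅ countable_empty
    (fun i => (hV i).continuous.continuousOn)
    (fun x _ i => ((hV i).differentiable le_rfl x).hasFDerivAt)
    (Continuous.continuousOn (by
      have := fun i => (TorusCk.pd (k := 0) (hV i) i).continuous
      exact continuous_finsetSum _ fun i _ => this i) |>.integrableOn_compact isCompact_Icc)
  refine h.trans (Finset.sum_eq_zero fun i _ => ?_)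
  rw [sub_eq_zero]
  congr 1
  funext x
  -- Opposite faces of the cube differ by a lattice vector, so periodicity cancels the face
  -- integrals in pairs.
  have e : (i.insertNth ((1 : Space) i) x : Space)
      = i.insertNth ((0 : Space) i) x + Pi.single i 1 := by
    funext j
    refine Fin.succAboveCases i ?_ (fun j => ?_) j
    · simp
    · simp
  rw [e]
  exact (hV i).2 i _

end TorusIntegral

/-! ### The resolvent of the Laplacian -/

section GaussianWeight

/-- The unnormalised density of the standard Gaussian measure. -/
noncomputable def gaussWeight (z : Space) : ℝ := ∏ i, Real.exp (-(1 / 2) * z i ^ 2)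

lemma gaussWeight_eq (z : Space) : gaussWeight z = Real.exp (∑ i, -(1 / 2) * z i ^ 2) :=
  (Real.exp_sum _ _).symm

lemma gaussWeight_pos (z : Space) : 0 < gaussWeight z :=
  Finset.prod_pos fun _ _ => Real.exp_pos _

lemma continuous_gaussWeight : Continuous gaussWeight := by
  unfold gaussWeight; fun_prop

lemma integrable_gaussWeight : Integrable gaussWeight :=
  Integrable.fintype_prod (f := fun _ : Fin 3 => fun t : ℝ => Real.exp (-(1 / 2) * t ^ 2))
    fun _ => integrable_exp_neg_mul_sq (by norm_num)

lemma integrable_gaussWeight_mul_coord (i : Fin 3) :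
    Integrable (fun z : Space => gaussWeight z * z i) := by
  have h := Integrable.fintype_prod (μ := fun _ : Fin 3 => (volume : Measure ℝ))
    (f := fun j : Fin 3 => fun t : ℝ =>
    -- The coordinate z i is written as a product of one-variable factors, so that integrability of
    -- products applies.
    (if j = i then t else 1) * Real.exp (-(1 / 2) * t ^ 2)) (fun j => by
      by_cases hj : j = i
      · simpa [hj] using integrable_mul_exp_neg_mul_sq (b := 1 / 2) (by norm_num)
      · simpa [hj] using integrable_exp_neg_mul_sq (b := 1 / 2) (by norm_num))
  refine h.congr (Eventually.of_forall fun z => ?_)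
  simp only [Finset.prod_mul_distrib, gaussWeight]
  rw [Finset.prod_ite_eq' Finset.univ i fun j => z j]
  simp [mul_comm]

lemma integral_gaussWeight_pos : 0 < ∫ z, gaussWeight z := by
  refine (integral_pos_iff_support_of_nonneg (fun z => (gaussWeight_pos z).le)
    integrable_gaussWeight).2 ?_
  have : Function.support gaussWeight = univ := by
    ext z; simp [(gaussWeight_pos z).ne']
  rw [this]; simp

lemma fderiv_gaussWeight (i : Fin 3) (z : Space) :
    fderiv ℝ gaussWeight z (Pi.single i 1) = -(gaussWeight z * z i) := by
  have h : HasFDerivAt gaussWeight (gaussWeight z • ∑ j : Fin 3, (-(1 / 2) : ℝ) •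
      ((2 * z j) • ContinuousLinearMap.proj (R := ℝ) (φ := fun _ : Fin 3 => ℝ) j)) z := by
    have h1 : ∀ j : Fin 3, HasFDerivAt (fun z : Space => -(1 / 2) * z j ^ 2)
        ((-(1 / 2) : ℝ) • ((2 * z j) •
          ContinuousLinearMap.proj (R := ℝ) (φ := fun _ : Fin 3 => ℝ) j)) z := by
      intro j
      have := ((hasFDerivAt_apply (𝕜 := ℝ) j z).pow 2).const_mul (-(1 / 2) : ℝ)
      refine this.congr_fderiv ?_
      ext v; simp
    have h2 := (HasFDerivAt.fun_sum (u := Finset.univ) fun j _ => h1 j).exp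
    rw [← gaussWeight_eq] at h2
    exact h2.congr_of_eventuallyEq (Eventually.of_forall fun y => gaussWeight_eq y)
  rw [h.fderiv]
  simp [Pi.single_apply]

end GaussianWeight

/-! ### Gaussian averages under dilation -/

section Stein

variable {f : Space → ℝ}

lemma fderiv_eq_sum_pd (f : Space → ℝ) (x v : Space) :
    fderiv ℝ f x v = ∑ i, v i * pd i f x := by
  conv_lhs => rw [pi_eq_sum_univ' v]
  simp only [map_sum, map_smul, smul_eq_mul, pd]

lemma integrable_gaussWeight_mul {g : Space → ℝ} (hg : Continuous g) {M : ℝ}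
    (hM : ∀ x, |g x| ≤ M) : Integrable (fun z => gaussWeight z * g z) :=
  integrable_gaussWeight.mul_bdd hg.aestronglyMeasurable
    (Eventually.of_forall hM)

lemma integrable_gaussWeight_mul_coord_mul {g : Space → ℝ} (hg : Continuous g) {M : ℝ}
    (hM : ∀ x, |g x| ≤ M) (i : Fin 3) : Integrable (fun z => gaussWeight z * z i * g z) :=
  (integrable_gaussWeight_mul_coord i).mul_bdd hg.aestronglyMeasurable
    (Eventually.of_forall hM)

/-- Gaussian integration by parts along a dilation. -/
lemma integral_gaussWeight_coord {g : Space → ℝ} (hg : ContDiff ℝ 1 g) {M : ℝ}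
    (hM : ∀ x, |g x| ≤ M) (i : Fin 3) (hM' : ∀ x, |pd i g x| ≤ M) (s : ℝ) :
    ∫ z, gaussWeight z * z i * g (s • z) = s * ∫ z, gaussWeight z * pd i g (s • z) := by
  have hd : ∀ z, HasFDerivAt (fun z : Space => g (s • z)) (s • fderiv ℝ g (s • z)) z := by
    intro z
    have h1 := ((hg.differentiable (by norm_num)) (s • z)).hasFDerivAt.comp z
      ((hasFDerivAt_id z).const_smul s)
    refine h1.congr_fderiv ?_
    ext v; simp
  have hpd : ∀ z, fderiv ℝ (fun z : Space => g (s • z)) z (Pi.single i 1) = s * pd i g (s • z) := by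
    intro z; rw [(hd z).fderiv]; rfl
  have hc : Continuous (pd i g) :=
    (hg.continuous_fderiv (by norm_num)).clm_apply continuous_const
  have hgs : Continuous (fun z : Space => g (s • z)) := hg.continuous.comp (by fun_prop)
  have hcs : Continuous (fun z : Space => pd i g (s • z)) := hc.comp (by fun_prop)
  have h := integral_mul_fderiv_eq_neg_fderiv_mul_of_integrable (μ := (volume : Measure Space))
    (f := gaussWeight) (g := fun z => g (s • z)) (v := Pi.single i 1) ?_ ?_ ?_
    (fun z _ => by
      have : gaussWeight = fun z => Real.exp (∑ i, -(1 / 2) * z i ^ 2) := funext gaussWeight_eq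
      rw [this]; fun_prop) (fun z _ => (hd z).differentiableAt)
  · simp only [hpd, fderiv_gaussWeight] at h
    rw [← integral_const_mul]
    simp only [neg_mul, integral_neg, neg_neg] at h
    rw [← h]
    congr 1; funext z; ring
  · simp only [fderiv_gaussWeight, neg_mul]
    exact (integrable_gaussWeight_mul_coord_mul hgs (fun x => hM _) i).neg
  · simp only [hpd]
    have := (integrable_gaussWeight_mul hcs (fun x => hM' _)).const_mul s
    refine this.congr (Eventually.of_forall fun z => by simp only; ring)
  · exact integrable_gaussWeight_mul hgs (fun x => hM _)

/-- Differentiation under the integral produces ∑ z_i ∂_i f(sz), and Gaussian integration by parts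
trades each factor z_i for s ∂_i. This is the heat equation in the time variable s²/2. -/
lemma hasDerivAt_integral_gaussWeight (hf : ContDiff ℝ 2 f) {M : ℝ} (hM : ∀ x, |f x| ≤ M)
    (hM1 : ∀ i x, |pd i f x| ≤ M) (hM2 : ∀ i x, |pd i (pd i f) x| ≤ M) (s : ℝ) :
    HasDerivAt (fun s : ℝ => ∫ z, gaussWeight z * f (s • z))
      (s * ∫ z, gaussWeight z * laplace f (s • z)) s := by
  have hf1 : ∀ i, ContDiff ℝ 1 (pd i f) := fun i =>
    (hf.fderiv_right (m := 1) (by norm_num)).clm_apply contDiff_const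
  have hc1 : ∀ i, Continuous (pd i f) := fun i => (hf1 i).continuous
  have hc2 : ∀ i, Continuous (pd i (pd i f)) := fun i =>
    ((hf1 i).continuous_fderiv (by norm_num)).clm_apply continuous_const
  have hsm : ∀ s : ℝ, Continuous (fun z : Space => s • z) := fun s => by fun_prop
  have key := (hasDerivAt_integral_of_dominated_loc_of_deriv_le (μ := (volume : Measure Space))
    (F := fun (s : ℝ) z => gaussWeight z * f (s • z))
    (F' := fun (s : ℝ) z => ∑ i, gaussWeight z * z i * pd i f (s • z)) (x₀ := s) (s := univ)
    (bound := fun z => ∑ i : Fin 3, |gaussWeight z * z i| * M) univ_mem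
    (Eventually.of_forall fun s =>
      (integrable_gaussWeight_mul (hf.continuous.comp (hsm s)) (fun x => hM _)).1)
    (integrable_gaussWeight_mul (hf.continuous.comp (hsm s)) (fun x => hM _))
    ((integrable_finsetSum _ fun i _ =>
      integrable_gaussWeight_mul_coord_mul ((hc1 i).comp (hsm s)) (fun x => hM1 i _) i).1)
    (Eventually.of_forall fun z s _ => ?_)
    (integrable_finsetSum _ fun i _ => (integrable_gaussWeight_mul_coord i).abs.mul_const M)
    (Eventually.of_forall fun z s _ => ?_)).2
  · refine key.congr_deriv ?_
    have e1 := integral_finsetSum (μ := (volume : Measure Space)) Finset.univ fun i _ =>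
      integrable_gaussWeight_mul_coord_mul ((hc1 i).comp (hsm s)) (fun x => hM1 i _) i
    have e2 := integral_finsetSum (μ := (volume : Measure Space)) Finset.univ fun i _ =>
      integrable_gaussWeight_mul ((hc2 i).comp (hsm s)) (fun x => hM2 i _)
    simp only [Function.comp_apply] at e1 e2
    simp only [laplace, Finset.mul_sum]
    rw [e1, e2, Finset.mul_sum]
    exact Finset.sum_congr rfl fun i _ =>
      integral_gaussWeight_coord (hf1 i) (hM1 i) i (hM2 i) s
  · refine (norm_sum_le _ _).trans (Finset.sum_le_sum fun i _ => ?_)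
    rw [norm_mul]
    exact mul_le_mul_of_nonneg_left (hM1 i _) (norm_nonneg _)
  · have h1 : HasDerivAt (fun s : ℝ => f (s • z)) (fderiv ℝ f (s • z) z) s := by
      have h2 : HasDerivAt (fun s : ℝ => s • z) z s := by
        simpa using (hasDerivAt_id s).smul_const z
      exact ((hf.differentiable (by norm_num)) (s • z)).hasFDerivAt.comp_hasDerivAt s h2
    have h3 := h1.const_mul (gaussWeight z)
    rw [fderiv_eq_sum_pd, Finset.mul_sum] at h3
    simpa only [mul_assoc] using h3

end Stein

/-! ### The resolvent kernel as a probability measure -/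

section Resolvent

/-- The density of the radial part of the resolvent kernel. -/
noncomputable def radialWeight (s : ℝ) : ℝ := s * Real.exp (-(1 / 2) * s ^ 2)

lemma continuous_radialWeight : Continuous radialWeight := by
  unfold radialWeight; fun_prop

lemma integrable_radialWeight : Integrable radialWeight :=
  integrable_mul_exp_neg_mul_sq (by norm_num)

lemma hasDerivAt_exp_neg_half_sq (s : ℝ) :
    HasDerivAt (fun s : ℝ => -Real.exp (-(1 / 2) * s ^ 2)) (radialWeight s) s := by
  have h := (((hasDerivAt_id s).pow 2).const_mul (-(1 / 2) : ℝ)).exp.neg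
  refine h.congr_deriv ?_
  simp [radialWeight]
  ring

lemma tendsto_exp_neg_half_sq :
    Tendsto (fun s : ℝ => -Real.exp (-(1 / 2) * s ^ 2)) atTop (𝓝 0) := by
  have h : Tendsto (fun s : ℝ => -(1 / 2) * s ^ 2) atTop atBot :=
    (tendsto_pow_atTop two_ne_zero).const_mul_atTop_of_neg (by norm_num)
  simpa using (Real.tendsto_exp_atBot.comp h).neg

lemma integral_radialWeight : ∫ s in Ioi (0 : ℝ), radialWeight s = 1 := by
  rw [integral_Ioi_of_hasDerivAt_of_tendsto' (fun s _ => hasDerivAt_exp_neg_half_sq s)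
    integrable_radialWeight.integrableOn tendsto_exp_neg_half_sq]
  simp

/-- The integrand is the derivative of -exp(-s²/2) F(s), because F' = s H. Boundedness of F kills
the boundary term at infinity, and the one at 0 is F 0. -/
lemma integral_radialWeight_mul_sub {F H : ℝ → ℝ} (hF : ∀ s, HasDerivAt F (s * H s) s)
    (hH : Measurable H) {M : ℝ} (hFM : ∀ s, |F s| ≤ M) (hHM : ∀ s, |H s| ≤ M) :
    ∫ s in Ioi (0 : ℝ), radialWeight s * (F s - H s) = F 0 := by
  have hFc : Continuous F := continuous_iff_continuousAt.2 fun s => (hF s).continuousAt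
  have hd : ∀ s, HasDerivAt (fun s : ℝ => -Real.exp (-(1 / 2) * s ^ 2) * F s)
      (radialWeight s * (F s - H s)) s := fun s =>
    ((hasDerivAt_exp_neg_half_sq s).mul (hF s)).congr_deriv (by
      simp only [radialWeight]; ring)
  have hi : Integrable fun s => radialWeight s * (F s - H s) :=
    integrable_radialWeight.mul_bdd (c := M + M)
      (hFc.measurable.sub hH).aestronglyMeasurable
      (Eventually.of_forall fun s => (norm_sub_le _ _).trans (add_le_add (hFM s) (hHM s)))
  rw [integral_Ioi_of_hasDerivAt_of_tendsto' (m := 0) (fun s _ => hd s) hi.integrableOn ?_]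
  · simp
  · refine tendsto_exp_neg_half_sq.zero_mul_isBoundedUnder_le ?_
    exact isBoundedUnder_of ⟨M, fun s => hFM s⟩

/-- The density of the resolvent kernel in polar form. -/
noncomputable def resolventWeight (p : ℝ × Space) : ℝ :=
  radialWeight p.1 * (gaussWeight p.2 / ∫ z, gaussWeight z)

/-- The kernel of `(1 - Δ)⁻¹` on `ℝ³`, as the law of a Gaussian vector scaled by an independent
Rayleigh variable. -/
noncomputable def resolventMeasure : Measure Space :=
  (((volume.restrict (Ioi (0 : ℝ))).prod volume).withDensity
    fun p => ENNReal.ofReal (resolventWeight p)).map fun p => p.1 • p.2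

lemma continuous_resolventWeight : Continuous resolventWeight :=
  (continuous_radialWeight.comp continuous_fst).mul
    ((continuous_gaussWeight.comp continuous_snd).div_const _)

lemma integrable_resolventWeight :
    Integrable resolventWeight ((volume.restrict (Ioi (0 : ℝ))).prod volume) :=
  integrable_radialWeight.restrict.mul_prod (integrable_gaussWeight.div_const _)

lemma ae_resolventWeight_nonneg :
    ∀ᵐ p ∂((volume.restrict (Ioi (0 : ℝ))).prod (volume : Measure Space)),
      0 ≤ resolventWeight p := by
  have h : ∀ᵐ s ∂(volume.restrict (Ioi (0 : ℝ))), 0 < s := ae_restrict_mem measurableSet_Ioi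
  filter_upwards [Measure.quasiMeasurePreserving_fst.ae h] with p hp
  exact mul_nonneg (mul_nonneg hp.le (Real.exp_pos _).le)
    (div_nonneg (gaussWeight_pos _).le integral_gaussWeight_pos.le)

lemma integral_resolventWeight :
    ∫ p, resolventWeight p ∂((volume.restrict (Ioi (0 : ℝ))).prod volume) = 1 := by
  unfold resolventWeight
  rw [integral_prod_mul radialWeight fun z => gaussWeight z / ∫ z, gaussWeight z,
    integral_radialWeight, integral_div, div_self integral_gaussWeight_pos.ne', one_mul]

lemma measurable_smul_prod : Measurable fun p : ℝ × Space => p.1 • p.2 :=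
  (continuous_fst.smul continuous_snd).measurable

instance : IsProbabilityMeasure resolventMeasure := by
  refine ⟨?_⟩
  rw [resolventMeasure, Measure.map_apply measurable_smul_prod MeasurableSet.univ, preimage_univ,
    withDensity_apply _ MeasurableSet.univ, Measure.restrict_univ,
    ← ofReal_integral_eq_lintegral_ofReal integrable_resolventWeight ae_resolventWeight_nonneg,
    integral_resolventWeight, ENNReal.ofReal_one]

lemma integrable_resolventMeasure_iff {g : Space → ℝ} (hg : Continuous g) :
    Integrable g resolventMeasure ↔
      Integrable (fun p : ℝ × Space => g (p.1 • p.2) * resolventWeight p)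
        ((volume.restrict (Ioi (0 : ℝ))).prod volume) := by
  rw [resolventMeasure, integrable_map_measure hg.aestronglyMeasurable
    measurable_smul_prod.aemeasurable, integrable_withDensity_iff
    continuous_resolventWeight.measurable.ennreal_ofReal
    (Eventually.of_forall fun _ => ENNReal.ofReal_lt_top)]
  refine integrable_congr ?_
  filter_upwards [ae_resolventWeight_nonneg] with p hp
  rw [ENNReal.toReal_ofReal hp]
  rfl

lemma integral_resolventMeasure {g : Space → ℝ} (hg : Continuous g) :
    ∫ y, g y ∂resolventMeasure = ∫ p : ℝ × Space, resolventWeight p * g (p.1 • p.2)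
        ∂((volume.restrict (Ioi (0 : ℝ))).prod volume) := by
  rw [resolventMeasure, integral_map measurable_smul_prod.aemeasurable hg.aestronglyMeasurable,
    integral_withDensity_eq_integral_toReal_smul
    continuous_resolventWeight.measurable.ennreal_ofReal
    (Eventually.of_forall fun _ => ENNReal.ofReal_lt_top)]
  refine integral_congr_ae ?_
  filter_upwards [ae_resolventWeight_nonneg] with p hp
  rw [ENNReal.toReal_ofReal hp, smul_eq_mul]

/-- Finiteness of the first moment is what makes averaging at scale δ move a Lipschitz function by
O(δ). In polar form the integrand is dominated by a finite sum of products of s² exp(-s²/2) with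
Gaussian first moments. -/
lemma integrable_norm_resolventMeasure : Integrable (fun y => ‖y‖) resolventMeasure := by
  rw [integrable_resolventMeasure_iff continuous_norm]
  have h1 : IntegrableOn (fun s : ℝ => s * radialWeight s) (Ioi 0) := by
    have := integrableOn_rpow_mul_exp_neg_mul_sq (b := 1 / 2) (by norm_num) (s := 2) (by norm_num)
    refine this.congr_fun (fun s _ => ?_) measurableSet_Ioi
    simp only [radialWeight, Real.rpow_two]
    ring
  have h2 : ∀ i : Fin 3, Integrable fun z : Space =>
      gaussWeight z * z i / ∫ z, gaussWeight z := fun i =>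
    (integrable_gaussWeight_mul_coord i).div_const _
  have h3 := integrable_finsetSum Finset.univ fun i (_ : i ∈ Finset.univ) =>
    (h1.integrable.mul_prod (h2 i)).norm
  refine h3.mono' ((continuous_norm.comp (continuous_fst.smul continuous_snd)).mul
    continuous_resolventWeight).aestronglyMeasurable ?_
  filter_upwards with p
  have h4 : ‖p.2‖ ≤ ∑ i, |p.2 i| := by
    refine (pi_norm_le_iff_of_nonneg (Finset.sum_nonneg fun i _ => abs_nonneg _)).2 fun i => ?_
    exact Finset.single_le_sum (f := fun i => |p.2 i|) (fun i _ => abs_nonneg _)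
      (Finset.mem_univ i)
  have hk := integral_gaussWeight_pos
  calc ‖‖p.1 • p.2‖ * resolventWeight p‖
      = |p.1| * ‖p.2‖ * |resolventWeight p| := by
        rw [norm_mul, norm_norm, norm_smul]; rfl
    _ ≤ |p.1| * (∑ i, |p.2 i|) * |resolventWeight p| := by gcongr
    _ = _ := by
        rw [Finset.mul_sum, Finset.sum_mul]
        refine Finset.sum_congr rfl fun i _ => ?_
        simp only [resolventWeight, Real.norm_eq_abs, abs_mul, abs_div]
        ring

/-- `∫ (1 - Δ) f = f(0)` against the resolvent kernel. -/
lemma integral_resolventMeasure_sub_laplace {f : Space → ℝ} (hf : ContDiff ℝ 2 f) {M : ℝ}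
    (hM : ∀ x, |f x| ≤ M) (hM1 : ∀ i x, |pd i f x| ≤ M) (hM2 : ∀ i x, |pd i (pd i f) x| ≤ M) :
    ∫ y, (f y - laplace f y) ∂resolventMeasure = f 0 := by
  have hf1 : ∀ i, ContDiff ℝ 1 (pd i f) := fun i =>
    (hf.fderiv_right (m := 1) (by norm_num)).clm_apply contDiff_const
  have hc2 : ∀ i, Continuous (pd i (pd i f)) := fun i =>
    ((hf1 i).continuous_fderiv (by norm_num)).clm_apply continuous_const
  have hlc : Continuous (laplace f) := continuous_finsetSum _ fun i _ => hc2 i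
  have hM0 : 0 ≤ M := (abs_nonneg _).trans (hM 0)
  have hlM : ∀ x, |laplace f x| ≤ 3 * M := fun x => by
    refine (Finset.abs_sum_le_sum_abs _ _).trans ((Finset.sum_le_sum fun i _ => hM2 i x).trans ?_)
    simp
  have hfM : ∀ x, |f x| ≤ 3 * M := fun x => (hM x).trans (by linarith)
  have hκ := integral_gaussWeight_pos
  set κ := ∫ z, gaussWeight z with hκd
  have hsm : ∀ s : ℝ, Continuous (fun z : Space => s • z) := fun s => by fun_prop
  have hav : ∀ g : Space → ℝ, Continuous g → (∀ x, |g x| ≤ 3 * M) → ∀ s : ℝ,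
      |κ⁻¹ * ∫ z, gaussWeight z * g (s • z)| ≤ 3 * M := by
    intro g hg hgM s
    have h1 : ‖∫ z, gaussWeight z * g (s • z)‖ ≤ ∫ z, gaussWeight z * (3 * M) := by
      refine norm_integral_le_of_norm_le (integrable_gaussWeight.mul_const _)
        (Eventually.of_forall fun z => ?_)
      rw [norm_mul, Real.norm_of_nonneg (gaussWeight_pos z).le]
      exact mul_le_mul_of_nonneg_left (hgM _) (gaussWeight_pos z).le
    rw [integral_mul_const, Real.norm_eq_abs, ← hκd] at h1
    rw [abs_mul, abs_of_pos (inv_pos.2 hκ), inv_mul_le_iff₀ hκ]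
    exact h1
  have hmeas : Measurable fun s : ℝ => κ⁻¹ * ∫ z, gaussWeight z * laplace f (s • z) := by
    refine Measurable.const_mul (StronglyMeasurable.measurable ?_) _
    refine StronglyMeasurable.integral_prod_right
      (f := fun (s : ℝ) z => gaussWeight z * laplace f (s • z)) (Continuous.stronglyMeasurable ?_)
    exact (continuous_gaussWeight.comp continuous_snd).mul
      (hlc.comp (continuous_fst.smul continuous_snd))
  -- F and H are the normalised Gaussian averages of f and Δf at dilation s. The heat equation gives
  -- F' = s H, and F 0 = f 0.
  have hmain := integral_radialWeight_mul_sub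
    (F := fun s => κ⁻¹ * ∫ z, gaussWeight z * f (s • z))
    (H := fun s => κ⁻¹ * ∫ z, gaussWeight z * laplace f (s • z))
    (fun s => ((hasDerivAt_integral_gaussWeight hf hM hM1 hM2 s).const_mul κ⁻¹).congr_deriv
      (by ring)) hmeas (hav f hf.continuous hfM) (hav _ hlc hlM)
  have h0 : κ⁻¹ * ∫ z, gaussWeight z * f ((0 : ℝ) • z) = f 0 := by
    simp only [zero_smul, integral_mul_const, ← hκd]
    field_simp
  simp only [h0] at hmain
  rw [integral_resolventMeasure (g := fun y => f y - laplace f y) (hf.continuous.sub hlc),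
    integral_prod, ← hmain]
  · refine integral_congr_ae (Eventually.of_forall fun s => ?_)
    simp only [resolventWeight, ← hκd]
    have i1 := integrable_gaussWeight_mul (hf.continuous.comp (hsm s)) (fun x => hM _)
    have i2 := integrable_gaussWeight_mul (hlc.comp (hsm s)) (fun x => hlM _)
    rw [← mul_sub]
    have := integral_sub i1 i2
    simp only [Function.comp_apply] at this
    rw [← this, ← integral_const_mul, ← integral_const_mul]
    congr 1; funext z; ring
  · refine integrable_resolventWeight.mul_bdd (c := 3 * M + 3 * M)
      ((hf.continuous.sub hlc).comp (continuous_fst.smul continuous_snd)).aestronglyMeasurable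
      (Eventually.of_forall fun p => ?_)
    exact (norm_sub_le _ _).trans (add_le_add (hfM _) (hlM _))

end Resolvent

/-! ### Functions of time and space -/

section JointContinuity

variable {F G : Type} [NormedAddCommGroup F] [NormedAddCommGroup G]

/-- Joint continuity on `I × ℝ³` and periodicity in space. -/
def JointCont (I : Set ℝ) (f : ℝ → Space → F) : Prop :=
  ContinuousOn (Function.uncurry f) (I ×ˢ univ) ∧
    ∀ t ∈ I, ∀ i : Fin 3, Function.Periodic (f t) (Pi.single i 1)

variable {I : Set ℝ} {f : ℝ → Space → F}

lemma JointCont.mono {J : Set ℝ} (hf : JointCont I f) (h : J ⊆ I) : JointCont J f :=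
  ⟨hf.1.mono (prod_mono h subset_rfl), fun t ht => hf.2 t (h ht)⟩

lemma JointCont.continuous (hf : JointCont I f) {t : ℝ} (ht : t ∈ I) : Continuous (f t) := by
  rw [← continuousOn_univ]
  exact hf.1.comp (f := fun x => (t, x)) (by fun_prop) fun x _ => ⟨ht, mem_univ _⟩

lemma JointCont.torusCk [NormedSpace ℝ F] (hf : JointCont I f) {t : ℝ} (ht : t ∈ I) : TorusCk 0 (f t) :=
  TorusCk.zero_iff.2 ⟨hf.continuous ht, hf.2 t ht⟩

lemma JointCont.comp_continuous (hf : JointCont I f) {φ : F → G} (hφ : Continuous φ) :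
    JointCont I fun t x => φ (f t x) :=
  ⟨hφ.comp_continuousOn hf.1, fun t ht i x => by simp only [hf.2 t ht i x]⟩

lemma JointCont.comp_continuousOn {φ : F → G} {s : Set F} (hφ : ContinuousOn φ s)
    (hf : JointCont I f) (hs : ∀ t ∈ I, ∀ x, f t x ∈ s) : JointCont I fun t x => φ (f t x) :=
  ⟨hφ.comp hf.1 fun p hp => hs p.1 hp.1 p.2, fun t ht i x => by simp only [hf.2 t ht i x]⟩

lemma JointCont.const (c : F) : JointCont I fun _ _ => c :=
  ⟨continuousOn_const, fun _ _ _ _ => rfl⟩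

lemma JointCont.congr {g : ℝ → Space → F} (hf : JointCont I f) (h : ∀ t ∈ I, ∀ x, g t x = f t x) :
    JointCont I g :=
  ⟨hf.1.congr fun p hp => h p.1 hp.1 p.2, fun t ht i x => by
    rw [h t ht, h t ht]; exact hf.2 t ht i x⟩

lemma JointCont.exists_bound (hI : IsCompact I) (hf : JointCont I f) :
    ∃ M, 0 ≤ M ∧ ∀ t ∈ I, ∀ x, ‖f t x‖ ≤ M := by
  obtain ⟨M, hM⟩ := (hI.prod (isCompact_Icc (a := (0 : Space)) (b := 1))).exists_bound_of_continuousOn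
    (hf.1.mono (prod_mono subset_rfl (subset_univ _)))
  refine ⟨max M 0, le_max_right _ _, fun t ht x => ?_⟩
  rw [← exists_mem_Icc_eq (hf.2 t ht) x]
  exact (hM (t, _) ⟨ht, fract_mem_Icc x⟩).trans (le_max_left _ _)

/-- Uniform bounds, and hence dominated convergence, are available on compact time intervals only.
Joint continuity is local in time, so it passes to the open interval. -/
lemma JointCont.of_Icc_subset {a b : ℝ} (h : ∀ c d, Icc c d ⊆ Ioo a b → JointCont (Icc c d) f) :
    JointCont (Ioo a b) f := by
  have key : ∀ t ∈ Ioo a b, ∃ c d, Icc c d ⊆ Ioo a b ∧ t ∈ Ioo c d := by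
    intro t ht
    obtain ⟨c, hc, hct⟩ := exists_between ht.1
    obtain ⟨d, hd, hdb⟩ := exists_between ht.2
    exact ⟨c, d, fun s hs => ⟨hc.trans_le hs.1, hs.2.trans_lt hdb⟩, hct, hd⟩
  refine ⟨fun p hp => ?_, fun t ht => ?_⟩
  · obtain ⟨c, d, hcd, ht⟩ := key p.1 hp.1
    have := (h c d hcd).1 p ⟨Ioo_subset_Icc_self ht, hp.2⟩
    refine (this.continuousAt ?_).continuousWithinAt
    exact prod_mem_nhds (Icc_mem_nhds ht.1 ht.2) univ_mem
  · obtain ⟨c, d, hcd, ht'⟩ := key t ht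
    exact (h c d hcd).2 t (Ioo_subset_Icc_self ht')

section Real

variable {f g : ℝ → Space → ℝ}

lemma JointCont.add (hf : JointCont I f) (hg : JointCont I g) :
    JointCont I fun t x => f t x + g t x :=
  ⟨hf.1.add hg.1, fun t ht i x => by simp only [hf.2 t ht i x, hg.2 t ht i x]⟩

lemma JointCont.sub (hf : JointCont I f) (hg : JointCont I g) :
    JointCont I fun t x => f t x - g t x :=
  ⟨hf.1.sub hg.1, fun t ht i x => by simp only [hf.2 t ht i x, hg.2 t ht i x]⟩

lemma JointCont.mul (hf : JointCont I f) (hg : JointCont I g) :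
    JointCont I fun t x => f t x * g t x :=
  ⟨hf.1.mul hg.1, fun t ht i x => by simp only [hf.2 t ht i x, hg.2 t ht i x]⟩

lemma JointCont.const_mul (c : ℝ) (hf : JointCont I f) : JointCont I fun t x => c * f t x :=
  (JointCont.const c).mul hf

lemma JointCont.sum {ι : Type} {s : Finset ι} {f : ι → ℝ → Space → ℝ}
    (hf : ∀ i ∈ s, JointCont I (f i)) : JointCont I fun t x => ∑ i ∈ s, f i t x :=
  ⟨by
    have := continuousOn_finsetSum s fun i hi => (hf i hi).1
    simpa [Function.uncurry_def] using this,
    fun t ht j x => Finset.sum_congr rfl fun i hi => (hf i hi).2 t ht j x⟩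

end Real

end JointContinuity

/-! ### Curves in `C^k` and their time derivatives -/

section TimeRegularity

variable {F G : Type} [NormedAddCommGroup F] [NormedSpace ℝ F] [NormedAddCommGroup G]
  [NormedSpace ℝ G] {k : ℕ} {I : Set ℝ}

lemma TendstoCk.clm {g : ℝ → Space → F} {l : Filter ℝ} {f : Space → F}
    (h : TendstoCk k g l f) (hg : ∀ᶠ s in l, ContDiff ℝ k (g s)) (hf : ContDiff ℝ k f)
    (L : F →L[ℝ] G) : TendstoCk k (fun s x => L (g s x)) l (fun x => L (f x)) := by
  intro j hj
  have e : ∀ f : Space → F, ContDiff ℝ k f → iteratedFDeriv ℝ j (fun x => L (f x))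
      = fun x => ContinuousLinearMap.compContinuousMultilinearMapL ℝ (fun _ : Fin j => Space) F G L
        (iteratedFDeriv ℝ j f x) := fun f hf => by
    funext x
    exact L.iteratedFDeriv_comp_left hf.contDiffAt (by exact_mod_cast hj)
  rw [e f hf]
  have h1 := ((ContinuousLinearMap.compContinuousMultilinearMapL ℝ (fun _ : Fin j => Space) F G
    L).uniformContinuous).comp_tendstoUniformly (h j hj)
  refine (tendstoUniformly_congr ?_).1 h1
  filter_upwards [hg] with s hs
  rw [e _ hs]
  rfl

/-- The j-th derivative of `fderiv ℝ f` is an isometric copy of the derivative of f of order j + 1,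
so uniform convergence transfers. -/
lemma TendstoCk.fderiv {g : ℝ → Space → F} {l : Filter ℝ} {f : Space → F}
    (h : TendstoCk (k + 1) g l f) : TendstoCk k (fun s => fderiv ℝ (g s)) l (fderiv ℝ f) := by
  intro j hj
  have e : ∀ f : Space → F, iteratedFDeriv ℝ j (_root_.fderiv ℝ f)
      = fun x => continuousMultilinearCurryRightEquiv' ℝ j Space F
        (iteratedFDeriv ℝ (j + 1) f x) := fun f => by
    funext x
    rw [iteratedFDeriv_succ_eq_comp_right]
    simp
  simp only [e]
  exact (continuousMultilinearCurryRightEquiv' ℝ j Space F).isometry.uniformContinuous.comp_tendstoUniformly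
    (h (j + 1) (by omega))

lemma TendstoCk.tendstoUniformly {g : ℝ → Space → F} {l : Filter ℝ} {f : Space → F}
    (h : TendstoCk k g l f) : TendstoUniformly g f l := by
  have h0 := h 0 (Nat.zero_le _)
  have := (continuousMultilinearCurryFin0 ℝ Space F).isometry.uniformContinuous.comp_tendstoUniformly
    h0
  have e : ∀ f : Space → F, (continuousMultilinearCurryFin0 ℝ Space F) ∘ iteratedFDeriv ℝ 0 f = f :=
    fun f => by funext x; simp
  simpa only [e] using this

lemma TendstoCk.of_le {l k : ℕ} {g : ℝ → Space → F} {p : Filter ℝ} {f : Space → F}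
    (h : TendstoCk k g p f) (hl : l ≤ k) : TendstoCk l g p f :=
  fun j hj => h j (hj.trans hl)

lemma C0Time.of_le {l : ℕ} {f : ℝ → Space → F} (hf : C0Time I k f) (h : l ≤ k) : C0Time I l f :=
  ⟨fun t ht => (hf.1 t ht).of_le h, fun t ht => (hf.2 t ht).of_le h⟩

lemma C0Time.clm {f : ℝ → Space → F} (hf : C0Time I k f) (L : F →L[ℝ] G) :
    C0Time I k fun t x => L (f t x) :=
  ⟨fun t ht => (hf.1 t ht).clm L, fun t ht => (hf.2 t ht).clm
    (eventually_mem_nhdsWithin.mono fun s hs => (hf.1 s hs).1) (hf.1 t ht).1 L⟩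

lemma C0Time.fderiv {f : ℝ → Space → F} (hf : C0Time I (k + 1) f) :
    C0Time I k fun t => fderiv ℝ (f t) :=
  ⟨fun t ht => (hf.1 t ht).fderiv, fun t ht => (hf.2 t ht).fderiv⟩

lemma C0Time.pd {f : ℝ → Space → ℝ} (hf : C0Time I (k + 1) f) (i : Fin 3) :
    C0Time I k fun t => pd i (f t) :=
  hf.fderiv.clm (ContinuousLinearMap.apply ℝ ℝ (Pi.single i (1 : ℝ)))

/-- Convergence as s → t is uniform in x, which together with continuity of f t gives continuity in
the pair by an ε/2 argument. -/
lemma C0Time.jointCont {f : ℝ → Space → F} (hf : C0Time I k f) : JointCont I f := by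
  refine ⟨fun p hp => ?_, fun t ht => (hf.1 t ht).2⟩
  obtain ⟨t, x⟩ := p
  have hu := (hf.2 t hp.1).tendstoUniformly
  have hc := (hf.1 t hp.1).continuous
  rw [ContinuousWithinAt, nhdsWithin_prod_eq, nhdsWithin_univ]
  rw [Metric.tendsto_nhds]
  intro ε hε
  have h1 := Metric.tendstoUniformly_iff.1 hu (ε / 2) (half_pos hε)
  have h2 := Metric.tendsto_nhds.1 (hc.tendsto x) (ε / 2) (half_pos hε)
  filter_upwards [h1.prod_mk h2] with q hq
  calc dist (f q.1 q.2) (f t x) ≤ dist (f q.1 q.2) (f t q.2) + dist (f t q.2) (f t x) :=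
        dist_triangle _ _ _
    _ < ε / 2 + ε / 2 := add_lt_add (by rw [dist_comm]; exact hq.1 q.2) hq.2
    _ = ε := add_halves ε

/-- `f ∈ C¹(I, C^k(𝕋³, F))` with time derivative `f'`. -/
def HasC1Time (I : Set ℝ) (k : ℕ) (f f' : ℝ → Space → F) : Prop :=
  (∀ t ∈ I, TorusCk k (f t)) ∧ C0Time I k f' ∧
    ∀ t ∈ I, TendstoCk k (fun s x => (s - t)⁻¹ • (f s x - f t x)) (𝓝[I \ {t}] t) (f' t)

lemma C1Time.exists_hasC1Time {f : ℝ → Space → F} (hf : C1Time I k f) : ∃ f', HasC1Time I k f f' :=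
  hf.2.imp fun _ h => ⟨hf.1, h⟩

lemma HasC1Time.clm {f f' : ℝ → Space → F} (hf : HasC1Time I k f f') (L : F →L[ℝ] G) :
    HasC1Time I k (fun t x => L (f t x)) fun t x => L (f' t x) := by
  refine ⟨fun t ht => (hf.1 t ht).clm L, hf.2.1.clm L, fun t ht => ?_⟩
  have h := (hf.2.2 t ht).clm (eventually_mem_nhdsWithin.mono fun s hs =>
    (contDiff_const (c := (s - t)⁻¹)).smul ((hf.1 s hs.1).1.sub (hf.1 t ht).1)) (hf.2.1.1 t ht).1 L
  simpa only [map_smul, map_sub] using h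

lemma HasC1Time.fderiv {f f' : ℝ → Space → F} (hf : HasC1Time I (k + 1) f f') :
    HasC1Time I k (fun t => fderiv ℝ (f t)) fun t => fderiv ℝ (f' t) := by
  refine ⟨fun t ht => (hf.1 t ht).fderiv, hf.2.1.fderiv, fun t ht j hj => ?_⟩
  refine (tendstoUniformly_congr ?_).1 ((hf.2.2 t ht).fderiv j hj)
  filter_upwards [eventually_mem_nhdsWithin] with s hs
  have e : _root_.fderiv ℝ (fun x => (s - t)⁻¹ • (f s x - f t x))
      = fun x => (s - t)⁻¹ • (_root_.fderiv ℝ (f s) x - _root_.fderiv ℝ (f t) x) := by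
    funext x
    have d1 := (hf.1 s hs.1).differentiable (Nat.le_add_left 1 k) x
    have d2 := (hf.1 t ht).differentiable (Nat.le_add_left 1 k) x
    exact ((d1.hasFDerivAt.sub d2.hasFDerivAt).const_smul _).fderiv
  exact congrArg (fun g => iteratedFDeriv ℝ j g) e

lemma HasC1Time.pd {f f' : ℝ → Space → ℝ} (hf : HasC1Time I (k + 1) f f') (i : Fin 3) :
    HasC1Time I k (fun t => pd i (f t)) fun t => pd i (f' t) :=
  hf.fderiv.clm (ContinuousLinearMap.apply ℝ ℝ (Pi.single i (1 : ℝ)))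

lemma HasC1Time.hasDerivAt {f f' : ℝ → Space → F} (hf : HasC1Time I k f f') (hI : IsOpen I)
    {t : ℝ} (ht : t ∈ I) (x : Space) : HasDerivAt (fun s => f s x) (f' t x) t := by
  rw [hasDerivAt_iff_tendsto_slope]
  have h := (hf.2.2 t ht).tendstoUniformly.tendsto_at x
  -- Openness of I turns the restricted filter of the difference quotients into the punctured
  -- neighbourhood filter of the slope.
  have e : 𝓝[I \ {t}] t = 𝓝[≠] t := by
    rw [sdiff_eq, inter_comm]
    exact nhdsWithin_inter_of_mem' (mem_nhdsWithin_of_mem_nhds (hI.mem_nhds ht))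
  rw [e] at h
  exact h

end TimeRegularity

/-! ### Integrals depending on parameters -/

section ParametricIntegral

variable {Y : Type} [TopologicalSpace Y] [MeasurableSpace Y] [OpensMeasurableSpace Y]
  {μ : Measure Y} [IsFiniteMeasure μ]

/-- The parameter space P is left general: it is space-time for the smoothing operator and a time
interval for the energy. -/
lemma JointCont.integral {K : Set ℝ} (hK : IsCompact K) {f : ℝ → Space → ℝ} (hf : JointCont K f)
    [SecondCountableTopology Y] {P : Type} [TopologicalSpace P] [FirstCountableTopology P]
    {s : Set P} {τ : P → ℝ} (hτ : ContinuousOn τ s) (hτK : ∀ p ∈ s, τ p ∈ K)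
    {φ : P → Y → Space} (hφ : ∀ p ∈ s, Continuous (φ p)) (hφ' : ∀ y, ContinuousOn (φ · y) s) :
    ContinuousOn (fun p => ∫ y, f (τ p) (φ p y) ∂μ) s := by
  obtain ⟨M, -, hM⟩ := hf.exists_bound hK
  refine continuousOn_of_dominated (μ := μ) (bound := fun _ => M)
    (fun p hp => ((hf.continuous (hτK p hp)).comp (hφ p hp)).aestronglyMeasurable)
    (fun p hp => Eventually.of_forall fun y => hM _ (hτK p hp) _) (integrable_const M)
    (Eventually.of_forall fun y => ?_)
  exact hf.1.comp (f := fun p => (τ p, φ p y)) (hτ.prodMk (hφ' y)) fun p hp =>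
    ⟨hτK p hp, mem_univ _⟩

/-- The derivative is dominated on a compact time interval around t. The map φ is an affine map y ↦
x + δ y for the smoothing operator and the identity for the energy. -/
lemma hasDerivAt_integral_of_jointCont [SecondCountableTopology Y] {a b : ℝ} {f f' : ℝ → Space → ℝ}
    (hf : ∀ t ∈ Ioo a b, TorusCk 0 (f t)) (hf' : JointCont (Ioo a b) f')
    (hd : ∀ t ∈ Ioo a b, ∀ x, HasDerivAt (fun s => f s x) (f' t x) t)
    {φ : Y → Space} (hφ : Continuous φ) {t : ℝ} (ht : t ∈ Ioo a b) :
    HasDerivAt (fun s => ∫ y, f s (φ y) ∂μ) (∫ y, f' t (φ y) ∂μ) t := by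
  obtain ⟨c, hc, hct⟩ := exists_between ht.1
  obtain ⟨d, htd, hd'⟩ := exists_between ht.2
  have hsub : Icc c d ⊆ Ioo a b := fun s hs => ⟨hc.trans_le hs.1, hs.2.trans_lt hd'⟩
  obtain ⟨M, -, hM⟩ := (hf'.mono hsub).exists_bound isCompact_Icc
  obtain ⟨N, hN⟩ := (hf t ht).exists_bound
  refine (hasDerivAt_integral_of_dominated_loc_of_deriv_le (μ := μ) (F := fun s y => f s (φ y))
    (F' := fun s y => f' s (φ y)) (s := Icc c d) (bound := fun _ => M)
    (Icc_mem_nhds hct htd) ?_ ?_ ?_ ?_ (integrable_const M) ?_).2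
  · filter_upwards [Ioo_mem_nhds ht.1 ht.2] with s hs
    exact ((hf s hs).continuous.comp hφ).aestronglyMeasurable
  · exact Integrable.of_bound ((hf t ht).continuous.comp hφ).aestronglyMeasurable N
      (Eventually.of_forall fun y => hN _)
  · exact ((hf'.continuous ht).comp hφ).aestronglyMeasurable
  · exact Eventually.of_forall fun y s hs => hM s hs _
  · exact Eventually.of_forall fun y s hs => hd s (hsub hs) _

end ParametricIntegral

/-! ### Solving the screened Poisson equation -/

section Smoothing

variable {F G : Type} [NormedAddCommGroup F] [NormedSpace ℝ F] [NormedAddCommGroup G]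
  [NormedSpace ℝ G]

/-- The solution operator `(1 - δ² Δ)⁻¹` of the screened Poisson equation. -/
noncomputable def smoothing (δ : ℝ) (f : Space → F) (x : Space) : F :=
  ∫ y, f (x + δ • y) ∂resolventMeasure

variable {δ : ℝ} {k : ℕ}

lemma continuous_add_smul (δ : ℝ) (x : Space) : Continuous fun y : Space => x + δ • y := by
  fun_prop

lemma TorusCk.integrable_shift [CompleteSpace F] {f : Space → F} (hf : TorusCk k f) (x : Space) :
    Integrable (fun y => f (x + δ • y)) resolventMeasure := by
  obtain ⟨M, hM⟩ := hf.exists_bound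
  exact Integrable.of_bound (hf.continuous.comp (continuous_add_smul δ x)).aestronglyMeasurable M
    (Eventually.of_forall fun y => hM _)

lemma smoothing_periodic {f : Space → F} (hf : ∀ i : Fin 3, Function.Periodic f (Pi.single i 1))
    (i : Fin 3) : Function.Periodic (smoothing δ f) (Pi.single i 1) := by
  intro x
  simp only [smoothing]
  congr 1; funext y
  rw [add_right_comm]; exact hf i _

lemma hasFDerivAt_smoothing [CompleteSpace F] {f : Space → F} (hf : TorusCk 1 f) (x : Space) :
    HasFDerivAt (smoothing δ f) (smoothing δ (fderiv ℝ f) x) x := by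
  obtain ⟨M, hM⟩ := (TorusCk.fderiv (k := 0) hf).exists_bound
  refine hasFDerivAt_integral_of_dominated_of_fderiv_le (F := fun x y => f (x + δ • y))
    (F' := fun x y => fderiv ℝ f (x + δ • y)) (s := univ) (bound := fun _ => M) univ_mem
    (Eventually.of_forall fun x => (hf.integrable_shift x).1) (hf.integrable_shift x)
    ((TorusCk.fderiv (k := 0) hf).integrable_shift x).1
    (Eventually.of_forall fun y x _ => hM _) (integrable_const M)
    (Eventually.of_forall fun y x _ => ?_)
  exact (hasFDerivAt_comp_add_right (δ • y)).2 ((hf.differentiable le_rfl) (x + δ • y)).hasFDerivAt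

lemma continuous_smoothing [CompleteSpace F] {f : Space → F} (hf : TorusCk k f) :
    Continuous (smoothing δ f) := by
  obtain ⟨M, hM⟩ := hf.exists_bound
  refine continuous_of_dominated (bound := fun _ => M) (fun x => (hf.integrable_shift x).1)
    (fun x => Eventually.of_forall fun y => hM _) (integrable_const M)
    (Eventually.of_forall fun y => hf.continuous.comp (by fun_prop))

lemma TorusCk.smoothing [CompleteSpace F] {f : Space → F} (h : TorusCk k f) :
    TorusCk k (NSK.smoothing δ f) := by
  refine ⟨?_, smoothing_periodic h.2⟩
  -- The codomain varies because the derivative of the smoothing is the smoothing of the derivative,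
  -- which takes values in linear maps.
  induction k generalizing F with
  | zero => simpa using continuous_smoothing h
  | succ k ih =>
    have h1 := fun x => hasFDerivAt_smoothing (δ := δ) (h.of_le (Nat.le_add_left 1 k)) x
    push_cast
    exact contDiff_succ_iff_hasFDerivAt.2 ⟨_, ih h.fderiv, h1⟩

variable {f : Space → ℝ}

lemma pd_smoothing (hf : TorusCk 1 f) (i : Fin 3) :
    pd i (smoothing δ f) = smoothing δ (pd i f) := by
  funext x
  rw [pd, (hasFDerivAt_smoothing hf x).fderiv, smoothing,
    ContinuousLinearMap.integral_apply ((TorusCk.fderiv (k := 0) hf).integrable_shift x)]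
  rfl

lemma laplace_smoothing (hf : TorusCk 2 f) :
    laplace (smoothing δ f) = smoothing δ (laplace f) := by
  funext x
  simp only [laplace, smoothing]
  rw [integral_finsetSum _ fun i _ =>
    (TorusCk.pd (k := 0) (TorusCk.pd (k := 1) hf i) i).integrable_shift x]
  refine Finset.sum_congr rfl fun i _ => ?_
  rw [pd_smoothing (hf.of_le one_le_two), pd_smoothing (TorusCk.pd (k := 1) hf i)]
  rfl

lemma abs_smoothing_le {M : ℝ} (hM : ∀ x, |f x| ≤ M) (x : Space) : |smoothing δ f x| ≤ M := by
  simpa [smoothing] using norm_integral_le_of_norm_le_const (μ := resolventMeasure)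
    (f := fun y => f (x + δ • y)) (Eventually.of_forall fun y => hM _)

/-- The first absolute moment of the resolvent kernel. -/
noncomputable def resolventMoment : ℝ := ∫ y, ‖y‖ ∂resolventMeasure

/-- The difference is the average of f(x + δy) - f(x), each at most L δ ‖y‖. With δ = α^(-1/2) this
is the source of the convergence rate. -/
lemma abs_smoothing_sub_le (hf : TorusCk k f) (hδ : 0 ≤ δ) {L : ℝ}
    (hL : ∀ x y, |f x - f y| ≤ L * ‖x - y‖) (x : Space) :
    |smoothing δ f x - f x| ≤ L * δ * resolventMoment := by
  have e : smoothing δ f x - f x = ∫ y, (f (x + δ • y) - f x) ∂resolventMeasure := by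
    rw [integral_sub (hf.integrable_shift x) (integrable_const _)]
    simp [smoothing]
  rw [e, resolventMoment, ← integral_const_mul]
  refine norm_integral_le_of_norm_le (f := fun y => f (x + δ • y) - f x) (integrable_norm_resolventMeasure.const_mul _)
    (Eventually.of_forall fun y => ?_)
  refine (hL _ _).trans_eq ?_
  rw [add_sub_cancel_left, norm_smul, Real.norm_of_nonneg hδ]
  ring

lemma pd_comp_affine (hf : Differentiable ℝ f) (x : Space) (i : Fin 3) :
    pd i (fun y => f (x + δ • y)) = fun y => δ * pd i f (x + δ • y) := by
  funext y
  have h1 := (hf (x + δ • y)).hasFDerivAt.comp y (((hasFDerivAt_id y).const_smul δ).const_add x)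
  have h2 : HasFDerivAt (fun y => f (x + δ • y)) _ y := h1
  rw [pd, h2.fderiv]
  simp [pd]

/-- `smoothing δ f` solves the screened Poisson equation. -/
lemma smoothing_sub_laplace (hf : TorusCk 2 f) (x : Space) :
    smoothing δ f x - δ ^ 2 * laplace (smoothing δ f) x = f x := by
  have hf1 : ∀ i, TorusCk 1 (pd i f) := fun i => TorusCk.pd (k := 1) hf i
  have hf2 : ∀ i, TorusCk 0 (pd i (pd i f)) := fun i => TorusCk.pd (k := 0) (hf1 i) i
  have hl : TorusCk 0 (laplace f) := TorusCk.laplace (k := 0) hf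
  -- The kernel identity holds at the origin and at unit scale; it is applied to the rescaled
  -- translate g, whose Laplacian is δ² Δf(x + δy).
  set g : Space → ℝ := fun y => f (x + δ • y) with hg
  have hgd : ContDiff ℝ 2 g := hf.1.comp (by fun_prop)
  have e1 : ∀ i, pd i g = fun y => δ * pd i f (x + δ • y) := fun i =>
    pd_comp_affine (hf.differentiable one_le_two) x i
  have e2 : ∀ i, pd i (pd i g) = fun y => δ ^ 2 * pd i (pd i f) (x + δ • y) := fun i => by
    have hd : Differentiable ℝ fun y => pd i f (x + δ • y) :=
      ((hf1 i).differentiable le_rfl).comp (by fun_prop)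
    rw [e1, pd_const_mul δ hd, pd_comp_affine ((hf1 i).differentiable le_rfl)]
    funext y; ring
  have e3 : laplace g = fun y => δ ^ 2 * laplace f (x + δ • y) := by
    funext y
    simp only [laplace, e2, Finset.mul_sum]
  obtain ⟨M0, h0⟩ := hf.exists_bound
  choose M1 h1 using fun i => (hf1 i).exists_bound
  choose M2 h2 using fun i => (hf2 i).exists_bound
  have hb : ∀ (M : Fin 3 → ℝ) i, |M i| ≤ ∑ i, |M i| := fun M i =>
    Finset.single_le_sum (f := fun i => |M i|) (fun i _ => abs_nonneg _) (Finset.mem_univ i)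
  have hS1 : 0 ≤ ∑ i, |M1 i| := Finset.sum_nonneg fun i _ => abs_nonneg _
  have hS2 : 0 ≤ ∑ i, |M2 i| := Finset.sum_nonneg fun i _ => abs_nonneg _
  -- The value of M is a crude common bound for g and its first and second partial derivatives.
  have key := integral_resolventMeasure_sub_laplace hgd
    (M := |M0| + |δ| * (∑ i, |M1 i|) + δ ^ 2 * ∑ i, |M2 i|) (fun y => ?_) (fun i y => ?_)
    (fun i y => ?_)
  · have h3 := integral_sub (hf.integrable_shift (δ := δ) x)
      ((hl.integrable_shift (δ := δ) x).const_mul (δ ^ 2))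
    rw [integral_const_mul] at h3
    rw [laplace_smoothing hf]
    simp only [e3] at key
    simp only [smoothing]
    rw [← h3, key, hg]
    simp
  · have := (h0 (x + δ • y)).trans (le_abs_self M0)
    have h4 : 0 ≤ |δ| * ∑ i, |M1 i| := by positivity
    have h5 : 0 ≤ δ ^ 2 * ∑ i, |M2 i| := by positivity
    simp only [hg]
    rw [Real.norm_eq_abs] at this
    linarith
  · rw [e1, abs_mul]
    have := ((h1 i (x + δ • y)).trans (le_abs_self _)).trans (hb M1 i)
    have h4 : |δ| * |pd i f (x + δ • y)| ≤ |δ| * ∑ i, |M1 i| :=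
      mul_le_mul_of_nonneg_left this (abs_nonneg _)
    have h5 : 0 ≤ δ ^ 2 * ∑ i, |M2 i| := by positivity
    have h6 := abs_nonneg M0
    linarith
  · rw [e2, abs_mul, abs_of_nonneg (sq_nonneg δ)]
    have := ((h2 i (x + δ • y)).trans (le_abs_self _)).trans (hb M2 i)
    have h4 : δ ^ 2 * |pd i (pd i f) (x + δ • y)| ≤ δ ^ 2 * ∑ i, |M2 i| :=
      mul_le_mul_of_nonneg_left this (sq_nonneg _)
    have h5 : 0 ≤ |δ| * ∑ i, |M1 i| := by positivity
    have h6 := abs_nonneg M0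
    linarith

end Smoothing

/-! ### Smoothing of time-dependent functions -/

section SmoothingTime

variable {δ : ℝ} {f f' : ℝ → Space → ℝ}

lemma JointCont.smoothing_of_isCompact {K : Set ℝ} (hK : IsCompact K) (hf : JointCont K f) :
    JointCont K fun t => smoothing δ (f t) := by
  refine ⟨?_, fun t ht => smoothing_periodic (hf.2 t ht)⟩
  exact hf.integral hK (μ := resolventMeasure) (s := K ×ˢ univ) (τ := Prod.fst)
    (φ := fun p y => p.2 + δ • y) continuousOn_fst (fun p hp => hp.1)
    (fun p _ => continuous_add_smul δ p.2) (fun y => by fun_prop)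

lemma JointCont.smoothing_Ioo {a b : ℝ} (hf : JointCont (Ioo a b) f) :
    JointCont (Ioo a b) fun t => smoothing δ (f t) :=
  JointCont.of_Icc_subset fun _ _ h => (hf.mono h).smoothing_of_isCompact isCompact_Icc

lemma hasDerivAt_smoothing {a b : ℝ} (hf : ∀ t ∈ Ioo a b, TorusCk 0 (f t))
    (hf' : JointCont (Ioo a b) f')
    (hd : ∀ t ∈ Ioo a b, ∀ x, HasDerivAt (fun s => f s x) (f' t x) t) {t : ℝ} (ht : t ∈ Ioo a b)
    (x : Space) : HasDerivAt (fun s => smoothing δ (f s) x) (smoothing δ (f' t) x) t :=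
  hasDerivAt_integral_of_jointCont hf hf' hd (continuous_add_smul δ x) ht

end SmoothingTime

/-! ### Balance laws for the relative energy at a fixed time -/

section PointwiseIdentities

variable {a b w : Space → ℝ} {u v : Fin 3 → Space → ℝ}

lemma sum_pd_mul {φ : Space → ℝ} {V : Fin 3 → Space → ℝ} (hφ : Differentiable ℝ φ)
    (hV : ∀ j, Differentiable ℝ (V j)) (x : Space) :
    ∑ j, pd j (fun y => φ y * V j y) x = ∑ j, pd j φ x * V j x + φ x * ∑ j, pd j (V j) x := by
  rw [Finset.mul_sum, ← Finset.sum_add_distrib]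
  exact Finset.sum_congr rfl fun j _ => by rw [pd_mul hφ (hV j)]

lemma pd_sq {φ : Space → ℝ} (hφ : Differentiable ℝ φ) (j : Fin 3) (x : Space) :
    pd j (fun y => φ y ^ 2) x = 2 * φ x * pd j φ x := by
  simp only [pow_two]
  rw [pd_mul hφ hφ]
  ring

lemma pd_sum_sq {V : Fin 3 → Space → ℝ} (hV : ∀ j, Differentiable ℝ (V j)) (j : Fin 3)
    (x : Space) : pd j (fun y => ∑ i, V i y ^ 2) x = ∑ i, 2 * V i x * pd j (V i) x := by
  rw [pd_sum (f := fun i y => V i y ^ 2) fun i _ => (hV i).fun_pow 2]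
  exact Finset.sum_congr rfl fun i _ => pd_sq (hV i) j x

/-- Kinetic part of the relative energy balance. -/
lemma kinetic_identity {π e W a' : Space → ℝ} {U g v' : Fin 3 → Space → ℝ}
    {S : Fin 3 → Fin 3 → Space → ℝ} {Ck : ℝ} (ha : Differentiable ℝ a) (hb : Differentiable ℝ b)
    (hπ : Differentiable ℝ π) (he : Differentiable ℝ e) (hW : Differentiable ℝ W)
    (hU : ∀ i, Differentiable ℝ (U i)) (hv : ∀ i, Differentiable ℝ (v i))
    (hS : ∀ i j, Differentiable ℝ (S i j)) {x : Space}
    (hmass : a' x = -∑ j, pd j (fun y => a y * U j y) x)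
    (hmom : ∀ i, a x * v' i x = -pd i π x + ∑ j, pd j (S i j) x - (a x - b x) * g i x
      + Ck * a x * pd i W x + Ck * a x * pd i e x - a x * ∑ j, U j x * pd j (v i) x
      - a x * ∑ j, v j x * pd j (u i) x) :
    1 / 2 * a' x * ∑ i, v i x ^ 2 + a x * ∑ i, v i x * v' i x
      = (π x * ∑ i, pd i (v i) x - ∑ i, ∑ j, S i j x * pd j (v i) x
          - (a x - b x) * ∑ i, g i x * v i x + Ck * (a x - b x) * ∑ i, v i x * pd i e x
          - Ck * e x * ∑ j, pd j (fun y => b y * v j y) x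
          - a x * ∑ i, ∑ j, v i x * v j x * pd j (u i) x
          - Ck * W x * ∑ j, pd j (fun y => a y * v j y) x)
        + (-(1 / 2) * ∑ j, pd j (fun y => (∑ i, v i y ^ 2) * (a y * U j y)) x
          - ∑ j, pd j (fun y => π y * v j y) x + ∑ i, ∑ j, pd j (fun y => v i y * S i j y) x
          + Ck * ∑ j, pd j (fun y => W y * (a y * v j y)) x
          + Ck * ∑ j, pd j (fun y => e y * (b y * v j y)) x) := by
  -- Every flux is expanded by the product rule. For the consistency error, a v·∇e is split as (a -
  -- b) v·∇e + b v·∇e: as ∇e is bounded but not small, the part with b is integrated by parts so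
  -- that e itself appears.
  have hQ : Differentiable ℝ fun y => ∑ i, v i y ^ 2 :=
    Differentiable.fun_sum fun i _ => (hv i).fun_pow 2
  rw [sum_pd_mul hQ fun j => ha.fun_mul (hU j), sum_pd_mul hπ hv, sum_pd_mul hW fun j => ha.fun_mul (hv j),
    sum_pd_mul he fun j => hb.fun_mul (hv j)]
  have h3 : ∀ i, ∑ j, pd j (fun y => v i y * S i j y) x
      = ∑ j, pd j (v i) x * S i j x + v i x * ∑ j, pd j (S i j) x := fun i =>
    sum_pd_mul (hv i) (hS i) x
  simp only [h3, pd_sum_sq hv, hmass]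
  simp only [Finset.sum_add_distrib]
  have h4 : a x * ∑ i, v i x * v' i x = ∑ i, v i x * (a x * v' i x) := by
    rw [Finset.mul_sum]; exact Finset.sum_congr rfl fun i _ => by ring
  rw [h4]
  simp only [hmom]
  simp only [Fin.sum_univ_three]
  ring

/-- Capillary part of the relative energy balance. -/
lemma capillary_identity {r w' r' : Space → ℝ} {α : ℝ} (hw : TorusCk 3 w)
    (hr : Differentiable ℝ r) (hw' : Differentiable ℝ w') (hu : ∀ i, TorusCk 2 (u i)) {x : Space}
    (hz : ∀ x, laplace w x = α * (w x - r x)) :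
    (α * (w x - r x) * (w' x - r' x) + ∑ i, pd i w x * pd i w' x)
        + laplace w x * (r' x + ∑ j, pd j (fun y => r y * u j y) x)
      = (-(w x * ∑ i, pd i (fun y => ∑ j, pd j (u j) y) x * pd i w x)
          - 1 / 2 * (∑ j, pd j (u j) x) * ∑ i, pd i w x ^ 2
          - ∑ i, ∑ j, pd i (u j) x * pd j w x * pd i w x
          + 1 / 2 * α * (w x - r x) ^ 2 * ∑ j, pd j (u j) x
          - α * (w x - r x) ^ 2 * ∑ j, pd j (u j) x)
        + (∑ j, pd j (fun y => w' y * pd j w y) x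
          + ∑ j, pd j (fun y => (∑ i, pd i (fun z => w z * u i z) y) * pd j w y) x
          - 1 / 2 * ∑ j, pd j (fun y => (∑ i, pd i w y ^ 2) * u j y) x
          - 1 / 2 * α * ∑ j, pd j (fun y => (w y - r y) ^ 2 * u j y) x) := by
  have hwd := hw.differentiable (by norm_num)
  have hw1 : ∀ i, TorusCk 2 (pd i w) := fun i => TorusCk.pd (k := 2) hw i
  have hw1d := fun i => (hw1 i).differentiable one_le_two
  have hud := fun i => (hu i).differentiable one_le_two
  have hu1 : ∀ i j, TorusCk 1 (pd i (u j)) := fun i j => TorusCk.pd (k := 1) (hu j) i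
  have hu1d := fun i j => (hu1 i j).differentiable le_rfl
  have hzd : Differentiable ℝ fun y => w y - r y := hwd.fun_sub hr
  have hD : ∀ y, ∑ i, pd i (fun z => w z * u i z) y
      = ∑ i, pd i w y * u i y + w y * ∑ i, pd i (u i) y := fun y => sum_pd_mul hwd hud y
  have hdu : Differentiable ℝ fun y => ∑ j, pd j (u j) y :=
    Differentiable.fun_sum fun j _ => hu1d j j
  have hA : Differentiable ℝ fun y => ∑ i, pd i w y * u i y :=
    Differentiable.fun_sum fun i _ => (hw1d i).fun_mul (hud i)
  have hB : Differentiable ℝ fun y => w y * ∑ i, pd i (u i) y := hwd.fun_mul hdu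
  -- Second derivatives of w are put in the order ∂_i ∂_j. Then ∑ u_i ∂_i∂_j w ∂_j w is the
  -- transport of ½|∇w|² by u and cancels against the divergence of ½|∇w|² u.
  have hDp : ∀ j, pd j (fun y => ∑ i, pd i w y * u i y + w y * ∑ i, pd i (u i) y) x
      = ∑ i, (pd i (pd j w) x * u i x + pd i w x * pd j (u i) x)
        + (pd j w x * ∑ i, pd i (u i) x + w x * pd j (fun y => ∑ i, pd i (u i) y) x) := by
    intro j
    rw [pd_add hA hB, pd_mul hwd hdu, pd_sum fun i _ => (hw1d i).fun_mul (hud i)]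
    refine congrArg₂ (· + ·) (Finset.sum_congr rfl fun i _ => ?_) rfl
    rw [pd_mul (hw1d i) (hud i), pd_comm (hw.1.of_le (by norm_num)) j i]
  have hlap : laplace w x = ∑ i, pd i (pd i w) x := rfl
  have hz' := hz x
  simp only [hD]
  rw [sum_pd_mul hr hud, sum_pd_mul hw' hw1d, sum_pd_mul (hA.fun_add hB) hw1d,
    sum_pd_mul (Differentiable.fun_sum fun i _ => (hw1d i).fun_pow 2) hud,
    sum_pd_mul (hzd.fun_pow 2) hud]
  simp only [hDp, pd_sum_sq hw1d, pd_sq hzd, pd_sub hwd hr]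
  rw [← hlap, hz']
  have h5 := hz'
  rw [hlap] at h5
  simp only [Fin.sum_univ_three] at h5 ⊢
  ring

/-- Density part of the relative energy balance. -/
lemma density_identity {r r' : Space → ℝ} (hr : Differentiable ℝ r) (hb : Differentiable ℝ b)
    (hu : ∀ i, Differentiable ℝ (u i)) (hv : ∀ i, Differentiable ℝ (v i)) {x : Space}
    (hr' : r' x = -∑ j, pd j (fun y => (r y + b y) * v j y) x - ∑ j, pd j (fun y => r y * u j y) x) :
    r x * r' x = (-(r x * ∑ j, pd j (fun y => b y * v j y) x) - 1 / 2 * r x ^ 2 * ∑ j, pd j (v j) x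
        - 1 / 2 * r x ^ 2 * ∑ j, pd j (u j) x)
      + (-(1 / 2) * ∑ j, pd j (fun y => r y ^ 2 * v j y) x
        - 1 / 2 * ∑ j, pd j (fun y => r y ^ 2 * u j y) x) := by
  rw [hr', sum_pd_mul (hr.fun_add hb) hv, sum_pd_mul hr hu, sum_pd_mul hb hv,
    sum_pd_mul (hr.fun_pow 2) hv, sum_pd_mul (hr.fun_pow 2) hu]
  simp only [pd_sq hr, pd_add hr hb, Fin.sum_univ_three]
  ring

end PointwiseIdentities

/-! ### Growth of the relative energy at a fixed time -/

section MeanZero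

/-- Continuous functions with vanishing integral over the torus. -/
def MeanZero (f : Space → ℝ) : Prop := Continuous f ∧ ∫ x, f x ∂torusMeasure = 0

variable {f g : Space → ℝ}

lemma MeanZero.add (hf : MeanZero f) (hg : MeanZero g) : MeanZero fun x => f x + g x :=
  ⟨hf.1.add hg.1, by
    rw [integral_add (integrable_torus hf.1) (integrable_torus hg.1), hf.2, hg.2, add_zero]⟩

lemma MeanZero.const_mul (c : ℝ) (hf : MeanZero f) : MeanZero fun x => c * f x :=
  ⟨continuous_const.mul hf.1, by rw [integral_const_mul, hf.2, mul_zero]⟩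

lemma MeanZero.sub (hf : MeanZero f) (hg : MeanZero g) : MeanZero fun x => f x - g x := by
  simpa [sub_eq_add_neg] using hf.add (hg.const_mul (-1))

lemma MeanZero.sum {f : Fin 3 → Space → ℝ} (hf : ∀ i, MeanZero (f i)) :
    MeanZero fun x => ∑ i, f i x :=
  ⟨continuous_finsetSum _ fun i _ => (hf i).1, by
    rw [integral_finsetSum _ fun i _ => integrable_torus (hf i).1]
    exact Finset.sum_eq_zero fun i _ => (hf i).2⟩

lemma meanZero_divergence {V : Fin 3 → Space → ℝ} (hV : ∀ j, TorusCk 1 (V j)) :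
    MeanZero fun x => ∑ j, pd j (V j) x :=
  ⟨continuous_finsetSum _ fun j _ => (TorusCk.pd (k := 0) (hV j) j).continuous,
    integral_sum_pd_eq_zero hV⟩

/-- The divergence terms D are discarded before estimating, so Young's inequality need only hold
pointwise for X - D. -/
lemma integral_le_of_eq_add_meanZero {X D B : Space → ℝ} (hX : Continuous X) (hD : MeanZero D)
    (hB : Continuous B) (h : ∀ x, X x - D x ≤ B x) :
    ∫ x, X x ∂torusMeasure ≤ ∫ x, B x ∂torusMeasure := by
  have h1 : ∫ x, (X x - D x) ∂torusMeasure = ∫ x, X x ∂torusMeasure := by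
    rw [integral_sub (integrable_torus hX) (integrable_torus hD.1), hD.2, sub_zero]
  rw [← h1]
  exact integral_mono (integrable_torus (hX.sub hD.1)) (integrable_torus hB) h

end MeanZero

/-! ### Algebraic inequalities: dissipation and absorption -/

section Young

lemma mul_mul_le_of_abs_le {c M y z : ℝ} (hc : |c| ≤ M) : |y * (c * z)| ≤ M / 2 * (y ^ 2 + z ^ 2) := by
  rw [abs_mul, abs_mul]
  have h1 : |y| * (|c| * |z|) ≤ M * (|y| * |z|) := by
    nlinarith [mul_nonneg (abs_nonneg y) (abs_nonneg z)]
  have hM : 0 ≤ M := (abs_nonneg c).trans hc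
  have h2 : |y| * |z| ≤ (y ^ 2 + z ^ 2) / 2 := by
    nlinarith [sq_nonneg (|y| - |z|), sq_abs y, sq_abs z]
  nlinarith

lemma abs_mul_sum_le {c z : Fin 3 → ℝ} {M y : ℝ} (hc : ∀ i, |c i| ≤ M) :
    |y * ∑ i, c i * z i| ≤ M / 2 * (3 * y ^ 2 + ∑ i, z i ^ 2) := by
  rw [Finset.mul_sum]
  refine (Finset.abs_sum_le_sum_abs _ _).trans
    ((Finset.sum_le_sum fun i _ => mul_mul_le_of_abs_le (hc i)).trans_eq ?_)
  simp only [Fin.sum_univ_three]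
  ring

lemma abs_sum_sum_le {c : Fin 3 → Fin 3 → ℝ} {z : Fin 3 → ℝ} {M : ℝ} (hc : ∀ i j, |c i j| ≤ M) :
    |∑ i, ∑ j, z i * (c i j * z j)| ≤ 3 * M * ∑ i, z i ^ 2 := by
  refine (Finset.abs_sum_le_sum_abs _ _).trans ((Finset.sum_le_sum fun i _ =>
    (Finset.abs_sum_le_sum_abs _ _).trans (Finset.sum_le_sum fun j _ =>
      mul_mul_le_of_abs_le (hc i j))).trans_eq ?_)
  simp only [Fin.sum_univ_three]
  ring

lemma abs_mul_le_of_sq {c M y : ℝ} (hc : |c| ≤ M) (hy : 0 ≤ y) : |c * y| ≤ M * y := by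
  rw [abs_mul, abs_of_nonneg hy]
  exact mul_le_mul_of_nonneg_right hc hy

/-- Dissipation controls the divergence of the velocity difference. -/
lemma dissipation_lower_bound {lam mu : ℝ} (hmu : 0 < mu) (G : Fin 3 → Fin 3 → ℝ) :
    (lam + 2 / 3 * mu) * (∑ i, G i i) ^ 2
      ≤ ∑ i, ∑ j, (lam * (∑ k, G k k) * (if i = j then 1 else 0) + mu * (G i j + G j i)) * G i j := by
  -- The excess is 2 mu times the squared norm of the trace-free symmetric part of G; the trace part
  -- contributes the 2/3.
  have key : ∑ i, ∑ j,
        (lam * (∑ k, G k k) * (if i = j then 1 else 0) + mu * (G i j + G j i)) * G i j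
      - (lam + 2 / 3 * mu) * (∑ i, G i i) ^ 2
      = mu * ((G 0 1 + G 1 0) ^ 2 + (G 0 2 + G 2 0) ^ 2 + (G 1 2 + G 2 1) ^ 2
        + 2 / 3 * ((G 0 0 - G 1 1) ^ 2 + (G 0 0 - G 2 2) ^ 2 + (G 1 1 - G 2 2) ^ 2)) := by
    simp [Fin.sum_univ_three]
    ring
  have : 0 ≤ mu * ((G 0 1 + G 1 0) ^ 2 + (G 0 2 + G 2 0) ^ 2 + (G 1 2 + G 2 1) ^ 2
        + 2 / 3 * ((G 0 0 - G 1 1) ^ 2 + (G 0 0 - G 2 2) ^ 2 + (G 1 1 - G 2 2) ^ 2)) := by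
    positivity
  linarith

/-- Terms linear in the divergence of the velocity difference are absorbed by dissipation. -/
lemma absorb_divergence {M ν Ck b r π e d : ℝ} (hν : 0 < ν) (hCk : 0 ≤ Ck)
    (hb : |b| ≤ M) (hr : |r| ≤ M) (hπ : |π| ≤ M * |r|) :
    π * d - Ck * e * (b * d) - r * (b * d) - 1 / 2 * r ^ 2 * d - ν * d ^ 2
      ≤ 4 * M ^ 2 / ν * r ^ 2 + Ck ^ 2 * M ^ 2 / ν * e ^ 2 := by
  -- All terms share the factor d, so s d - ν d² ≤ s²/(4ν) by completing the square. In the bound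
  -- for s, 5/2 = 1 + 1 + 1/2 comes from π, r b and ½ r², the last being linear in |r| because |r| ≤
  -- M. The final constants are rounded up.
  set s := π - Ck * e * b - r * b - 1 / 2 * r ^ 2 with hs
  have hs1 : |s| ≤ 5 / 2 * (M * |r|) + Ck * (M * |e|) := by
    have h1 : |Ck * e * b| ≤ Ck * (M * |e|) := by
      rw [abs_mul, abs_mul, abs_of_nonneg hCk, mul_assoc, mul_comm M]
      gcongr
    have h2 : |r * b| ≤ M * |r| := by
      rw [abs_mul, mul_comm M]; gcongr
    have h3 : |1 / 2 * r ^ 2| ≤ 1 / 2 * (M * |r|) := by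
      rw [abs_of_nonneg (by positivity), ← sq_abs, pow_two]
      gcongr
    have h4 := abs_sub (π - Ck * e * b - r * b) (1 / 2 * r ^ 2)
    have h5 := abs_sub (π - Ck * e * b) (r * b)
    have h6 := abs_sub π (Ck * e * b)
    linarith
  have hs2 : s ^ 2 ≤ 25 / 2 * (M ^ 2 * r ^ 2) + 2 * (Ck ^ 2 * M ^ 2 * e ^ 2) := by
    have h1 : s ^ 2 ≤ (5 / 2 * (M * |r|) + Ck * (M * |e|)) ^ 2 := by
      rw [← sq_abs]
      exact pow_le_pow_left₀ (abs_nonneg _) hs1 2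
    have h2 := sq_nonneg (5 / 2 * (M * |r|) - Ck * (M * |e|))
    have h3 : (M * |r|) ^ 2 = M ^ 2 * r ^ 2 := by rw [mul_pow, sq_abs]
    have h4 : (Ck * (M * |e|)) ^ 2 = Ck ^ 2 * M ^ 2 * e ^ 2 := by
      rw [mul_pow, mul_pow, sq_abs]; ring
    generalize M * |r| = x at *
    generalize Ck * (M * |e|) = y at *
    rw [← h3, ← h4]
    linarith
  have h5 : s * d - ν * d ^ 2 ≤ s ^ 2 / (4 * ν) := by
    rw [le_div_iff₀ (by positivity)]
    linarith [sq_nonneg (s - 2 * ν * d)]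
  have h6 : s ^ 2 / (4 * ν) ≤ 4 * M ^ 2 / ν * r ^ 2 + Ck ^ 2 * M ^ 2 / ν * e ^ 2 := by
    have e1 : 4 * M ^ 2 / ν * r ^ 2 + Ck ^ 2 * M ^ 2 / ν * e ^ 2
        = (16 * (M ^ 2 * r ^ 2) + 4 * (Ck ^ 2 * M ^ 2 * e ^ 2)) / (4 * ν) := by
      field_simp
      ring
    rw [e1]
    refine div_le_div_of_nonneg_right ?_ (by positivity)
    have : 0 ≤ M ^ 2 * r ^ 2 := by positivity
    have : 0 ≤ Ck ^ 2 * M ^ 2 * e ^ 2 := by positivity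
    linarith
  have h7 : π * d - Ck * e * (b * d) - r * (b * d) - 1 / 2 * r ^ 2 * d = s * d := by
    rw [hs]; ring
  linarith

/-- The growth constant of the relative energy. -/
noncomputable def rateConst (M ν Ck : ℝ) : ℝ :=
  4 * M ^ 2 / ν + Ck ^ 2 * M ^ 2 / ν + 4 * M + 3 * M ^ 2 + 5 * (Ck * M)

lemma rateConst_nonneg {M ν Ck : ℝ} (hM : 0 ≤ M) (hν : 0 < ν) (hCk : 0 ≤ Ck) :
    0 ≤ rateConst M ν Ck := by
  unfold rateConst; positivity

/-- Young's inequality for all terms of the relative energy balance. -/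
lemma rate_bound {M ν Ck α a b r π e w z : ℝ} {v g de db dw ddu : Fin 3 → ℝ}
    {Dv Du S : Fin 3 → Fin 3 → ℝ} (hν : 0 < ν) (hCk : 0 ≤ Ck) (hα : 0 ≤ α)
    (ha : |a| ≤ M) (hb : |b| ≤ M) (hr : |r| ≤ M) (hπ : |π| ≤ M * |r|) (hg : ∀ i, |g i| ≤ M)
    (hde : ∀ i, |de i| ≤ M) (hdb : ∀ i, |db i| ≤ M) (hDu : ∀ i j, |Du i j| ≤ M)
    (hdu : |∑ j, Du j j| ≤ M) (hddu : ∀ i, |ddu i| ≤ M)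
    (hS : ν * (∑ i, Dv i i) ^ 2 ≤ ∑ i, ∑ j, S i j * Dv i j) :
    π * ∑ i, Dv i i - ∑ i, ∑ j, S i j * Dv i j - r * ∑ i, g i * v i + Ck * r * ∑ i, v i * de i
        - Ck * e * (∑ j, db j * v j + b * ∑ j, Dv j j)
        - a * ∑ i, ∑ j, v i * v j * Du i j
        + Ck * (-(w * ∑ i, ddu i * dw i) - 1 / 2 * (∑ j, Du j j) * ∑ i, dw i ^ 2
          - ∑ i, ∑ j, Du j i * dw j * dw i + 1 / 2 * (α * z ^ 2) * ∑ j, Du j j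
          - α * z ^ 2 * ∑ j, Du j j)
        + (-(r * (∑ j, db j * v j + b * ∑ j, Dv j j)) - 1 / 2 * r ^ 2 * ∑ j, Dv j j
          - 1 / 2 * r ^ 2 * ∑ j, Du j j)
      ≤ rateConst M ν Ck * (r ^ 2 + ∑ i, v i ^ 2 + w ^ 2 + ∑ i, dw i ^ 2 + α * z ^ 2 + e ^ 2) := by
  have hM : 0 ≤ M := (abs_nonneg a).trans ha
  set d := ∑ i, Dv i i with hd
  set du := ∑ j, Du j j with hdud
  have hV : 0 ≤ ∑ i, v i ^ 2 := Finset.sum_nonneg fun i _ => sq_nonneg _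
  have hG : 0 ≤ ∑ i, dw i ^ 2 := Finset.sum_nonneg fun i _ => sq_nonneg _
  have t1 : -(r * ∑ i, g i * v i) ≤ M / 2 * (3 * r ^ 2 + ∑ i, v i ^ 2) :=
    (neg_le_abs _).trans (abs_mul_sum_le hg)
  have t2 : r * ∑ i, v i * de i ≤ M / 2 * (3 * r ^ 2 + ∑ i, v i ^ 2) := by
    have := (le_abs_self _).trans (abs_mul_sum_le (y := r) (z := v) hde)
    simpa only [mul_comm (de _)] using this
  have t3 : -(e * ∑ j, db j * v j) ≤ M / 2 * (3 * e ^ 2 + ∑ i, v i ^ 2) :=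
    (neg_le_abs _).trans (abs_mul_sum_le hdb)
  have t4 : -(r * ∑ j, db j * v j) ≤ M / 2 * (3 * r ^ 2 + ∑ i, v i ^ 2) :=
    (neg_le_abs _).trans (abs_mul_sum_le hdb)
  have t5 : -(a * ∑ i, ∑ j, v i * v j * Du i j) ≤ 3 * M ^ 2 * ∑ i, v i ^ 2 := by
    have h1 := abs_sum_sum_le (z := v) hDu
    have h2 : |a * ∑ i, ∑ j, v i * v j * Du i j| ≤ M * (3 * M * ∑ i, v i ^ 2) := by
      rw [abs_mul]
      refine mul_le_mul ha ?_ (abs_nonneg _) hM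
      refine le_of_eq_of_le ?_ h1
      congr 1
      exact Finset.sum_congr rfl fun i _ => Finset.sum_congr rfl fun j _ => by ring
    linarith [neg_le_abs (a * ∑ i, ∑ j, v i * v j * Du i j)]
  have t6 : -(w * ∑ i, ddu i * dw i) ≤ M / 2 * (3 * w ^ 2 + ∑ i, dw i ^ 2) :=
    (neg_le_abs _).trans (abs_mul_sum_le hddu)
  have t7 : -(du * ∑ i, dw i ^ 2) ≤ M * ∑ i, dw i ^ 2 :=
    (neg_le_abs _).trans (abs_mul_le_of_sq hdu hG)
  have t8 : -∑ i, ∑ j, Du j i * dw j * dw i ≤ 3 * M * ∑ i, dw i ^ 2 := by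
    refine (neg_le_abs _).trans (le_of_eq_of_le ?_ (abs_sum_sum_le (z := dw) fun i j => hDu j i))
    congr 1
    exact Finset.sum_congr rfl fun i _ => Finset.sum_congr rfl fun j _ => by ring
  have hz : 0 ≤ α * z ^ 2 := by positivity
  have t9 : -(du * (α * z ^ 2)) ≤ M * (α * z ^ 2) := (neg_le_abs _).trans (abs_mul_le_of_sq hdu hz)
  have t10 : -(du * r ^ 2) ≤ M * r ^ 2 := (neg_le_abs _).trans (abs_mul_le_of_sq hdu (sq_nonneg r))
  have t11 := absorb_divergence (d := d) (e := e) hν hCk hb hr hπ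
  have c2 := mul_le_mul_of_nonneg_left t2 hCk
  have c3 := mul_le_mul_of_nonneg_left t3 hCk
  have c6 := mul_le_mul_of_nonneg_left t6 hCk
  have c7 := mul_le_mul_of_nonneg_left t7 hCk
  have c8 := mul_le_mul_of_nonneg_left t8 hCk
  have c9 := mul_le_mul_of_nonneg_left t9 hCk
  have hCM : 0 ≤ Ck * M := mul_nonneg hCk hM
  have p1 : 0 ≤ 4 * M ^ 2 / ν := by positivity
  have p2 : 0 ≤ Ck ^ 2 * M ^ 2 / ν := by positivity
  have hM2 : 0 ≤ M ^ 2 := sq_nonneg M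
  have q : ∀ k y : ℝ, 0 ≤ k → 0 ≤ y → 0 ≤ k * y := fun _ _ => mul_nonneg
  have r2 := sq_nonneg r
  have w2 := sq_nonneg w
  have e2 := sq_nonneg e
  -- With the quadratic quantities made atomic, only coefficients are compared. The supplied
  -- products are the nonnegative surplus from using one constant for all of them.
  unfold rateConst
  generalize ∑ i, v i ^ 2 = V at *
  generalize ∑ i, dw i ^ 2 = G at *
  generalize α * z ^ 2 = Z at *
  generalize 4 * M ^ 2 / ν = P at *
  generalize Ck ^ 2 * M ^ 2 / ν = Q at *
  linarith [q _ _ p1 hV, q _ _ p1 w2, q _ _ p1 hG, q _ _ p1 hz, q _ _ p1 e2, q _ _ p2 hV,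
    q _ _ p2 w2, q _ _ p2 hG, q _ _ p2 hz, q _ _ p2 r2, q _ _ hM hV, q _ _ hM w2, q _ _ hM hG,
    q _ _ hM hz, q _ _ hM e2, q _ _ hM r2, q _ _ hM2 w2, q _ _ hM2 hG, q _ _ hM2 hz, q _ _ hM2 e2,
    q _ _ hM2 r2, q _ _ hCM hV, q _ _ hCM w2, q _ _ hCM hG, q _ _ hCM hz, q _ _ hCM e2,
    q _ _ hCM r2]

end Young

/-! ### Rate of the relative energy from the balance laws -/

section EnergyRate

/-- The Navier-Stokes stress of a velocity field given by its components. -/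
noncomputable def stressComp (lam mu : ℝ) (v : Fin 3 → Space → ℝ) (i j : Fin 3) (x : Space) : ℝ :=
  lam * (∑ k, pd k (v k) x) * (if i = j then 1 else 0) + mu * (pd j (v i) x + pd i (v j) x)

lemma torusCk_stressComp {k : ℕ} {v : Fin 3 → Space → ℝ} (hv : ∀ i, TorusCk (k + 1) (v i))
    (lam mu : ℝ) (i j : Fin 3) : TorusCk k (stressComp lam mu v i j) :=
  (((TorusCk.sum fun l _ => (hv l).pd l).const_mul lam).mul (TorusCk.const _)).add
    (((hv i).pd j).add ((hv j).pd i) |>.const_mul mu)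

lemma stressComp_sub {u v : Fin 3 → Space → ℝ} (hu : ∀ i, Differentiable ℝ (u i))
    (hv : ∀ i, Differentiable ℝ (v i)) (lam mu : ℝ) (i j : Fin 3) (x : Space) :
    stressComp lam mu (fun i y => v i y - u i y) i j x
      = stressComp lam mu v i j x - stressComp lam mu u i j x := by
  simp only [stressComp, pd_sub (hv _) (hu _), Finset.sum_sub_distrib]
  ring

/-- Growth of the relative energy at a fixed time, in terms of the relative energy and the
consistency error `e`. -/
theorem integral_energy_rate_le {a b e π w a' b' w' : Space → ℝ} {U u v g v' : Fin 3 → Space → ℝ}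
    {lam mu Ck α M ε : ℝ} (hmu : 0 < mu) (hν : 0 < lam + 2 / 3 * mu) (hCk : 0 ≤ Ck) (hα : 0 ≤ α)
    (ha : TorusCk 1 a) (hb : TorusCk 1 b) (he : TorusCk 1 e) (hπ : TorusCk 1 π) (hw : TorusCk 3 w)
    (hu : ∀ i, TorusCk 2 (u i)) (hv : ∀ i, TorusCk 2 (v i)) (hUv : ∀ i x, U i x = v i x + u i x)
    (ha' : Continuous a') (hb' : Continuous b') (hw' : TorusCk 1 w') (hv' : ∀ i, Continuous (v' i))
    (hamass : ∀ x, a' x = -∑ j, pd j (fun y => a y * U j y) x)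
    (hbmass : ∀ x, b' x = -∑ j, pd j (fun y => b y * u j y) x)
    (hmom : ∀ i x, a x * v' i x = -pd i π x + ∑ j, pd j (stressComp lam mu v i j) x
      - (a x - b x) * g i x + Ck * a x * pd i (laplace w) x + Ck * a x * pd i e x
      - a x * ∑ j, U j x * pd j (v i) x - a x * ∑ j, v j x * pd j (u i) x)
    (hz : ∀ x, laplace w x = α * (w x - (a x - b x)))
    (haM : ∀ x, |a x| ≤ M) (hbM : ∀ x, |b x| ≤ M) (hrM : ∀ x, |a x - b x| ≤ M)
    (hπM : ∀ x, |π x| ≤ M * |a x - b x|) (hgM : ∀ i x, |g i x| ≤ M) (hdeM : ∀ i x, |pd i e x| ≤ M)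
    (heε : ∀ x, |e x| ≤ ε) (hdbM : ∀ i x, |pd i b x| ≤ M) (hduM : ∀ i j x, |pd i (u j) x| ≤ M)
    (hdivM : ∀ x, |∑ j, pd j (u j) x| ≤ M)
    (hddivM : ∀ i x, |pd i (fun y => ∑ j, pd j (u j) y) x| ≤ M) :
    ∫ x, (1 / 2 * a' x * ∑ i, v i x ^ 2 + a x * ∑ i, v i x * v' i x
        + Ck * (α * (w x - (a x - b x)) * (w' x - (a' x - b' x)) + ∑ i, pd i w x * pd i w' x)
        + (a x - b x) * (a' x - b' x)) ∂torusMeasure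
      ≤ ∫ x, rateConst M (lam + 2 / 3 * mu) Ck * ((a x - b x) ^ 2 + ∑ i, v i x ^ 2 + w x ^ 2
          + ∑ i, pd i w x ^ 2 + α * (w x - (a x - b x)) ^ 2 + ε ^ 2) ∂torusMeasure := by
  have had := ha.differentiable le_rfl
  have hbd := hb.differentiable le_rfl
  have hud := fun i => (hu i).differentiable one_le_two
  have hvd := fun i => (hv i).differentiable one_le_two
  have hr : TorusCk 1 fun x => a x - b x := ha.sub hb
  have hrd := hr.differentiable le_rfl
  have hU : ∀ i, TorusCk 2 (U i) := fun i => by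
    rw [show U i = fun x => v i x + u i x from funext (hUv i)]
    exact (hv i).add (hu i)
  have hU1 := fun i => (hU i).of_le one_le_two
  have hu1 := fun i => (hu i).of_le one_le_two
  have hv1 := fun i => (hv i).of_le one_le_two
  have hS : ∀ i j, TorusCk 1 (stressComp lam mu v i j) := fun i j =>
    torusCk_stressComp (k := 1) hv lam mu i j
  have hW : TorusCk 1 (laplace w) := TorusCk.laplace (k := 1) hw
  have hw1 := hw.of_le (l := 1) (by norm_num)
  have hpw : ∀ i, TorusCk 2 (pd i w) := fun i => TorusCk.pd (k := 2) hw i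
  have hpw1 := fun i => (hpw i).of_le one_le_two
  have hM : 0 ≤ M := (abs_nonneg _).trans (haM 0)
  have hQ : TorusCk 1 fun y => ∑ i, v i y ^ 2 := TorusCk.sum fun i _ => (hv1 i).pow 2
  have hDw : TorusCk 1 fun y => ∑ i, pd i (fun z => w z * u i z) y :=
    TorusCk.sum fun i _ => TorusCk.pd (k := 1) ((hw.of_le (by norm_num)).mul (hu i)) i
  have hG : TorusCk 1 fun y => ∑ i, pd i w y ^ 2 := TorusCk.sum fun i _ => (hpw1 i).pow 2
  have hz2 : TorusCk 1 fun y => (w y - (a y - b y)) ^ 2 := (hw1.sub hr).pow 2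
  -- `hD1`, `hD2` and `hD3` collect the fluxes of the kinetic, capillary and density identities;
  -- they integrate to zero.
  have hD1 : MeanZero fun x =>
      -(1 / 2) * ∑ j, pd j (fun y => (∑ i, v i y ^ 2) * (a y * U j y)) x
          - ∑ j, pd j (fun y => π y * v j y) x
          + ∑ i, ∑ j, pd j (fun y => v i y * stressComp lam mu v i j y) x
          + Ck * ∑ j, pd j (fun y => laplace w y * (a y * v j y)) x
          + Ck * ∑ j, pd j (fun y => e y * (b y * v j y)) x :=
    (((((meanZero_divergence fun j => hQ.mul (ha.mul (hU1 j))).const_mul _).sub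
      (meanZero_divergence fun j => hπ.mul (hv1 j))).add
      (MeanZero.sum fun i => meanZero_divergence fun j => (hv1 i).mul (hS i j))).add
      ((meanZero_divergence fun j => hW.mul (ha.mul (hv1 j))).const_mul _)).add
      ((meanZero_divergence fun j => he.mul (hb.mul (hv1 j))).const_mul _)
  have hD2 : MeanZero fun x => ∑ j, pd j (fun y => w' y * pd j w y) x
          + ∑ j, pd j (fun y => (∑ i, pd i (fun z => w z * u i z) y) * pd j w y) x
          - 1 / 2 * ∑ j, pd j (fun y => (∑ i, pd i w y ^ 2) * u j y) x
          - 1 / 2 * α * ∑ j, pd j (fun y => (w y - (a y - b y)) ^ 2 * u j y) x :=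
    (((meanZero_divergence fun j => hw'.mul (hpw1 j)).add
      (meanZero_divergence fun j => hDw.mul (hpw1 j))).sub
      ((meanZero_divergence fun j => hG.mul (hu1 j)).const_mul _)).sub
      ((meanZero_divergence fun j => hz2.mul (hu1 j)).const_mul _)
  have hD3 : MeanZero fun x => -(1 / 2) * ∑ j, pd j (fun y => (a y - b y) ^ 2 * v j y) x
        - 1 / 2 * ∑ j, pd j (fun y => (a y - b y) ^ 2 * u j y) x :=
    ((meanZero_divergence fun j => (hr.pow 2).mul (hv1 j)).const_mul _).sub
      ((meanZero_divergence fun j => (hr.pow 2).mul (hu1 j)).const_mul _)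
  have hvc := fun i => (hv i).continuous
  have hpwc := fun i => (hpw i).continuous
  have hpw'c : ∀ i, Continuous (pd i w') := fun i => (TorusCk.pd (k := 0) hw' i).continuous
  have hac := ha.continuous
  have hbc := hb.continuous
  have hwc := hw.continuous
  have hw'c := hw'.continuous
  refine integral_le_of_eq_add_meanZero ?_ ((hD1.add (hD2.const_mul Ck)).add hD3) ?_ fun x => ?_
  · refine ((Continuous.add ?_ ?_).add (continuous_const.mul (Continuous.add ?_ ?_))).add ?_
    · exact (continuous_const.mul ha').mul (continuous_finsetSum _ fun i _ => (hvc i).pow 2)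
    · exact hac.mul (continuous_finsetSum _ fun i _ => (hvc i).mul (hv' i))
    · fun_prop
    · exact continuous_finsetSum _ fun i _ => (hpwc i).mul (hpw'c i)
    · fun_prop
  · refine continuous_const.mul (((((Continuous.add ?_ ?_).add ?_).add ?_).add ?_).add ?_)
    · fun_prop
    · exact continuous_finsetSum _ fun i _ => (hvc i).pow 2
    · fun_prop
    · exact continuous_finsetSum _ fun i _ => (hpwc i).pow 2
    · fun_prop
    · fun_prop
  -- Difference of the mass balances: with a = r + b and U = v + u, the flux a U - b u equals a v +
  -- r u.
  have hsplit : a' x - b' x = -∑ j, pd j (fun y => (a y - b y + b y) * v j y) x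
      - ∑ j, pd j (fun y => (a y - b y) * u j y) x := by
    rw [hamass, hbmass]
    have h1 : ∀ j, pd j (fun y => a y * U j y) x = pd j (fun y => (a y - b y + b y) * v j y) x
        + pd j (fun y => (a y - b y) * u j y) x + pd j (fun y => b y * u j y) x := by
      intro j
      have d1 : Differentiable ℝ fun y => (a y - b y + b y) * v j y :=
        (hrd.fun_add hbd).fun_mul (hvd j)
      have d2 : Differentiable ℝ fun y => (a y - b y) * u j y := hrd.fun_mul (hud j)
      have d3 : Differentiable ℝ fun y => b y * u j y := hbd.fun_mul (hud j)
      have e1 : (fun y => a y * U j y) = fun y => ((a y - b y + b y) * v j y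
          + (a y - b y) * u j y) + b y * u j y := by
        funext y; rw [hUv]; ring
      rw [e1, pd_add (d1.fun_add d2) d3, pd_add d1 d2]
    simp only [h1, Finset.sum_add_distrib]
    ring
  have k1 := kinetic_identity (g := g) (v' := v') (Ck := Ck) (u := u) had hbd (hπ.differentiable le_rfl)
    (he.differentiable le_rfl) (hW.differentiable le_rfl)
    (fun i => (hU i).differentiable one_le_two) hvd (fun i j => (hS i j).differentiable le_rfl)
    (hamass x) (fun i => hmom i x)
  have k2 := capillary_identity (w' := w') (r' := fun x => a' x - b' x) hw hrd
    (hw'.differentiable le_rfl) hu (x := x) hz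
  have k3 := density_identity (r' := fun x => a' x - b' x) hrd hbd hud hvd (x := x) hsplit
  have k4 : (fun j => pd j (fun y => (a y - b y + b y) * v j y) x)
      = fun j => pd j (fun y => a y * v j y) x := by
    funext j; simp only [sub_add_cancel]
  -- This is the work exchanged between kinetic and capillary energy. By `hsplit` it occurs in both
  -- identities and drops out of the sum.
  have k5 : laplace w x * (a' x - b' x + ∑ j, pd j (fun y => (a y - b y) * u j y) x)
      = -(laplace w x * ∑ j, pd j (fun y => a y * v j y) x) := by
    rw [hsplit, k4]; ring
  have k6 : ∑ j, pd j (fun y => b y * v j y) x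
      = ∑ j, pd j b x * v j x + b x * ∑ j, pd j (v j) x := sum_pd_mul hbd hvd x
  have hdis := dissipation_lower_bound (lam := lam) hmu fun i j => pd j (v i) x
  have hrate := rate_bound (ν := lam + 2 / 3 * mu) (Ck := Ck) (α := α) (e := e x) (w := w x)
    (z := w x - (a x - b x)) (v := fun i => v i x) (dw := fun i => pd i w x)
    (S := fun i j => stressComp lam mu v i j x) (Dv := fun i j => pd j (v i) x)
    (Du := fun i j => pd j (u i) x) hν hCk hα (haM x) (hbM x) (hrM x) (hπM x) (fun i => hgM i x)
    (fun i => hdeM i x) (fun i => hdbM i x) (fun i j => hduM j i x) (hdivM x)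
    (fun i => hddivM i x) hdis
  have hA := rateConst_nonneg hM hν hCk
  have hee : e x ^ 2 ≤ ε ^ 2 := by
    rw [← sq_abs]; exact pow_le_pow_left₀ (abs_nonneg _) (heε x) 2
  have hee' := mul_le_mul_of_nonneg_left hee hA
  simp only [k5] at k2
  simp only [k6] at k1 k3
  have k2' := congrArg (Ck * ·) k2
  linarith

end EnergyRate

/-! ### The equation for the velocity difference -/

section Momentum

lemma pd_comp {φ : ℝ → ℝ} {f : Space → ℝ} {x : Space} (hφ : DifferentiableAt ℝ φ (f x))
    (hf : Differentiable ℝ f) (i : Fin 3) : pd i (fun y => φ (f y)) x = deriv φ (f x) * pd i f x := by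
  have h := hφ.hasDerivAt.comp_hasFDerivAt x (hf x).hasFDerivAt
  have h2 : HasFDerivAt (fun y => φ (f y)) _ x := h
  rw [pd, h2.fderiv]
  rfl

lemma contDiffOn_pressure {h : ℝ → ℝ} (hh : ContDiffOn ℝ 3 h (Ioi 0)) :
    ContDiffOn ℝ 2 (pressure h) (Ioi 0) :=
  (contDiffOn_id.mul (hh.deriv_of_isOpen isOpen_Ioi (by norm_num))).sub (hh.of_le (by norm_num))

/-- Momentum balance in terms of the material derivative of the velocity. -/
lemma material_derivative {ρ ρ' : Space → ℝ} {u : Fin 3 → Space → ℝ} {i : Fin 3} {x : Space}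
    {m u' R : ℝ} (hρ : Differentiable ℝ ρ) (hu : ∀ i, Differentiable ℝ (u i))
    (hm : m = ρ' x * u i x + ρ x * u') (hmass : ρ' x = -∑ j, pd j (fun y => ρ y * u j y) x)
    (hmom : m + ∑ j, pd j (fun y => ρ y * u i y * u j y) x = R) :
    ρ x * (u' + ∑ j, u j x * pd j (u i) x) = R := by
  -- Grouping the flux as u_i (ρ u_j) isolates u_i div(ρu), which the mass balance cancels.
  have e : ∀ j, pd j (fun y => ρ y * u i y * u j y) x
      = pd j (fun y => u i y * (ρ y * u j y)) x := fun j => by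
    congr 1; funext y; ring
  simp only [e] at hmom
  rw [sum_pd_mul (hu i) fun j => (hρ.fun_mul (hu j)), hm, hmass] at hmom
  rw [← hmom]
  simp only [Fin.sum_univ_three]
  ring

/-- Multiplied by Ck a, this merges the coupling force Ck α a∇c and the artificial pressure gradient
Ck α a∇a into a Korteweg force Ck a∇Δc, comparable with that of the reference flow. -/
lemma pd_laplace_of_screened {a c : Space → ℝ} {α : ℝ} (ha : Differentiable ℝ a)
    (hc : Differentiable ℝ c) (h : ∀ x, laplace c x = α * (c x - a x)) (i : Fin 3) (x : Space) :
    pd i (laplace c) x = α * (pd i c x - pd i a x) := by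
  rw [show laplace c = fun x => α * (c x - a x) from funext h, pd_const_mul α (hc.fun_sub ha),
    pd_sub hc ha]

lemma laplace_sub {f g : Space → ℝ} (hf : TorusCk 3 f) (hg : TorusCk 3 g) :
    laplace (fun x => f x - g x) = fun x => laplace f x - laplace g x := by
  have hd : ∀ {f : Space → ℝ}, TorusCk 3 f → Differentiable ℝ f := fun hf =>
    hf.differentiable (by norm_num)
  have hd1 : ∀ {f : Space → ℝ} (i : Fin 3), TorusCk 3 f → Differentiable ℝ (pd i f) := fun i hf =>
    (TorusCk.pd (k := 2) hf i).differentiable one_le_two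
  funext x
  simp only [laplace, pd_sub (hd hf) (hd hg), pd_sub (hd1 _ hf) (hd1 _ hg),
    Finset.sum_sub_distrib]

/-- The force `b⁻¹ (div σ[u] - ∇p(b))` of the reference flow. -/
noncomputable def refForce (h : ℝ → ℝ) (lam mu : ℝ) (b : Space → ℝ) (u : Fin 3 → Space → ℝ)
    (i : Fin 3) (x : Space) : ℝ :=
  (b x)⁻¹ * (-(deriv (pressure h) (b x) * pd i b x) + ∑ j, pd j (stressComp lam mu u i j) x)

/-- The equation for the difference of the velocities of the two systems. -/
lemma momentum_difference {h : ℝ → ℝ} (hh : ContDiffOn ℝ 3 h (Ioi 0)) {lam mu Ck α : ℝ}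
    {a b c d : Space → ℝ} {U u : Fin 3 → Space → ℝ} {U' u' : ℝ} {i : Fin 3}
    (ha : TorusCk 1 a) (hb : TorusCk 3 b) (hc : TorusCk 3 c) (hd : TorusCk 3 d)
    (hU : ∀ i, TorusCk 2 (U i)) (hu : ∀ i, TorusCk 2 (u i))
    (hapos : ∀ x, 0 < a x) (hbpos : ∀ x, 0 < b x) {x : Space}
    (hca : ∀ x, laplace c x = α * (c x - a x))
    (hmomU : a x * (U' + ∑ j, U j x * pd j (U i) x)
      = ∑ j, pd j (stressComp lam mu U i j) x + Ck * α * a x * pd i c x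
        - pd i (fun y => pressure h (a y) + Ck * (α / 2) * a y ^ 2) x)
    (hmomu : b x * (u' + ∑ j, u j x * pd j (u i) x)
      = ∑ j, pd j (stressComp lam mu u i j) x + Ck * b x * pd i (laplace b) x
        - pd i (fun y => pressure h (b y)) x) :
    a x * (U' - u') = -pd i (fun y => pressure h (a y) - pressure h (b y)) x
      + ∑ j, pd j (stressComp lam mu (fun i y => U i y - u i y) i j) x
      - (a x - b x) * refForce h lam mu b u i x
      + Ck * a x * pd i (laplace fun y => c y - d y) x
      + Ck * a x * pd i (fun y => laplace d y - laplace b y) x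
      - a x * ∑ j, U j x * pd j (fun y => U i y - u i y) x
      - a x * ∑ j, (U j x - u j x) * pd j (u i) x := by
  have hp := contDiffOn_pressure hh
  have hpd : ∀ s, 0 < s → DifferentiableAt ℝ (pressure h) s := fun s hs =>
    (hp.differentiableOn (by norm_num)).differentiableAt (Ioi_mem_nhds hs)
  have had := ha.differentiable le_rfl
  have hbd := hb.differentiable (by norm_num)
  have hcd := hc.differentiable (by norm_num)
  have hUd := fun i => (hU i).differentiable one_le_two
  have hud := fun i => (hu i).differentiable one_le_two
  have hpa : Differentiable ℝ fun y => pressure h (a y) := fun y =>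
    (hpd _ (hapos y)).fun_comp' y (had y)
  have hpb : Differentiable ℝ fun y => pressure h (b y) := fun y =>
    (hpd _ (hbpos y)).fun_comp' y (hbd y)
  have hlc := (TorusCk.laplace (k := 1) hc).differentiable le_rfl
  have hld := (TorusCk.laplace (k := 1) hd).differentiable le_rfl
  have hlb := (TorusCk.laplace (k := 1) hb).differentiable le_rfl
  have hSU : ∀ i j, Differentiable ℝ (stressComp lam mu U i j) := fun i j =>
    (torusCk_stressComp (k := 1) hU lam mu i j).differentiable le_rfl
  have hSu : ∀ i j, Differentiable ℝ (stressComp lam mu u i j) := fun i j =>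
    (torusCk_stressComp (k := 1) hu lam mu i j).differentiable le_rfl
  have e1 : pd i (fun y => pressure h (a y) + Ck * (α / 2) * a y ^ 2) x
      = pd i (fun y => pressure h (a y)) x + Ck * α * a x * pd i a x := by
    rw [pd_add hpa ((had.fun_pow 2).const_mul _), pd_const_mul _ (had.fun_pow 2)]
    beta_reduce
    rw [pd_sq had]
    ring
  have e2 := pd_laplace_of_screened had hcd hca i x
  have e3 : ∀ j, pd j (stressComp lam mu (fun i y => U i y - u i y) i j) x
      = pd j (stressComp lam mu U i j) x - pd j (stressComp lam mu u i j) x := fun j => by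
    rw [show stressComp lam mu (fun i y => U i y - u i y) i j = fun y =>
      stressComp lam mu U i j y - stressComp lam mu u i j y from
      funext (stressComp_sub hud hUd lam mu i j), pd_sub (hSU i j) (hSu i j)]
  have e4 : b x * refForce h lam mu b u i x = -pd i (fun y => pressure h (b y)) x
      + ∑ j, pd j (stressComp lam mu u i j) x := by
    rw [refForce, mul_inv_cancel_left₀ (hbpos x).ne', pd_comp (hpd _ (hbpos x)) hbd]
  -- The reference acceleration is solved for by dividing by b > 0 and later multiplied by a. The
  -- mismatch of weights leaves (a - b) times the force, while a∇Δb stays whole and pairs with a∇Δc.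
  have e5 : u' + ∑ j, u j x * pd j (u i) x
      = refForce h lam mu b u i x + Ck * pd i (laplace b) x := by
    refine mul_left_cancel₀ (hbpos x).ne' ?_
    rw [hmomu, mul_add, e4]
    ring
  rw [e1] at hmomU
  rw [pd_sub hpa hpb, laplace_sub hc hd, pd_sub hlc hld, pd_sub hld hlb]
  beta_reduce
  rw [e2]
  simp only [e3, pd_sub (hUd _) (hud _), Finset.sum_sub_distrib]
  have e6 : u' = refForce h lam mu b u i x + Ck * pd i (laplace b) x
      - ∑ j, u j x * pd j (u i) x := by linarith
  rw [e6]
  have e7 : a x * U' = (∑ j, pd j (stressComp lam mu U i j) x + Ck * α * a x * pd i c x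
        - (pd i (fun y => pressure h (a y)) x + Ck * α * a x * pd i a x))
        - a x * ∑ j, U j x * pd j (U i) x := by linarith
  rw [mul_sub, e7]
  simp only [Fin.sum_univ_three] at e4 ⊢
  linear_combination -e4

end Momentum

/-! ### Uniform bounds for the reference solution -/

section ReferenceBounds

/-- Phrasing bounds as eventual in M lets finitely many of them be met by a single constant. -/
lemma JointCont.eventually_bound {K : Set ℝ} (hK : IsCompact K) {f : ℝ → Space → ℝ}
    (hf : JointCont K f) : ∀ᶠ M in atTop, ∀ t ∈ K, ∀ x, |f t x| ≤ M := by
  obtain ⟨M, -, hM⟩ := hf.exists_bound hK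
  filter_upwards [eventually_ge_atTop M] with N hN t ht x
  exact (hM t ht x).trans hN

lemma C0Time.comp {I : Set ℝ} {k : ℕ} {u : ℝ → Space → Vec} (hu : C0Time I k u) (i : Fin 3) :
    C0Time I k fun t x => u t x i :=
  hu.clm (EuclideanSpace.proj i : Vec →L[ℝ] ℝ)

lemma HasC1Time.comp {I : Set ℝ} {k : ℕ} {u u' : ℝ → Space → Vec} (hu : HasC1Time I k u u')
    (i : Fin 3) : HasC1Time I k (fun t x => u t x i) fun t x => u' t x i :=
  hu.clm (EuclideanSpace.proj i : Vec →L[ℝ] ℝ)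

lemma jointCont_laplace {I : Set ℝ} {f : ℝ → Space → ℝ} (hf : C0Time I 2 f) :
    JointCont I fun t => laplace (f t) :=
  JointCont.sum fun i _ => ((C0Time.pd (k := 1) hf i).pd i).jointCont

lemma jointCont_pd_laplace {I : Set ℝ} {f : ℝ → Space → ℝ} (hf : C0Time I 3 f) (i : Fin 3) :
    JointCont I fun t => pd i (laplace (f t)) := by
  have h1 : ∀ j, C0Time I 1 fun t => pd j (pd j (f t)) := fun j =>
    C0Time.pd (k := 1) (C0Time.pd (k := 2) hf j) j
  refine (JointCont.sum (s := Finset.univ) fun j _ =>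
    (C0Time.pd (k := 0) (h1 j) i).jointCont).congr fun t ht x => ?_
  have := pd_sum (s := Finset.univ) (i := i) fun j _ => ((h1 j).1 t ht).differentiable le_rfl
  exact congrFun this x

lemma jointCont_pd_sum {I : Set ℝ} {u : Fin 3 → ℝ → Space → ℝ} (hu : ∀ j, C0Time I 2 (u j))
    (i : Fin 3) : JointCont I fun t => pd i fun y => ∑ j, pd j (u j t) y := by
  have h1 : ∀ j, C0Time I 1 fun t => pd j (u j t) := fun j => C0Time.pd (k := 1) (hu j) j
  refine (JointCont.sum (s := Finset.univ) fun j _ =>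
    (C0Time.pd (k := 0) (h1 j) i).jointCont).congr fun t ht x => ?_
  have := pd_sum (s := Finset.univ) (i := i) fun j _ => ((h1 j).1 t ht).differentiable le_rfl
  exact congrFun this x

lemma jointCont_pd_stressComp {I : Set ℝ} {u : Fin 3 → ℝ → Space → ℝ}
    (hu : ∀ j, C0Time I 2 (u j)) (lam mu : ℝ) (i j : Fin 3) :
    JointCont I fun t => pd j (stressComp lam mu (fun k => u k t) i j) := by
  have h1 : ∀ j k, C0Time I 1 fun t => pd k (u j t) := fun j k => C0Time.pd (k := 1) (hu j) k
  have h2 : ∀ j k l, JointCont I fun t => pd l (pd k (u j t)) := fun j k l =>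
    (C0Time.pd (k := 0) (h1 j k) l).jointCont
  refine ((((jointCont_pd_sum hu j).const_mul lam).mul
    (JointCont.const (if i = j then (1 : ℝ) else 0))).add
    (((h2 i j j).add (h2 j i j)).const_mul mu)).congr fun t ht x => ?_
  have d1 : ∀ j k, Differentiable ℝ (pd k (u j t)) := fun j k =>
    ((h1 j k).1 t ht).differentiable le_rfl
  have d2 : Differentiable ℝ fun y => ∑ k, pd k (u k t) y :=
    Differentiable.fun_sum fun k _ => d1 k k
  have d3 : Differentiable ℝ fun y => (lam * ∑ k, pd k (u k t) y) * (if i = j then (1 : ℝ) else 0) :=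
    (d2.const_mul lam).fun_mul (differentiable_const _)
  have d4 : Differentiable ℝ fun y => mu * (pd j (u i t) y + pd i (u j t) y) :=
    ((d1 i j).fun_add (d1 j i)).const_mul mu
  have e := pd_add (i := j) d3 d4
  have e0 : pd j (fun y => (lam * ∑ k, pd k (u k t) y) * (if i = j then (1 : ℝ) else 0))
      = fun x => lam * pd j (fun y => ∑ k, pd k (u k t) y) x * (if i = j then 1 else 0) := by
    rw [show (fun y => (lam * ∑ k, pd k (u k t) y) * (if i = j then (1 : ℝ) else 0))
      = fun y => (lam * if i = j then (1 : ℝ) else 0) * ∑ k, pd k (u k t) y from by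
        funext y; ring, pd_const_mul _ d2]
    funext y; ring
  rw [e0, pd_const_mul mu ((d1 i j).fun_add (d1 j i)), pd_add (d1 i j) (d1 j i)] at e
  exact congrFun e x

/-- Bounds for a reference flow on the time interval `[0, T]`. -/
structure ReferenceBound (h : ℝ → ℝ) (lam mu T cρ Cρ M : ℝ) (b : ℝ → Space → ℝ)
    (u : ℝ → Fin 3 → Space → ℝ) : Prop where
  density_le : Cρ ≤ M
  pressure_lipschitz : ∀ r ∈ Icc cρ Cρ, ∀ s ∈ Icc cρ Cρ,
    |pressure h r - pressure h s| ≤ M * |r - s|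
  pd_density : ∀ t ∈ Icc 0 T, ∀ i x, |pd i (b t) x| ≤ M
  laplace_density : ∀ t ∈ Icc 0 T, ∀ x, |laplace (b t) x| ≤ M
  pd_laplace_density : ∀ t ∈ Icc 0 T, ∀ i x, |pd i (laplace (b t)) x| ≤ M
  pd_velocity : ∀ t ∈ Icc 0 T, ∀ i j x, |pd i (u t j) x| ≤ M
  div_velocity : ∀ t ∈ Icc 0 T, ∀ x, |∑ j, pd j (u t j) x| ≤ M
  pd_div_velocity : ∀ t ∈ Icc 0 T, ∀ i x, |pd i (fun y => ∑ j, pd j (u t j) y) x| ≤ M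
  force : ∀ t ∈ Icc 0 T, ∀ i x, |refForce h lam mu (b t) (u t) i x| ≤ M

/-- All bounds come from compactness of [0, T] times the unit cube, so M depends on the reference
solution. The lower bound cρ keeps the density in a region where the pressure is C² and where
division by the density is harmless. -/
lemma exists_referenceBound {h : ℝ → ℝ} (hh : ContDiffOn ℝ 3 h (Ioi 0)) {lam mu T cρ Cρ : ℝ}
    (hcρ : 0 < cρ) {b : ℝ → Space → ℝ} {u : Fin 3 → ℝ → Space → ℝ} (hb : C0Time (Icc 0 T) 3 b)
    (hbc : ∀ t ∈ Icc 0 T, ∀ x, cρ ≤ b t x) (hu : ∀ i, C0Time (Icc 0 T) 2 (u i)) :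
    ∃ M, 0 < M ∧ ReferenceBound h lam mu T cρ Cρ M b fun t i => u i t := by
  have hp := contDiffOn_pressure hh
  have hdp : ContinuousOn (deriv (pressure h)) (Ioi 0) :=
    hp.continuousOn_deriv_of_isOpen isOpen_Ioi (by norm_num)
  have hK : IsCompact (Icc (0 : ℝ) T) := isCompact_Icc
  obtain ⟨L, hL⟩ := isCompact_Icc.exists_bound_of_continuousOn (s := Icc cρ Cρ)
    (hdp.mono fun s hs => hcρ.trans_le hs.1)
  have hpl : ∀ r ∈ Icc cρ Cρ, ∀ s ∈ Icc cρ Cρ, |pressure h r - pressure h s| ≤ L * |r - s| := by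
    intro r hr s hs
    exact (convex_Icc cρ Cρ).norm_image_sub_le_of_norm_deriv_le (fun y hy =>
      (hp.differentiableOn (by norm_num)).differentiableAt
        (Ioi_mem_nhds (hcρ.trans_le hy.1))) hL hs hr
  have hpb : ∀ i, C0Time (Icc 0 T) 2 fun t => pd i (b t) := fun i => C0Time.pd (k := 2) hb i
  have hpu : ∀ i j, C0Time (Icc 0 T) 1 fun t => pd i (u j t) := fun i j => C0Time.pd (k := 1) (hu j) i
  have hbpos : ∀ t ∈ Icc 0 T, ∀ x, b t x ∈ Ioi (0 : ℝ) := fun t ht x => hcρ.trans_le (hbc t ht x)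
  have hforce : ∀ i, JointCont (Icc 0 T) fun t => refForce h lam mu (b t) (fun i => u i t) i := by
    intro i
    have h1 : JointCont (Icc 0 T) fun t x => (b t x)⁻¹ :=
      JointCont.comp_continuousOn (s := Ioi 0)
        (continuousOn_inv₀.mono fun s hs => (ne_of_gt hs : s ≠ 0)) hb.jointCont hbpos
    have h2 : JointCont (Icc 0 T) fun t x => deriv (pressure h) (b t x) :=
      JointCont.comp_continuousOn hdp hb.jointCont hbpos
    have h3 := (JointCont.const (I := Icc 0 T) (-1 : ℝ)).mul (h2.mul (hpb i).jointCont)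
    have h4 := JointCont.sum (s := Finset.univ) fun j _ =>
      jointCont_pd_stressComp hu lam mu i j
    exact (h1.mul (h3.add h4)).congr fun t _ x => by simp only [refForce]; ring
  have e1 : ∀ᶠ M in atTop, ∀ i, ∀ t ∈ Icc 0 T, ∀ x, |pd i (b t) x| ≤ M :=
    eventually_all.2 fun i => (hpb i).jointCont.eventually_bound hK
  have e2 := (jointCont_laplace (hb.of_le (by norm_num))).eventually_bound hK
  have e3 : ∀ᶠ M in atTop, ∀ i, ∀ t ∈ Icc 0 T, ∀ x, |pd i (laplace (b t)) x| ≤ M :=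
    eventually_all.2 fun i => (jointCont_pd_laplace hb i).eventually_bound hK
  have e4 : ∀ᶠ M in atTop, ∀ i j, ∀ t ∈ Icc 0 T, ∀ x, |pd i (u j t) x| ≤ M :=
    eventually_all.2 fun i => eventually_all.2 fun j => (hpu i j).jointCont.eventually_bound hK
  have e5 := (JointCont.sum (s := Finset.univ) fun j _ => (hpu j j).jointCont).eventually_bound hK
  have e6 : ∀ᶠ M in atTop, ∀ i, ∀ t ∈ Icc 0 T, ∀ x, |pd i (fun y => ∑ j, pd j (u j t) y) x| ≤ M :=
    eventually_all.2 fun i => (jointCont_pd_sum hu i).eventually_bound hK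
  have e7 : ∀ᶠ M in atTop, ∀ i, ∀ t ∈ Icc 0 T, ∀ x,
      |refForce h lam mu (b t) (fun i => u i t) i x| ≤ M :=
    eventually_all.2 fun i => (hforce i).eventually_bound hK
  obtain ⟨M, h1, h2, h3, h4, h5, h6, h7, h8, h9, h10⟩ := (e1.and (e2.and (e3.and (e4.and (e5.and
    (e6.and (e7.and ((eventually_ge_atTop L).and ((eventually_ge_atTop Cρ).and
      (eventually_gt_atTop 0)))))))))).exists
  exact ⟨M, h10, h9, fun r hr s hs => (hpl r hr s hs).trans
    (mul_le_mul_of_nonneg_right h8 (abs_nonneg _)), fun t ht i => h1 i t ht, h2,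
    fun t ht i => h3 i t ht, fun t ht i j => h4 i j t ht, h5, fun t ht i => h6 i t ht,
    fun t ht i => h7 i t ht⟩

/-- `Space` carries the sup norm, so the norm of the derivative is at most the sum of the three
partial bounds. -/
lemma abs_sub_le_of_pd_le {f : Space → ℝ} (hf : Differentiable ℝ f) {M : ℝ}
    (hM : ∀ i x, |pd i f x| ≤ M) (x y : Space) : |f x - f y| ≤ 3 * M * ‖x - y‖ := by
  have hM0 : 0 ≤ M := (abs_nonneg _).trans (hM 0 0)
  refine convex_univ.norm_image_sub_le_of_norm_fderiv_le (fun z _ => hf z) (fun z _ => ?_)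
    (mem_univ y) (mem_univ x)
  refine ContinuousLinearMap.opNorm_le_bound _ (by positivity) fun v => ?_
  rw [fderiv_eq_sum_pd]
  calc ‖∑ i, v i * pd i f z‖ ≤ ∑ i : Fin 3, ‖v‖ * M := by
        refine (norm_sum_le _ _).trans (Finset.sum_le_sum fun i _ => ?_)
        rw [norm_mul]
        exact mul_le_mul (norm_le_pi_norm v i) (hM i z) (norm_nonneg _) (norm_nonneg _)
    _ = 3 * M * ‖v‖ := by simp; ring

end ReferenceBounds

/-! ### A Gronwall inequality -/

section Gronwall

/-- The function exp(-At)(E t + B/A) has nonpositive derivative on the open interval and is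
continuous up to the endpoints, hence it is nonincreasing. No derivative at the endpoints is needed.
-/
lemma le_of_deriv_le_linear {E E' : ℝ → ℝ} {T A B : ℝ} (hT : 0 ≤ T) (hA : 0 < A) (hB : 0 ≤ B)
    (hE : ContinuousOn E (Icc 0 T)) (hE' : ∀ t ∈ Ioo 0 T, HasDerivAt E (E' t) t)
    (hle : ∀ t ∈ Ioo 0 T, E' t ≤ A * E t + B) (hE0 : 0 ≤ E 0) :
    ∀ t ∈ Icc 0 T, E t ≤ (E 0 + B / A) * Real.exp (A * T) := by
  intro t ht
  have hd : ∀ t ∈ Ioo 0 T, HasDerivAt (fun t => Real.exp (-(A * t)) * (E t + B / A))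
      (Real.exp (-(A * t)) * (E' t - A * E t - B)) t := by
    intro t ht
    have h1 : HasDerivAt (fun t => Real.exp (-(A * t))) (Real.exp (-(A * t)) * (-A)) t := by
      have := ((hasDerivAt_id t).const_mul A).neg.exp
      simpa using this
    refine (h1.mul ((hE' t ht).add_const (B / A))).congr_deriv ?_
    field_simp
    ring
  have hanti : AntitoneOn (fun t => Real.exp (-(A * t)) * (E t + B / A)) (Icc 0 T) := by
    refine antitoneOn_of_deriv_nonpos (convex_Icc 0 T) ?_ ?_ ?_
    · exact (Continuous.continuousOn (by fun_prop)).mul (hE.add continuousOn_const)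
    · rw [interior_Icc]
      exact fun t ht => (hd t ht).differentiableAt.differentiableWithinAt
    · rw [interior_Icc]
      intro t ht
      rw [(hd t ht).deriv]
      have := hle t ht
      exact mul_nonpos_of_nonneg_of_nonpos (Real.exp_pos _).le (by linarith)
  have h2 := hanti (left_mem_Icc.2 hT) ht ht.1
  simp only [mul_zero, neg_zero, Real.exp_zero, one_mul] at h2
  rw [Real.exp_neg, inv_mul_le_iff₀ (Real.exp_pos _)] at h2
  have h3 : Real.exp (A * t) * (E 0 + B / A) ≤ Real.exp (A * T) * (E 0 + B / A) := by
    have : A * t ≤ A * T := mul_le_mul_of_nonneg_left ht.2 hA.le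
    gcongr
  have h4 : 0 ≤ B / A := by positivity
  linarith

end Gronwall

/-! ### The relative energy -/

section RelativeEnergy

/-- Density of the relative energy of `(a, U, c)` with respect to `(b, u, d)`. -/
noncomputable def relEnergyDensity (Ck α : ℝ) (a b c d : Space → ℝ) (U u : Space → Vec)
    (x : Space) : ℝ :=
  1 / 2 * (a x * ∑ i, (U x i - u x i) ^ 2)
    + Ck * (1 / 2 * α * (c x - d x - (a x - b x)) ^ 2 + 1 / 2 * ∑ i, (pd i c x - pd i d x) ^ 2)
    + 1 / 2 * (a x - b x) ^ 2

/-- The time derivative of the density of the relative energy. -/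
noncomputable def relEnergyRate (Ck α : ℝ) (a b c d a' b' c' d' : Space → ℝ)
    (U u U' u' : Space → Vec) (x : Space) : ℝ :=
  1 / 2 * a' x * ∑ i, (U x i - u x i) ^ 2 + a x * ∑ i, (U x i - u x i) * (U' x i - u' x i)
    + Ck * (α * (c x - d x - (a x - b x)) * (c' x - d' x - (a' x - b' x))
      + ∑ i, (pd i c x - pd i d x) * (pd i c' x - pd i d' x))
    + (a x - b x) * (a' x - b' x)

variable {Ck α : ℝ} {I : Set ℝ}

lemma jointCont_relEnergyDensity {a b c d : ℝ → Space → ℝ} {U u : ℝ → Space → Vec}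
    (ha : JointCont I a) (hb : JointCont I b) (hc : JointCont I c) (hd : JointCont I d)
    (hpc : ∀ i, JointCont I fun t => pd i (c t)) (hpd : ∀ i, JointCont I fun t => pd i (d t))
    (hU : ∀ i, JointCont I fun t x => U t x i) (hu : ∀ i, JointCont I fun t x => u t x i) :
    JointCont I fun t => relEnergyDensity Ck α (a t) (b t) (c t) (d t) (U t) (u t) := by
  have sq : ∀ {f : ℝ → Space → ℝ}, JointCont I f → JointCont I fun t x => f t x ^ 2 := fun hf =>
    hf.comp_continuous (continuous_pow 2)
  exact (((ha.mul (JointCont.sum fun i _ => sq ((hU i).sub (hu i)))).const_mul _).add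
    (((((sq ((hc.sub hd).sub (ha.sub hb))).const_mul _)).add
      ((JointCont.sum fun i _ => sq ((hpc i).sub (hpd i))).const_mul _)).const_mul _)).add
    ((sq (ha.sub hb)).const_mul _)

lemma jointCont_relEnergyRate {a b c d a' b' c' d' : ℝ → Space → ℝ} {U u U' u' : ℝ → Space → Vec}
    (ha : JointCont I a) (hb : JointCont I b) (hc : JointCont I c) (hd : JointCont I d)
    (ha' : JointCont I a') (hb' : JointCont I b') (hc' : JointCont I c') (hd' : JointCont I d')
    (hpc : ∀ i, JointCont I fun t => pd i (c t)) (hpd : ∀ i, JointCont I fun t => pd i (d t))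
    (hpc' : ∀ i, JointCont I fun t => pd i (c' t)) (hpd' : ∀ i, JointCont I fun t => pd i (d' t))
    (hU : ∀ i, JointCont I fun t x => U t x i) (hu : ∀ i, JointCont I fun t x => u t x i)
    (hU' : ∀ i, JointCont I fun t x => U' t x i) (hu' : ∀ i, JointCont I fun t x => u' t x i) :
    JointCont I fun t => relEnergyRate Ck α (a t) (b t) (c t) (d t) (a' t) (b' t) (c' t) (d' t)
      (U t) (u t) (U' t) (u' t) := by
  have sq : ∀ {f : ℝ → Space → ℝ}, JointCont I f → JointCont I fun t x => f t x ^ 2 := fun hf =>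
    hf.comp_continuous (continuous_pow 2)
  exact ((((ha'.const_mul _).mul (JointCont.sum fun i _ => sq ((hU i).sub (hu i)))).add
    (ha.mul (JointCont.sum fun i _ => ((hU i).sub (hu i)).mul ((hU' i).sub (hu' i))))).add
    (((((((hc.sub hd).sub (ha.sub hb)).const_mul _).mul ((hc'.sub hd').sub (ha'.sub hb')))).add
      (JointCont.sum fun i _ => ((hpc i).sub (hpd i)).mul ((hpc' i).sub (hpd' i)))).const_mul _)).add
    ((ha.sub hb).mul (ha'.sub hb'))

lemma hasDerivAt_relEnergyDensity {a b c d a' b' c' d' : ℝ → Space → ℝ}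
    {U u U' u' : ℝ → Space → Vec} {t : ℝ} {x : Space}
    (ha : HasDerivAt (fun s => a s x) (a' t x) t) (hb : HasDerivAt (fun s => b s x) (b' t x) t)
    (hc : HasDerivAt (fun s => c s x) (c' t x) t) (hd : HasDerivAt (fun s => d s x) (d' t x) t)
    (hpc : ∀ i, HasDerivAt (fun s => pd i (c s) x) (pd i (c' t) x) t)
    (hpd : ∀ i, HasDerivAt (fun s => pd i (d s) x) (pd i (d' t) x) t)
    (hU : ∀ i, HasDerivAt (fun s => U s x i) (U' t x i) t)
    (hu : ∀ i, HasDerivAt (fun s => u s x i) (u' t x i) t) :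
    HasDerivAt (fun s => relEnergyDensity Ck α (a s) (b s) (c s) (d s) (U s) (u s) x)
      (relEnergyRate Ck α (a t) (b t) (c t) (d t) (a' t) (b' t) (c' t) (d' t)
      (U t) (u t) (U' t) (u' t) x) t := by
  have h1 := (ha.fun_mul (HasDerivAt.fun_sum (u := Finset.univ) fun i _ =>
    ((hU i).fun_sub (hu i)).fun_pow 2)).const_mul (1 / 2 : ℝ)
  have h2 := (((hc.fun_sub hd).fun_sub (ha.fun_sub hb)).fun_pow 2).const_mul (1 / 2 * α)
  have h3 := (HasDerivAt.fun_sum (u := Finset.univ) fun i _ =>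
    ((hpc i).fun_sub (hpd i)).fun_pow 2).const_mul (1 / 2 : ℝ)
  have h4 := ((ha.fun_sub hb).fun_pow 2).const_mul (1 / 2 : ℝ)
  refine ((h1.fun_add ((h2.fun_add h3).const_mul Ck)).fun_add h4).congr_deriv ?_
  simp only [relEnergyRate, Fin.sum_univ_three]
  ring

/-- The energy contains no w² of its own; it is recovered from w² ≤ 2(w - r)² + 2r² and α ≥ 1. This
leaves 3r², three copies of α(w - r)², |∇w|² and |v|², whence the 6, the 6/Ck and, from a ≥ cρ, the
2/cρ. -/
lemma relEnergyDensity_lower_bound {cρ : ℝ} {a b c d : Space → ℝ} {U u : Space → Vec} {x : Space}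
    (hcρ : 0 < cρ) (hCk : 0 < Ck) (hα : 1 ≤ α) (ha : cρ ≤ a x) :
    (a x - b x) ^ 2 + ∑ i, (U x i - u x i) ^ 2 + (c x - d x) ^ 2 + ∑ i, (pd i c x - pd i d x) ^ 2
        + α * (c x - d x - (a x - b x)) ^ 2
      ≤ (6 + 2 / cρ + 6 / Ck) * relEnergyDensity Ck α a b c d U u x := by
  unfold relEnergyDensity
  set V := ∑ i, (U x i - u x i) ^ 2 with hVd
  set G := ∑ i, (pd i c x - pd i d x) ^ 2 with hGd
  have hV : 0 ≤ V := Finset.sum_nonneg fun i _ => sq_nonneg _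
  have hG : 0 ≤ G := Finset.sum_nonneg fun i _ => sq_nonneg _
  set r := a x - b x with hr
  set w := c x - d x with hw
  have hz : 0 ≤ (w - r) ^ 2 := sq_nonneg _
  have hw2 : w ^ 2 ≤ 2 * (α * (w - r) ^ 2) + 2 * r ^ 2 := by
    have h1 : (w - r) ^ 2 ≤ α * (w - r) ^ 2 := le_mul_of_one_le_left hz hα
    nlinarith [sq_nonneg (w - 2 * r)]
  have hZ : 0 ≤ α * (w - r) ^ 2 := mul_nonneg (by linarith) hz
  have haV : cρ * V ≤ a x * V := mul_le_mul_of_nonneg_right ha hV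
  have e1 : 1 / 2 * α * (w - r) ^ 2 = 1 / 2 * (α * (w - r) ^ 2) := by ring
  rw [e1]
  generalize α * (w - r) ^ 2 = Z at *
  have hK : 0 ≤ 1 / 2 * (a x * V) := by
    have : 0 ≤ cρ * V := by positivity
    linarith
  have hR : 0 ≤ 1 / 2 * r ^ 2 := by positivity
  have hC : 0 ≤ Ck * (1 / 2 * Z + 1 / 2 * G) := by positivity
  have t1 : V ≤ 2 / cρ * (1 / 2 * (a x * V)) := by
    rw [div_mul_eq_mul_div, le_div_iff₀ hcρ]; linarith
  have t2 : 3 * Z + 3 * G = 6 / Ck * (Ck * (1 / 2 * Z + 1 / 2 * G)) := by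
    field_simp; ring
  have p1 : 0 ≤ 2 / cρ := by positivity
  have p2 : 0 ≤ 6 / Ck := by positivity
  have q1 := mul_nonneg p1 hR
  have q2 := mul_nonneg p1 hC
  have q3 := mul_nonneg p2 hR
  have q4 := mul_nonneg p2 hK
  linarith

end RelativeEnergy

/-! ### Differential inequality for the relative energy of solutions -/

section EnergyEstimate

variable {h : ℝ → ℝ} {lam mu Ck T cρ Cρ cm α : ℝ}

lemma inv_sqrt_sq {α : ℝ} (hα : 0 < α) : ((√α)⁻¹) ^ 2 = 1 / α := by
  rw [inv_pow, Real.sq_sqrt hα.le, one_div]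

lemma laplace_smoothing_inv_sqrt (hα : 0 < α) {b : Space → ℝ} (hb : TorusCk 2 b) (x : Space) :
    laplace (smoothing (√α)⁻¹ b) x = α * (smoothing (√α)⁻¹ b x - b x) := by
  have h := smoothing_sub_laplace (δ := (√α)⁻¹) hb x
  rw [inv_sqrt_sq hα] at h
  rw [← h]
  field_simp
  ring

lemma laplace_eq_of_screened (hα : 0 < α) {a c : Space → ℝ}
    (h : ∀ x, c x - 1 / α * laplace c x = a x) (x : Space) :
    laplace c x = α * (c x - a x) := by
  rw [← h]
  field_simp
  ring

/-- Growth of the relative energy between a lower-order solution and a reference flow. -/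
theorem relEnergyRate_integral_le (hh : ContDiffOn ℝ 3 h (Ioi 0)) (hmu : 0 < mu)
    (hν : 0 < lam + 2 / 3 * mu) (hCk : 0 < Ck) (hcρ : 0 < cρ) {ρ₀ : Space → ℝ} {u₀ : Space → Vec}
    {b : ℝ → Space → ℝ} {u : ℝ → Space → Vec} (hbu : IsStrongNSK h lam mu Ck T ρ₀ u₀ b u)
    (hbub : UniformBounds T cρ Cρ cm b u) {M : ℝ}
    (hM : ReferenceBound h lam mu T cρ Cρ M b fun t i x => u t x i) (hα : 1 ≤ α)
    {ρ₀α : Space → ℝ} {u₀α : Space → Vec} {a : ℝ → Space → ℝ} {U : ℝ → Space → Vec}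
    {c : ℝ → Space → ℝ} (haU : IsStrongLowerOrder h lam mu Ck T α ρ₀α u₀α a U c)
    (haUb : UniformBounds T cρ Cρ cm a U) {a' b' c' : ℝ → Space → ℝ} {U' u' : ℝ → Space → Vec}
    (ha' : HasC1Time (Ioo 0 T) 0 a a') (hb' : HasC1Time (Ioo 0 T) 1 b b')
    (hc' : HasC1Time (Ioo 0 T) 2 c c') (hU' : HasC1Time (Ioo 0 T) 0 U U')
    (hu' : HasC1Time (Ioo 0 T) 0 u u') {t : ℝ} (ht : t ∈ Ioo 0 T) :
    ∫ x, relEnergyRate Ck α (a t) (b t) (c t) (smoothing (√α)⁻¹ (b t)) (a' t) (b' t) (c' t)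
        (smoothing (√α)⁻¹ (b' t)) (U t) (u t) (U' t) (u' t) x ∂torusMeasure
      ≤ rateConst (2 * M) (lam + 2 / 3 * mu) Ck * (6 + 2 / cρ + 6 / Ck)
          * ∫ x, relEnergyDensity Ck α (a t) (b t) (c t) (smoothing (√α)⁻¹ (b t)) (U t) (u t) x
            ∂torusMeasure
        + rateConst (2 * M) (lam + 2 / 3 * mu) Ck * (3 * M * resolventMoment) ^ 2 / α := by
  have htI : t ∈ Icc 0 T := Ioo_subset_Icc_self ht
  have hα0 : 0 < α := by linarith
  set δ := (√α)⁻¹ with hδ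
  have hδ0 : 0 ≤ δ := by positivity
  have hat := haU.rho_C0.1 t htI
  have hbt := hbu.rho_C0.1 t htI
  have hct := haU.c_C0.1 t htI
  have hUt := fun i => (haU.u_C0.comp i).1 t htI
  have hut := fun i => (hbu.u_C0.comp i).1 t htI
  have hdt : TorusCk 3 (smoothing δ (b t)) := hbt.smoothing
  have hlb : TorusCk 1 (laplace (b t)) := TorusCk.laplace (k := 1) hbt
  have hld : laplace (smoothing δ (b t)) = smoothing δ (laplace (b t)) :=
    laplace_smoothing (hbt.of_le (by norm_num))
  have hM0 : 0 ≤ M := (abs_nonneg _).trans (hM.pd_density t htI 0 0)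
  have hM1 : M ≤ 2 * M := by linarith
  have hAa : ∀ x, 0 < a t x := haU.rho_pos t htI
  have hBb : ∀ x, 0 < b t x := hbu.rho_pos t htI
  have hCM := hM.density_le
  have haC : ∀ x, a t x ∈ Icc cρ Cρ := fun x => ⟨(haUb t htI x).1, (haUb t htI x).2.1⟩
  have hbC : ∀ x, b t x ∈ Icc cρ Cρ := fun x => ⟨(hbub t htI x).1, (hbub t htI x).2.1⟩
  have hp := (contDiffOn_pressure hh).of_le (m := ((1 : ℕ) : WithTop ℕ∞)) (by norm_num)
  have hlc := laplace_eq_of_screened hα0 (haU.screened t htI)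
  have hldt := laplace_smoothing_inv_sqrt hα0 (hbt.of_le (l := 2) (by norm_num))
  have hda := fun x => ha'.hasDerivAt isOpen_Ioo ht x
  have hdb := fun x => hb'.hasDerivAt isOpen_Ioo ht x
  have hdU := fun i x => (hU'.comp i).hasDerivAt isOpen_Ioo ht x
  have hdu := fun i x => (hu'.comp i).hasDerivAt isOpen_Ioo ht x
  have hamass : ∀ x, a' t x = -∑ j, pd j (fun y => a t y * U t y j) x := fun x => by
    have := haU.mass t ht x
    rw [(hda x).deriv] at this
    exact eq_neg_of_add_eq_zero_left this
  have hbmass : ∀ x, b' t x = -∑ j, pd j (fun y => b t y * u t y j) x := fun x => by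
    have := hbu.mass t ht x
    rw [(hdb x).deriv] at this
    exact eq_neg_of_add_eq_zero_left this
  have hmomU : ∀ i x, a t x * (U' t x i + ∑ j, U t x j * pd j (fun y => U t y i) x)
      = ∑ j, pd j (stressComp lam mu (fun i y => U t y i) i j) x + Ck * α * a t x * pd i (c t) x
        - pd i (fun y => pressure h (a t y) + Ck * (α / 2) * a t y ^ 2) x := fun i x => by
    refine material_derivative (u := fun i y => U t y i) (hat.differentiable le_rfl)
      (fun i => (hUt i).differentiable one_le_two) ((hda x).mul (hdU i x)).deriv (hamass x) ?_
    exact eq_sub_of_add_eq (haU.momentum t ht x i)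
  have hmomu : ∀ i x, b t x * (u' t x i + ∑ j, u t x j * pd j (fun y => u t y i) x)
      = ∑ j, pd j (stressComp lam mu (fun i y => u t y i) i j) x
        + Ck * b t x * pd i (laplace (b t)) x - pd i (fun y => pressure h (b t y)) x := fun i x => by
    refine material_derivative (u := fun i y => u t y i) (hbt.differentiable (by norm_num))
      (fun i => (hut i).differentiable one_le_two) ((hdb x).mul (hdu i x)).deriv (hbmass x) ?_
    exact eq_sub_of_add_eq (hbu.momentum t ht x i)
  have hctd := hct.differentiable (by norm_num)
  have hdtd := hdt.differentiable (by norm_num)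
  have hb't : TorusCk 1 (b' t) := hb'.2.1.1 t ht
  have hc't : TorusCk 1 (c' t) := (hc'.2.1.1 t ht).of_le one_le_two
  have hd't : TorusCk 1 (smoothing δ (b' t)) := hb't.smoothing
  -- The bound 2M is needed for ∇e, the difference of the smoothed and the original ∇Δb, each at
  -- most M. The value of ε comes from the Lipschitz constant 3M of Δb.
  have key := integral_energy_rate_le (a := a t) (b := b t)
    (e := fun x => laplace (smoothing δ (b t)) x - laplace (b t) x)
    (π := fun x => pressure h (a t x) - pressure h (b t x))
    (w := fun x => c t x - smoothing δ (b t) x) (a' := a' t) (b' := b' t)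
    (w' := fun x => c' t x - smoothing δ (b' t) x) (U := fun i x => U t x i)
    (u := fun i x => u t x i) (v := fun i x => U t x i - u t x i)
    (g := refForce h lam mu (b t) fun i x => u t x i) (v' := fun i x => U' t x i - u' t x i)
    (lam := lam) (mu := mu) (Ck := Ck) (α := α) (M := 2 * M)
    (ε := 3 * M * δ * resolventMoment) hmu hν hCk.le hα0.le hat (hbt.of_le (by norm_num))
    ((TorusCk.laplace (k := 1) hdt).sub hlb)
    ((TorusCk.comp (s := Ioi 0) hp hat hAa).sub
      (TorusCk.comp (s := Ioi 0) hp (hbt.of_le (by norm_num)) hBb))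
    (hct.sub hdt) hut (fun i => (hUt i).sub (hut i)) (fun i x => by ring)
    (ha'.2.1.1 t ht).continuous hb't.continuous (hc't.sub hd't)
    (fun i => ((hU'.comp i).2.1.1 t ht).continuous.sub ((hu'.comp i).2.1.1 t ht).continuous)
    hamass hbmass
    (fun i x => momentum_difference hh hat hbt hct hdt hUt hut hAa hBb hlc (hmomU i x) (hmomu i x))
    (fun x => by
      rw [laplace_sub hct hdt]
      beta_reduce
      rw [hlc, hldt]
      ring)
    (fun x => by rw [abs_of_pos (hAa x)]; linarith [(haC x).2])
    (fun x => by rw [abs_of_pos (hBb x)]; linarith [(hbC x).2])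
    (fun x => abs_le.2 ⟨by linarith [(hbC x).2, hAa x], by linarith [(haC x).2, hBb x]⟩)
    (fun x => (hM.pressure_lipschitz _ (haC x) _ (hbC x)).trans
      (mul_le_mul_of_nonneg_right hM1 (abs_nonneg _)))
    (fun i x => (hM.force t htI i x).trans hM1)
    (fun i x => by
      rw [pd_sub ((TorusCk.laplace (k := 1) hdt).differentiable le_rfl)
        (hlb.differentiable le_rfl), hld, pd_smoothing hlb]
      have h1 := abs_smoothing_le (δ := δ) (hM.pd_laplace_density t htI i) x
      have h2 := hM.pd_laplace_density t htI i x
      have h3 := abs_sub (smoothing δ (pd i (laplace (b t))) x) (pd i (laplace (b t)) x)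
      linarith)
    (fun x => by
      rw [hld]
      exact abs_smoothing_sub_le hlb hδ0 (abs_sub_le_of_pd_le (hlb.differentiable le_rfl)
        (hM.pd_laplace_density t htI)) x)
    (fun i x => (hM.pd_density t htI i x).trans hM1)
    (fun i j x => (hM.pd_velocity t htI i j x).trans hM1)
    (fun x => (hM.div_velocity t htI x).trans hM1)
    (fun i x => (hM.pd_div_velocity t htI i x).trans hM1)
  have hA := rateConst_nonneg (M := 2 * M) (by linarith) hν hCk.le
  set A := rateConst (2 * M) (lam + 2 / 3 * mu) Ck with hAd
  have ew : ∀ i, pd i (fun x => c t x - smoothing δ (b t) x)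
      = fun x => pd i (c t) x - pd i (smoothing δ (b t)) x := fun i => pd_sub hctd hdtd
  have ew' : ∀ i, pd i (fun x => c' t x - smoothing δ (b' t) x)
      = fun x => pd i (c' t) x - pd i (smoothing δ (b' t)) x := fun i =>
    pd_sub (hc't.differentiable le_rfl) (hd't.differentiable le_rfl)
  simp only [ew, ew'] at key
  refine key.trans ?_
  have hdc : Continuous
      (relEnergyDensity Ck α (a t) (b t) (c t) (smoothing δ (b t)) (U t) (u t)) := by
    have hac := hat.continuous
    have hbc := hbt.continuous
    have hcc := hct.continuous
    have hdc := hdt.continuous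
    have hUc := fun i => (hUt i).continuous
    have huc := fun i => (hut i).continuous
    have hpc := fun i => (TorusCk.pd (k := 2) hct i).continuous
    have hpd := fun i => (TorusCk.pd (k := 2) hdt i).continuous
    unfold relEnergyDensity
    refine ((continuous_const.mul (hac.mul (continuous_finsetSum _ fun i _ =>
      ((hUc i).sub (huc i)).pow 2))).add (continuous_const.mul (Continuous.add (by fun_prop)
      (continuous_const.mul (continuous_finsetSum _ fun i _ => ((hpc i).sub (hpd i)).pow 2))))).add
      (by fun_prop)
  have hε : (3 * M * δ * resolventMoment) ^ 2 = (3 * M * resolventMoment) ^ 2 / α := by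
    rw [show (3 * M * δ * resolventMoment) ^ 2 = (3 * M * resolventMoment) ^ 2 * δ ^ 2 by ring,
      inv_sqrt_sq hα0]
    ring
  rw [← integral_const_mul]
  -- The torus has unit measure, so the constant error term can be moved under the integral.
  have e2 : ∫ x, A * (6 + 2 / cρ + 6 / Ck) * relEnergyDensity Ck α (a t) (b t) (c t)
        (smoothing δ (b t)) (U t) (u t) x ∂torusMeasure
        + A * (3 * M * resolventMoment) ^ 2 / α
      = ∫ x, (A * (6 + 2 / cρ + 6 / Ck) * relEnergyDensity Ck α (a t) (b t) (c t)
        (smoothing δ (b t)) (U t) (u t) x + A * (3 * M * resolventMoment) ^ 2 / α)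
          ∂torusMeasure := by
    rw [integral_add (integrable_torus (hdc.const_mul _)) (integrable_const _)]
    simp
  rw [e2]
  refine integral_mono_of_nonneg (Eventually.of_forall fun x => ?_)
    (integrable_torus ((continuous_const.mul hdc).add continuous_const))
    (Eventually.of_forall fun x => ?_)
  · refine mul_nonneg hA ?_
    have h1 : 0 ≤ ∑ i, (U t x i - u t x i) ^ 2 := Finset.sum_nonneg fun i _ => sq_nonneg _
    have h2 : 0 ≤ ∑ i, (pd i (c t) x - pd i (smoothing δ (b t)) x) ^ 2 :=
      Finset.sum_nonneg fun i _ => sq_nonneg _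
    positivity
  · have h1 := relEnergyDensity_lower_bound (b := b t) (c := c t) (d := smoothing δ (b t))
      (U := U t) (u := u t) hcρ hCk hα (haC x).1
    have h2 := mul_le_mul_of_nonneg_left h1 hA
    simp only [hε]
    calc _ = A * ((a t x - b t x) ^ 2 + ∑ i, (U t x i - u t x i) ^ 2
          + (c t x - smoothing δ (b t) x) ^ 2
          + ∑ i, (pd i (c t) x - pd i (smoothing δ (b t)) x) ^ 2
          + α * (c t x - smoothing δ (b t) x - (a t x - b t x)) ^ 2)
          + A * (3 * M * resolventMoment) ^ 2 / α := by ring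
      _ ≤ _ := by rw [mul_assoc A]; exact add_le_add h2 le_rfl

end EnergyEstimate

/-! ### Propagation of the relative energy in time -/

section EnergyBound

variable {h : ℝ → ℝ} {lam mu Ck T cρ Cρ cm α : ℝ}

/-- The relative energy of `(a, U, c)` with respect to `(b, u)`. -/
noncomputable def relEnergy (Ck α : ℝ) (a b c : Space → ℝ) (U u : Space → Vec) : ℝ :=
  ∫ x, relEnergyDensity Ck α a b c (smoothing (√α)⁻¹ b) U u x ∂torusMeasure

lemma relEnergyDensity_nonneg {a b c d : Space → ℝ} {U u : Space → Vec} {x : Space}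
    (hCk : 0 ≤ Ck) (hα : 0 ≤ α) (ha : 0 ≤ a x) : 0 ≤ relEnergyDensity Ck α a b c d U u x := by
  have h1 : 0 ≤ ∑ i, (U x i - u x i) ^ 2 := Finset.sum_nonneg fun i _ => sq_nonneg _
  have h2 : 0 ≤ ∑ i, (pd i c x - pd i d x) ^ 2 := Finset.sum_nonneg fun i _ => sq_nonneg _
  unfold relEnergyDensity
  positivity

lemma jointCont_pd_smoothing {K : Set ℝ} (hK : IsCompact K) {δ : ℝ} {f : ℝ → Space → ℝ}
    (hf : C0Time K 1 f) (i : Fin 3) : JointCont K fun t => pd i (smoothing δ (f t)) :=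
  ((C0Time.pd (k := 0) hf i).jointCont.smoothing_of_isCompact hK).congr fun t ht x => by
    rw [pd_smoothing (hf.1 t ht)]

lemma jointCont_solution_relEnergyDensity {ρ₀ : Space → ℝ} {u₀ : Space → Vec}
    {b : ℝ → Space → ℝ} {u : ℝ → Space → Vec} (hbu : IsStrongNSK h lam mu Ck T ρ₀ u₀ b u)
    {ρ₀α : Space → ℝ} {u₀α : Space → Vec} {a : ℝ → Space → ℝ} {U : ℝ → Space → Vec}
    {c : ℝ → Space → ℝ} (haU : IsStrongLowerOrder h lam mu Ck T α ρ₀α u₀α a U c) :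
    JointCont (Icc 0 T) fun t =>
      relEnergyDensity Ck α (a t) (b t) (c t) (smoothing (√α)⁻¹ (b t)) (U t) (u t) :=
  jointCont_relEnergyDensity haU.rho_C0.jointCont hbu.rho_C0.jointCont haU.c_C0.jointCont
    (hbu.rho_C0.jointCont.smoothing_of_isCompact isCompact_Icc)
    (fun i => (C0Time.pd (k := 2) haU.c_C0 i).jointCont)
    (fun i => jointCont_pd_smoothing isCompact_Icc (hbu.rho_C0.of_le (by norm_num)) i)
    (fun i => (haU.u_C0.comp i).jointCont) (fun i => (hbu.u_C0.comp i).jointCont)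

/-- The relative energy grows at most exponentially, up to an error of order `1 / α`. -/
theorem exists_relEnergy_le (hh : ContDiffOn ℝ 3 h (Ioi 0)) (hT : 0 < T) (hmu : 0 < mu)
    (hν : 0 < lam + 2 / 3 * mu) (hCk : 0 < Ck) (hcρ : 0 < cρ) {ρ₀ : Space → ℝ} {u₀ : Space → Vec}
    {b : ℝ → Space → ℝ} {u : ℝ → Space → Vec} (hbu : IsStrongNSK h lam mu Ck T ρ₀ u₀ b u)
    (hbub : UniformBounds T cρ Cρ cm b u) {M : ℝ}
    (hM : ReferenceBound h lam mu T cρ Cρ M b fun t i x => u t x i) :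
    ∃ C > 0, ∀ α : ℝ, 1 ≤ α → ∀ (ρ₀α : Space → ℝ) (u₀α : Space → Vec) (a : ℝ → Space → ℝ)
      (U : ℝ → Space → Vec) (c : ℝ → Space → ℝ),
      IsStrongLowerOrder h lam mu Ck T α ρ₀α u₀α a U c → UniformBounds T cρ Cρ cm a U →
      ∀ t ∈ Icc 0 T, relEnergy Ck α (a t) (b t) (c t) (U t) (u t)
        ≤ C * (relEnergy Ck α (a 0) (b 0) (c 0) (U 0) (u 0) + 1 / α) := by
  have hM0 : 0 ≤ M := (abs_nonneg _).trans (hM.pd_density 0 (left_mem_Icc.2 hT.le) 0 0)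
  have hR := rateConst_nonneg (M := 2 * M) (by linarith) hν hCk.le
  set R := rateConst (2 * M) (lam + 2 / 3 * mu) Ck with hRd
  -- The summand 1 makes A positive, as Gronwall's inequality divides by it. A and B do not involve
  -- α.
  set A := R * (6 + 2 / cρ + 6 / Ck) + 1 with hA
  set B := R * (3 * M * resolventMoment) ^ 2 with hB
  have hA0 : 0 < A := by positivity
  have hB0 : 0 ≤ B := by positivity
  refine ⟨(1 + B / A) * Real.exp (A * T), by positivity, ?_⟩
  intro α hα ρ₀α u₀α a U c haU haUb t ht
  have hα0 : 0 < α := by linarith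
  obtain ⟨a', ha'⟩ := haU.rho_C1.exists_hasC1Time
  obtain ⟨b', hb'⟩ := hbu.rho_C1.exists_hasC1Time
  obtain ⟨c', hc'⟩ := haU.c_C1.exists_hasC1Time
  obtain ⟨U', hU'⟩ := haU.u_C1.exists_hasC1Time
  obtain ⟨u', hu'⟩ := hbu.u_C1.exists_hasC1Time
  have hjc := jointCont_solution_relEnergyDensity hbu haU
  have hE0 : ∀ t ∈ Icc 0 T, 0 ≤ relEnergy Ck α (a t) (b t) (c t) (U t) (u t) := fun t ht =>
    integral_nonneg fun x => relEnergyDensity_nonneg hCk.le hα0.le (haU.rho_pos t ht x).le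
  have hEc : ContinuousOn (fun t => relEnergy Ck α (a t) (b t) (c t) (U t) (u t)) (Icc 0 T) :=
    hjc.integral isCompact_Icc (μ := torusMeasure) (s := Icc 0 T) (τ := id) (φ := fun _ y => y)
      continuousOn_id (fun _ h => h) (fun _ _ => continuous_id) fun _ => continuousOn_const
  have hI : Ioo 0 T ⊆ Icc 0 T := Ioo_subset_Icc_self
  -- Smoothing commutes with the time derivative, so this is the time derivative of the screened
  -- density. Its spatial derivatives are handled in the same way.
  set d' := fun t => smoothing (√α)⁻¹ (b' t) with hd'
  have hpb : ∀ i, HasC1Time (Ioo 0 T) 0 (fun t => pd i (b t)) fun t => pd i (b' t) := fun i =>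
    HasC1Time.pd (k := 0) hb' i
  have hdd : ∀ t ∈ Ioo 0 T, ∀ x, HasDerivAt (fun s => smoothing (√α)⁻¹ (b s) x) (d' t x) t :=
    fun t ht x => hasDerivAt_smoothing (fun t ht => (hb'.1 t ht).of_le (Nat.zero_le _))
      hb'.2.1.jointCont (fun t ht => hb'.hasDerivAt isOpen_Ioo ht) ht x
  have hdpd : ∀ i, ∀ t ∈ Ioo 0 T, ∀ x,
      HasDerivAt (fun s => pd i (smoothing (√α)⁻¹ (b s)) x) (pd i (d' t) x) t := by
    intro i t ht x
    have h1 := hasDerivAt_smoothing (δ := (√α)⁻¹) (hpb i).1 (hpb i).2.1.jointCont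
      (fun t ht => (hpb i).hasDerivAt isOpen_Ioo ht) ht x
    rw [hd', pd_smoothing (hb'.2.1.1 t ht)]
    refine h1.congr_of_eventuallyEq ?_
    filter_upwards [isOpen_Ioo.mem_nhds ht] with s hs
    rw [pd_smoothing (hb'.1 s hs)]
  have hjr : JointCont (Ioo 0 T) fun t => relEnergyRate Ck α (a t) (b t) (c t)
      (smoothing (√α)⁻¹ (b t)) (a' t) (b' t) (c' t) (d' t) (U t) (u t) (U' t) (u' t) :=
    jointCont_relEnergyRate (haU.rho_C0.jointCont.mono hI) (hbu.rho_C0.jointCont.mono hI)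
      (haU.c_C0.jointCont.mono hI)
      ((hbu.rho_C0.jointCont.smoothing_of_isCompact isCompact_Icc).mono hI)
      ha'.2.1.jointCont hb'.2.1.jointCont hc'.2.1.jointCont hb'.2.1.jointCont.smoothing_Ioo
      (fun i => (C0Time.pd (k := 2) haU.c_C0 i).jointCont.mono hI)
      (fun i => (jointCont_pd_smoothing isCompact_Icc (hbu.rho_C0.of_le (by norm_num)) i).mono hI)
      (fun i => (C0Time.pd (k := 1) hc'.2.1 i).jointCont)
      (fun i => (hpb i).2.1.jointCont.smoothing_Ioo.congr fun t ht x => by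
        rw [hd', pd_smoothing (hb'.2.1.1 t ht)])
      (fun i => (haU.u_C0.comp i).jointCont.mono hI) (fun i => (hbu.u_C0.comp i).jointCont.mono hI)
      (fun i => (hU'.comp i).2.1.jointCont) (fun i => (hu'.comp i).2.1.jointCont)
  have hEd : ∀ t ∈ Ioo 0 T, HasDerivAt (fun t => relEnergy Ck α (a t) (b t) (c t) (U t) (u t))
      (∫ x, relEnergyRate Ck α (a t) (b t) (c t) (smoothing (√α)⁻¹ (b t)) (a' t) (b' t) (c' t)
        (d' t) (U t) (u t) (U' t) (u' t) x ∂torusMeasure) t := fun t ht =>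
    hasDerivAt_integral_of_jointCont (μ := torusMeasure) (fun t ht => hjc.torusCk (hI ht)) hjr
      (fun t ht x => hasDerivAt_relEnergyDensity (ha'.hasDerivAt isOpen_Ioo ht x)
        (hb'.hasDerivAt isOpen_Ioo ht x) (hc'.hasDerivAt isOpen_Ioo ht x) (hdd t ht x)
        (fun i => (HasC1Time.pd (k := 1) hc' i).hasDerivAt isOpen_Ioo ht x)
        (fun i => hdpd i t ht x) (fun i => (hU'.comp i).hasDerivAt isOpen_Ioo ht x)
        (fun i => (hu'.comp i).hasDerivAt isOpen_Ioo ht x))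
      continuous_id ht
  have key := le_of_deriv_le_linear (B := B / α) hT.le hA0 (by positivity) hEc hEd
    (fun t ht => by
      have h1 := relEnergyRate_integral_le hh hmu hν hCk hcρ hbu hbub hM hα haU haUb ha' hb' hc'
        hU' hu' ht
      have h2 := hE0 t (hI ht)
      have h3 : A * relEnergy Ck α (a t) (b t) (c t) (U t) (u t)
        = R * (6 + 2 / cρ + 6 / Ck) * relEnergy Ck α (a t) (b t) (c t) (U t) (u t)
          + relEnergy Ck α (a t) (b t) (c t) (U t) (u t) := by rw [hA]; ring
      unfold relEnergy at h2 h3 ⊢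
      linarith) (hE0 0 (left_mem_Icc.2 hT.le)) t ht
  refine key.trans ?_
  have h0 := hE0 0 (left_mem_Icc.2 hT.le)
  have h4 : 0 ≤ B / A := by positivity
  have h5 : 0 ≤ 1 / α := by positivity
  have h6 : B / α / A = B / A * (1 / α) := by field_simp
  rw [h6, mul_assoc, mul_comm (Real.exp _), ← mul_assoc]
  refine mul_le_mul_of_nonneg_right ?_ (Real.exp_pos _).le
  nlinarith [mul_nonneg h4 h0]

end EnergyBound

/-! ### Norms on the torus -/

section Norms

lemma l2Norm_sq {F : Type} [NormedAddCommGroup F] {f : Space → F} (hf : Continuous f) :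
    l2Norm f ^ 2 = ENNReal.ofReal (∫ x, ‖f x‖ ^ 2 ∂torusMeasure) := by
  have hL : MemLp f 2 torusMeasure := by
    obtain ⟨M, hM⟩ := isCompact_Icc.exists_bound_of_continuousOn (s := Icc (0 : Space) 1)
      hf.continuousOn
    exact MemLp.of_bound hf.aestronglyMeasurable M
      ((ae_restrict_mem measurableSet_Icc).mono fun x hx => hM x hx)
  have h0 : 0 ≤ ∫ x, ‖f x‖ ^ 2 ∂torusMeasure := integral_nonneg fun x => sq_nonneg _
  rw [l2Norm, hL.eLpNorm_eq_integral_rpow_norm two_ne_zero ENNReal.ofNat_ne_top,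
    ← ENNReal.ofReal_pow (by positivity)]
  congr 1
  simp only [ENNReal.toReal_ofNat, Real.rpow_two]
  rw [← Real.rpow_natCast, ← Real.rpow_mul h0]
  norm_num

lemma sobolevNorm_one_sq {f : Space → ℝ} (hf : TorusCk 1 f) :
    sobolevNorm 1 f ^ 2 = ENNReal.ofReal (∫ x, (f x ^ 2 + ∑ i, pd i f x ^ 2) ∂torusMeasure) := by
  have hp : ∀ i, Continuous (pd i f) := fun i => (TorusCk.pd (k := 0) hf i).continuous
  have e0 : ∀ i : Fin 0 → Fin 3,
      (fun x => iteratedFDeriv ℝ 0 f x fun l => Pi.single (i l) 1) = f := fun i => by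
    funext x; simp
  have e1 : ∀ i : Fin 1 → Fin 3,
      (fun x => iteratedFDeriv ℝ 1 f x fun l => Pi.single (i l) 1) = pd (i 0) f := fun i => by
    funext x; simp [iteratedFDeriv_one_apply, pd]
  have h1 := l2Norm_sq hf.continuous
  have h2 := fun i => l2Norm_sq (hp i)
  simp only [l2Norm, Real.norm_eq_abs, sq_abs] at h1 h2
  rw [sobolevNorm, ← ENNReal.rpow_natCast, ← ENNReal.rpow_mul]
  norm_num
  rw [Finset.sum_range_succ, Finset.sum_range_one]
  simp only [e0, e1]
  rw [integral_add (integrable_torus (hf.continuous.fun_pow 2))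
    (integrable_torus (continuous_finsetSum _ fun i _ => (hp i).fun_pow 2)),
    integral_finsetSum _ fun i _ => integrable_torus ((hp i).fun_pow 2),
    ENNReal.ofReal_add (integral_nonneg fun x => sq_nonneg _)
      (Finset.sum_nonneg fun i _ => integral_nonneg fun x => sq_nonneg _),
    ENNReal.ofReal_sum_of_nonneg fun i _ => integral_nonneg fun x => sq_nonneg _]
  simp only [h2, h1, Finset.univ_unique, Finset.sum_singleton]
  congr 1

lemma supTime_sq_le {T X : ℝ} {g : ℝ → ℝ≥0∞} (h : ∀ t ∈ Ioo 0 T, g t ^ 2 ≤ ENNReal.ofReal X) :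
    supTime T g ^ 2 ≤ ENNReal.ofReal X := by
  have h1 : supTime T g ≤ ENNReal.ofReal X ^ (1 / 2 : ℝ) := by
    refine essSup_le_of_ae_le _ ((ae_restrict_mem measurableSet_Ioo).mono fun t ht => ?_)
    rw [one_div, ENNReal.le_rpow_inv_iff two_pos]
    simpa using h t ht
  calc _ ≤ (ENNReal.ofReal X ^ (1 / 2 : ℝ)) ^ 2 := by gcongr
    _ = _ := by rw [← ENNReal.rpow_natCast, ← ENNReal.rpow_mul]; norm_num

lemma le_div_of_sq_le {X : ℝ≥0∞} {K α Y : ℝ} (hK : 0 ≤ K) (hα : 0 < α)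
    (hX : X ^ 2 = ENNReal.ofReal Y) (h : X ≤ ENNReal.ofReal (K * α ^ (-(1 / 2) : ℝ))) :
    Y ≤ K ^ 2 / α := by
  have h1 : X ^ 2 ≤ ENNReal.ofReal (K * α ^ (-(1 / 2) : ℝ)) ^ 2 := by gcongr
  rw [hX, ← ENNReal.ofReal_pow (by positivity), ENNReal.ofReal_le_ofReal_iff (by positivity)] at h1
  refine h1.trans_eq ?_
  rw [mul_pow, ← Real.rpow_natCast (α ^ _), ← Real.rpow_mul hα.le]
  norm_num [Real.rpow_neg_one, div_eq_mul_inv]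

end Norms

/-! ### The initial relative energy -/

section InitialEnergy

variable {Ck α : ℝ}

/-- Energy estimate for the screened Poisson equation. -/
lemma screened_energy_le (hα : 0 < α) {r w : Space → ℝ} (hr : TorusCk 1 r) (hw : TorusCk 2 w)
    (h : ∀ x, laplace w x = α * (w x - r x)) :
    ∫ x, (1 / 2 * α * (w x - r x) ^ 2 + 1 / 2 * ∑ i, pd i w x ^ 2) ∂torusMeasure
      ≤ 1 / 2 * ∫ x, ∑ i, pd i r x ^ 2 ∂torusMeasure := by
  have hw1 : TorusCk 1 w := hw.of_le one_le_two
  have hz : TorusCk 1 fun x => w x - r x := hw1.sub hr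
  have hpw : ∀ i, TorusCk 1 (pd i w) := fun i => TorusCk.pd (k := 1) hw i
  have hpr : ∀ i, Continuous (pd i r) := fun i => (TorusCk.pd (k := 0) hr i).continuous
  have hwc := hw.continuous
  have hrc := hr.continuous
  have hpwc := fun i => (hpw i).continuous
  -- The equation is tested with w - r: the divergence of (w - r)∇w integrates to zero. It remains
  -- to use ∇(w - r)·∇w ≥ ½|∇w|² - ½|∇r|².
  have h0 := integral_sum_pd_eq_zero fun i => hz.mul (hpw i)
  have e : ∀ x, ∑ i, pd i (fun y => (w y - r y) * pd i w y) x
      = ∑ i, (pd i w x - pd i r x) * pd i w x + α * (w x - r x) ^ 2 := fun x => by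
    rw [sum_pd_mul (hz.differentiable le_rfl) fun i => (hpw i).differentiable le_rfl]
    have := h x
    unfold laplace at this
    rw [this, pow_two]
    simp only [pd_sub (hw1.differentiable le_rfl) (hr.differentiable le_rfl)]
    ring
  simp only [e] at h0
  have hcR : Continuous fun x => ∑ i, pd i r x ^ 2 :=
    continuous_finsetSum _ fun i _ => (hpr i).pow 2
  have hcD : Continuous fun x => ∑ i, (pd i w x - pd i r x) * pd i w x + α * (w x - r x) ^ 2 :=
    (continuous_finsetSum _ fun i _ => ((hpwc i).sub (hpr i)).mul (hpwc i)).add (by fun_prop)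
  have hcW : Continuous fun x => ∑ i, pd i w x ^ 2 :=
    continuous_finsetSum _ fun i _ => (hpwc i).pow 2
  calc _ ≤ ∫ x, ((∑ i, (pd i w x - pd i r x) * pd i w x + α * (w x - r x) ^ 2)
        + 1 / 2 * ∑ i, pd i r x ^ 2) ∂torusMeasure := by
        refine integral_mono (integrable_torus (by fun_prop)) (integrable_torus (by fun_prop))
          fun x => ?_
        have h1 : 1 / 2 * ∑ i, pd i w x ^ 2 - 1 / 2 * ∑ i, pd i r x ^ 2
            ≤ ∑ i, (pd i w x - pd i r x) * pd i w x := by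
          rw [Finset.mul_sum, Finset.mul_sum, ← Finset.sum_sub_distrib]
          exact Finset.sum_le_sum fun i _ => by nlinarith [sq_nonneg (pd i w x - pd i r x)]
        have h2 : 0 ≤ α * (w x - r x) ^ 2 := by positivity
        beta_reduce
        linarith
    _ = _ := by
        rw [integral_add (integrable_torus hcD) (integrable_torus (by fun_prop)), h0, zero_add,
          integral_const_mul]

/-- Since c - d solves the screened Poisson equation with datum a - b, its energy is at most ½‖∇(a -
b)‖², with no factor α. Closeness of the densities in H¹ therefore suffices, and nothing has to be
assumed about c. -/
lemma relEnergy_le_of_close {Cρ : ℝ} (hCk : 0 ≤ Ck) (hα : 0 < α) {a b c : Space → ℝ}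
    {U u : Space → Vec} (ha : TorusCk 1 a) (hb : TorusCk 3 b) (hc : TorusCk 3 c)
    (hU : Continuous U) (hu : Continuous u) (haC : ∀ x, a x ≤ Cρ)
    (hs : ∀ x, c x - 1 / α * laplace c x = a x) :
    relEnergy Ck α a b c U u ≤ 1 / 2 * Cρ * (∫ x, ‖U x - u x‖ ^ 2 ∂torusMeasure)
      + 1 / 2 * (Ck + 1) * ∫ x, ((a x - b x) ^ 2 + ∑ i, pd i (fun y => a y - b y) x ^ 2)
        ∂torusMeasure := by
  set d := smoothing (√α)⁻¹ b with hdef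
  have hd : TorusCk 3 d := hb.smoothing
  have hr : TorusCk 1 fun x => a x - b x := ha.sub (hb.of_le (by norm_num))
  have hrc : Continuous fun x => a x - b x := hr.continuous
  have hw : TorusCk 3 fun x => c x - d x := hc.sub hd
  have hwc := hw.continuous
  have hlc := laplace_eq_of_screened hα hs
  have hld := laplace_smoothing_inv_sqrt hα (hb.of_le (l := 2) (by norm_num))
  have hpw : ∀ i, Continuous (pd i fun x => c x - d x) := fun i =>
    (TorusCk.pd (k := 2) hw i).continuous
  have hpr : ∀ i, Continuous (pd i fun x => a x - b x) := fun i =>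
    (TorusCk.pd (k := 0) hr i).continuous
  have hE := screened_energy_le hα hr (hw.of_le (l := 2) (by norm_num)) fun x => by
    rw [laplace_sub hc hd]
    beta_reduce
    rw [hlc, hld]
    ring
  have hcV : Continuous fun x => ‖U x - u x‖ ^ 2 := (hU.sub hu).norm.pow 2
  have hcG : Continuous fun x => ∑ i, pd i (fun y => a y - b y) x ^ 2 :=
    continuous_finsetSum _ fun i _ => (hpr i).pow 2
  have hcW : Continuous fun x => ∑ i, pd i (fun x => c x - d x) x ^ 2 :=
    continuous_finsetSum _ fun i _ => (hpw i).pow 2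
  have hcE : Continuous fun x => 1 / 2 * α * (c x - d x - (a x - b x)) ^ 2
      + 1 / 2 * ∑ i, pd i (fun x => c x - d x) x ^ 2 :=
    (continuous_const.mul ((hwc.sub hrc).pow 2)).add (continuous_const.mul hcW)
  have e : ∀ x, relEnergyDensity Ck α a b c d U u x = 1 / 2 * (a x * ‖U x - u x‖ ^ 2)
      + Ck * (1 / 2 * α * (c x - d x - (a x - b x)) ^ 2
        + 1 / 2 * ∑ i, pd i (fun x => c x - d x) x ^ 2) + 1 / 2 * (a x - b x) ^ 2 := fun x => by
    simp only [pd_sub (hc.differentiable (by norm_num)) (hd.differentiable (by norm_num)),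
      relEnergyDensity, EuclideanSpace.norm_sq_eq, Real.norm_eq_abs, sq_abs, PiLp.sub_apply]
  have hac := ha.continuous
  have i1 := integrable_torus (hcV.const_mul (1 / 2 * Cρ))
  have i2 := integrable_torus (hcE.const_mul Ck)
  have i3 := integrable_torus ((hrc.fun_pow 2).const_mul (1 / 2))
  have iG := integrable_torus hcG
  calc relEnergy Ck α a b c U u
      ≤ ∫ x, (1 / 2 * Cρ * ‖U x - u x‖ ^ 2
        + Ck * (1 / 2 * α * (c x - d x - (a x - b x)) ^ 2
        + 1 / 2 * ∑ i, pd i (fun x => c x - d x) x ^ 2) + 1 / 2 * (a x - b x) ^ 2)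
          ∂torusMeasure := by
        unfold relEnergy
        simp only [← hdef, e]
        refine integral_mono (integrable_torus ?_) ((i1.add i2).add i3) fun x => ?_
        · exact ((continuous_const.mul (hac.mul hcV)).add (continuous_const.mul hcE)).add
            (continuous_const.mul (hrc.pow 2))
        · have := mul_le_mul_of_nonneg_right (haC x) (sq_nonneg ‖U x - u x‖)
          beta_reduce
          linarith
    _ = 1 / 2 * Cρ * (∫ x, ‖U x - u x‖ ^ 2 ∂torusMeasure)
        + Ck * (∫ x, (1 / 2 * α * (c x - d x - (a x - b x)) ^ 2
          + 1 / 2 * ∑ i, pd i (fun x => c x - d x) x ^ 2) ∂torusMeasure)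
        + 1 / 2 * ∫ x, (a x - b x) ^ 2 ∂torusMeasure := by
        rw [integral_add (i1.fun_add i2) i3, integral_add i1 i2]
        simp only [integral_const_mul]
    _ ≤ _ := by
        rw [integral_add (integrable_torus (hrc.fun_pow 2)) iG]
        have g1 := mul_le_mul_of_nonneg_left hE hCk
        have g2 : 0 ≤ ∫ x, (a x - b x) ^ 2 ∂torusMeasure := integral_nonneg fun x => sq_nonneg _
        have g3 : 0 ≤ ∫ x, ∑ i, pd i (fun y => a y - b y) x ^ 2 ∂torusMeasure :=
          integral_nonneg fun x => Finset.sum_nonneg fun i _ => sq_nonneg _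
        have g4 := mul_nonneg hCk g2
        linarith

end InitialEnergy

/-! ### Rate of convergence -/

section ConvergenceRate

variable {h : ℝ → ℝ} {lam mu Ck T cρ Cρ cm K α : ℝ}

/-- Density of the squared error between `(a, U, c)` and `(b, u)`. -/
noncomputable def errorDensity (α : ℝ) (a b c : Space → ℝ) (U u : Space → Vec) (x : Space) : ℝ :=
  (b x - c x) ^ 2 + ∑ i, pd i (fun y => b y - c y) x ^ 2 + α * (a x - c x) ^ 2 + ‖U x - u x‖ ^ 2

lemma continuous_errorDensity {a b c : Space → ℝ} {U u : Space → Vec} (ha : Continuous a)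
    (hb : TorusCk 1 b) (hc : TorusCk 1 c) (hU : Continuous U) (hu : Continuous u) :
    Continuous (errorDensity α a b c U u) := by
  have h1 := hb.continuous
  have h2 := hc.continuous
  have h3 : Continuous fun x => ∑ i, pd i (fun y => b y - c y) x ^ 2 :=
    continuous_finsetSum _ fun i _ => (TorusCk.pd (k := 0) (hb.sub hc) i).continuous.pow 2
  unfold errorDensity
  fun_prop

/-- By the screened equation the difference is -α⁻¹ times the smoothing of Δb, and smoothing
contracts the sup norm. The full power 1/α is needed for the density, whose squared error carries a
weight α. -/
lemma smoothing_sub_bounds (hα : 0 < α) {b : Space → ℝ} (hb : TorusCk 3 b) {M : ℝ}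
    (h1 : ∀ x, |laplace b x| ≤ M) (h2 : ∀ i x, |pd i (laplace b) x| ≤ M) (x : Space) :
    |b x - smoothing (√α)⁻¹ b x| ≤ M / α ∧
      ∀ i, |pd i b x - pd i (smoothing (√α)⁻¹ b) x| ≤ M / α := by
  have hl : TorusCk 1 (laplace b) := TorusCk.laplace (k := 1) hb
  have e : ∀ y, b y - smoothing (√α)⁻¹ b y = -(1 / α) * smoothing (√α)⁻¹ (laplace b) y := fun y => by
    have := laplace_smoothing_inv_sqrt hα (hb.of_le (l := 2) (by norm_num)) y
    rw [laplace_smoothing (hb.of_le (by norm_num))] at this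
    rw [this]
    field_simp
    ring
  have hbd : ∀ {s : ℝ}, |s| ≤ M → |-(1 / α) * s| ≤ M / α := fun {s} hs => by
    rw [abs_mul, abs_neg, abs_of_pos (by positivity), one_div_mul_eq_div]
    gcongr
  refine ⟨by rw [e]; exact hbd (abs_smoothing_le h1 x), fun i => ?_⟩
  have e2 := pd_sub (i := i) (hb.differentiable (by norm_num))
    ((TorusCk.smoothing (δ := (√α)⁻¹) hb).differentiable (by norm_num))
  rw [show (fun y => b y - smoothing (√α)⁻¹ b y) = _ from funext e,
    pd_const_mul _ ((TorusCk.smoothing (δ := (√α)⁻¹) hl).differentiable le_rfl),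
    pd_smoothing hl] at e2
  rw [← congrFun e2 x]
  exact hbd (abs_smoothing_le (h2 i) x)

/-- Each error is routed through d by the triangle inequality. The constant 10 is 2 for b - c, 2 for
each of the three partial derivatives, and 2 for a - c, where α (M/α)² = M²/α. -/
lemma errorDensity_le {a b c d : Space → ℝ} {U u : Space → Vec} {x : Space} {M : ℝ}
    (hcρ : 0 < cρ) (hCk : 0 < Ck) (hα : 1 ≤ α) (ha : cρ ≤ a x) (hb : Differentiable ℝ b)
    (hc : Differentiable ℝ c) (h1 : |b x - d x| ≤ M / α) (h2 : ∀ i, |pd i b x - pd i d x| ≤ M / α) :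
    errorDensity α a b c U u x
      ≤ 2 * (6 + 2 / cρ + 6 / Ck) * relEnergyDensity Ck α a b c d U u x + 10 * M ^ 2 / α := by
  have hα0 : 0 < α := by linarith
  have hl := relEnergyDensity_lower_bound (b := b) (c := c) (d := d) (U := U) (u := u) hcρ hCk hα ha
  have sq : ∀ {s : ℝ}, |s| ≤ M / α → s ^ 2 ≤ M ^ 2 / α / α := fun {s} hs => by
    rw [div_div, ← pow_two, ← div_pow]
    exact sq_le_sq' (abs_le.1 hs).1 (abs_le.1 hs).2
  have hμ : M ^ 2 / α / α ≤ M ^ 2 / α := div_le_self (by positivity) hα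
  have hαμ : α * (M ^ 2 / α / α) = M ^ 2 / α := by field_simp
  have s1 := sq h1
  have s2 := fun i => sq (h2 i)
  have hG : ∑ i, pd i (fun y => b y - c y) x ^ 2
      ≤ 2 * ∑ i, (pd i c x - pd i d x) ^ 2 + 6 * (M ^ 2 / α) := by
    have : ∀ i, pd i (fun y => b y - c y) x ^ 2
        ≤ 2 * (pd i c x - pd i d x) ^ 2 + 2 * (M ^ 2 / α) := fun i => by
      rw [pd_sub hb hc]
      nlinarith [sq_nonneg ((pd i b x - pd i d x) + (pd i c x - pd i d x)), s2 i]
    calc _ ≤ _ := Finset.sum_le_sum fun i _ => this i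
      _ = _ := by rw [Finset.sum_add_distrib, Finset.mul_sum]; simp; ring
  have hB : (b x - c x) ^ 2 ≤ 2 * (c x - d x) ^ 2 + 2 * (M ^ 2 / α) := by
    nlinarith [sq_nonneg ((b x - d x) + (c x - d x))]
  have hA : α * (a x - c x) ^ 2
      ≤ 2 * (α * (c x - d x - (a x - b x)) ^ 2) + 2 * (M ^ 2 / α) := by
    have h3 : (a x - c x) ^ 2 ≤ 2 * (c x - d x - (a x - b x)) ^ 2 + 2 * (M ^ 2 / α / α) := by
      nlinarith [sq_nonneg ((b x - d x) + (c x - d x - (a x - b x)))]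
    have := mul_le_mul_of_nonneg_left h3 hα0.le
    linarith
  have hV : ‖U x - u x‖ ^ 2 = ∑ i, (U x i - u x i) ^ 2 := by
    simp only [EuclideanSpace.norm_sq_eq, Real.norm_eq_abs, sq_abs, PiLp.sub_apply]
  have hV0 : 0 ≤ ∑ i, (U x i - u x i) ^ 2 := Finset.sum_nonneg fun i _ => sq_nonneg _
  have hR0 := sq_nonneg (a x - b x)
  unfold errorDensity
  rw [hV]
  have e : 10 * M ^ 2 / α = 10 * (M ^ 2 / α) := by ring
  rw [e]
  linarith

/-- Convergence rate with a constant that may depend on the reference solution. -/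
theorem exists_error_le (hh : ContDiffOn ℝ 3 h (Ioi 0)) (hT : 0 < T) (hmu : 0 < mu)
    (hν : 0 < lam + 2 / 3 * mu) (hCk : 0 < Ck) (hcρ : 0 < cρ) (hK : 0 ≤ K) {ρ₀ : Space → ℝ}
    {u₀ : Space → Vec} {b : ℝ → Space → ℝ} {u : ℝ → Space → Vec}
    (hbu : IsStrongNSK h lam mu Ck T ρ₀ u₀ b u) (hbub : UniformBounds T cρ Cρ cm b u) :
    ∃ C > 0, ∀ α : ℝ, 1 ≤ α → ∀ (ρ₀α : Space → ℝ) (u₀α : Space → Vec) (a : ℝ → Space → ℝ)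
      (U : ℝ → Space → Vec) (c : ℝ → Space → ℝ), CloseInitialData K α ρ₀ u₀ ρ₀α u₀α →
      IsStrongLowerOrder h lam mu Ck T α ρ₀α u₀α a U c → UniformBounds T cρ Cρ cm a U →
      ∀ t ∈ Icc 0 T, ∫ x, errorDensity α (a t) (b t) (c t) (U t) (u t) x ∂torusMeasure ≤ C / α := by
  have h0 : (0 : ℝ) ∈ Icc 0 T := left_mem_Icc.2 hT.le
  have hCρ : 0 < Cρ := hcρ.trans_le ((hbub 0 h0 0).1.trans (hbub 0 h0 0).2.1)
  obtain ⟨M, hM0, hM⟩ := exists_referenceBound (lam := lam) (mu := mu) (Cρ := Cρ) hh hcρ hbu.rho_C0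
    (fun t ht x => (hbub t ht x).1) fun i => hbu.u_C0.comp i
  obtain ⟨C, hC0, hC⟩ := exists_relEnergy_le hh hT hmu hν hCk hcρ hbu hbub hM
  set Q := 6 + 2 / cρ + 6 / Ck with hQ
  have hQ0 : 0 < Q := by positivity
  -- The inner bracket bounds α (E(0) + 1/α), C propagates it in time, 2Q passes from the energy to
  -- the error density, and 10 M² pays for replacing d by b.
  refine ⟨2 * Q * (C * (1 / 2 * Cρ * K ^ 2 + 1 / 2 * (Ck + 1) * K ^ 2 + 1)) + 10 * M ^ 2,
    by positivity, ?_⟩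
  intro α hα ρ₀α u₀α a U c hcl haU haUb t ht
  have hα0 : 0 < α := by linarith
  have hE := hC α hα ρ₀α u₀α a U c haU haUb t ht
  have hr1 : TorusCk 1 fun x => ρ₀α x - ρ₀ x := (hcl.rho_reg.of_le (by norm_num)).sub
    (by rw [← hbu.rho_init]; exact (hbu.rho_C0.1 0 h0).of_le (by norm_num))
  have hUc : ∀ t ∈ Icc 0 T, Continuous (U t) := fun t ht => (haU.u_C0.1 t ht).continuous
  have huc : ∀ t ∈ Icc 0 T, Continuous (u t) := fun t ht => (hbu.u_C0.1 t ht).continuous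
  have hV : ∫ x, ‖U 0 x - u 0 x‖ ^ 2 ∂torusMeasure ≤ K ^ 2 / α := by
    refine le_div_of_sq_le hK hα0 (l2Norm_sq ((hUc 0 h0).sub (huc 0 h0))) ?_
    rw [haU.u_init, hbu.u_init]
    exact hcl.u_close
  have hR : ∫ x, ((a 0 x - b 0 x) ^ 2 + ∑ i, pd i (fun y => a 0 y - b 0 y) x ^ 2) ∂torusMeasure
      ≤ K ^ 2 / α := by
    rw [haU.rho_init, hbu.rho_init]
    exact le_div_of_sq_le hK hα0 (sobolevNorm_one_sq hr1) hcl.rho_close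
  have hI := relEnergy_le_of_close (Ck := Ck) hCk.le hα0 (haU.rho_C0.1 0 h0) (hbu.rho_C0.1 0 h0)
    (haU.c_C0.1 0 h0) (hUc 0 h0) (huc 0 h0) (fun x => (haUb 0 h0 x).2.1) (haU.screened 0 h0)
  have hI2 : relEnergy Ck α (a 0) (b 0) (c 0) (U 0) (u 0) + 1 / α
      ≤ (1 / 2 * Cρ * K ^ 2 + 1 / 2 * (Ck + 1) * K ^ 2 + 1) / α := by
    have g1 := mul_le_mul_of_nonneg_left hV (by positivity : 0 ≤ 1 / 2 * Cρ)
    have g2 := mul_le_mul_of_nonneg_left hR (by positivity : 0 ≤ 1 / 2 * (Ck + 1))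
    rw [add_div, add_div, mul_div_assoc, mul_div_assoc]
    linarith
  have hdc : Continuous
      (relEnergyDensity Ck α (a t) (b t) (c t) (smoothing (√α)⁻¹ (b t)) (U t) (u t)) :=
    (jointCont_solution_relEnergyDensity hbu haU).continuous ht
  have hbt := hbu.rho_C0.1 t ht
  have hct := haU.c_C0.1 t ht
  calc ∫ x, errorDensity α (a t) (b t) (c t) (U t) (u t) x ∂torusMeasure
      ≤ ∫ x, (2 * Q * relEnergyDensity Ck α (a t) (b t) (c t) (smoothing (√α)⁻¹ (b t)) (U t) (u t) x
        + 10 * M ^ 2 / α) ∂torusMeasure := by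
        refine integral_mono (integrable_torus (continuous_errorDensity
          (haU.rho_C0.1 t ht).continuous (hbt.of_le (by norm_num)) (hct.of_le (by norm_num))
          (hUc t ht) (huc t ht))) (integrable_torus (by fun_prop)) fun x => ?_
        have hb := smoothing_sub_bounds hα0 hbt (hM.laplace_density t ht)
          (hM.pd_laplace_density t ht) x
        exact errorDensity_le hcρ hCk hα (haUb t ht x).1 (hbt.differentiable (by norm_num))
          (hct.differentiable (by norm_num)) hb.1 hb.2
    _ = 2 * Q * relEnergy Ck α (a t) (b t) (c t) (U t) (u t) + 10 * M ^ 2 / α := by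
        rw [integral_add (integrable_torus (hdc.const_mul _)) (integrable_const _),
          integral_const_mul]
        simp [relEnergy]
    _ ≤ _ := by
        have g1 := mul_le_mul_of_nonneg_left hE (by positivity : 0 ≤ 2 * Q)
        have g2 := mul_le_mul_of_nonneg_left (mul_le_mul_of_nonneg_left hI2 hC0.le)
          (by positivity : 0 ≤ 2 * Q)
        rw [add_div, mul_div_assoc, mul_div_assoc, mul_div_assoc C]
        linarith

end ConvergenceRate

/-! ### Independence of the constant from the reference solution -/

section UniformRate

variable {h : ℝ → ℝ} {lam mu Ck T cρ Cρ cm K α : ℝ}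

/-- Density of the squared distance of `(b, u)` and `(b₁, u₁)` in `H¹ × L²`. -/
noncomputable def distDensity (b b₁ : Space → ℝ) (u u₁ : Space → Vec) (x : Space) : ℝ :=
  (b x - b₁ x) ^ 2 + ∑ i, (pd i b x - pd i b₁ x) ^ 2 + ‖u x - u₁ x‖ ^ 2

lemma sq_le_two_mul_sq_add_sq (r s t : ℝ) : (r - t) ^ 2 ≤ 2 * (s - t) ^ 2 + 2 * (r - s) ^ 2 := by
  nlinarith [sq_nonneg ((s - t) - (r - s))]

lemma norm_sub_sq_le {F : Type} [NormedAddCommGroup F] (r s t : F) :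
    ‖r - t‖ ^ 2 ≤ 2 * ‖s - t‖ ^ 2 + 2 * ‖r - s‖ ^ 2 := by
  have h1 : ‖r - t‖ ≤ ‖r - s‖ + ‖s - t‖ := norm_sub_le_norm_sub_add_norm_sub r s t
  nlinarith [sq_nonneg (‖r - s‖ - ‖s - t‖), norm_nonneg (r - t)]

section Pointwise

variable {a b b₁ c : Space → ℝ} {U u u₁ : Space → Vec}

lemma errorDensity_le_add_distDensity (hα : 0 ≤ α) (hb : Differentiable ℝ b)
    (hb₁ : Differentiable ℝ b₁) (hc : Differentiable ℝ c) (x : Space) :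
    errorDensity α a b c U u x ≤ 2 * errorDensity α a b₁ c U u₁ x + 2 * distDensity b b₁ u u₁ x := by
  have h1 := sq_le_two_mul_sq_add_sq (b x) (b₁ x) (c x)
  have h2 : ∑ i, (pd i b x - pd i c x) ^ 2 ≤ 2 * ∑ i, (pd i b₁ x - pd i c x) ^ 2
      + 2 * ∑ i, (pd i b x - pd i b₁ x) ^ 2 := by
    rw [Finset.mul_sum, Finset.mul_sum, ← Finset.sum_add_distrib]
    exact Finset.sum_le_sum fun i _ => sq_le_two_mul_sq_add_sq _ _ _
  have h3 := norm_sub_sq_le (u x) (u₁ x) (U x)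
  have h4 : 0 ≤ α * (a x - c x) ^ 2 := by positivity
  simp only [errorDensity, distDensity, pd_sub hb hc, pd_sub hb₁ hc, norm_sub_rev (U x)]
  linarith

lemma distDensity_le_add_errorDensity (hα : 0 ≤ α) (hb : Differentiable ℝ b)
    (hb₁ : Differentiable ℝ b₁) (hc : Differentiable ℝ c) (x : Space) :
    distDensity b b₁ u u₁ x
      ≤ 2 * errorDensity α a b c U u x + 2 * errorDensity α a b₁ c U u₁ x := by
  have h0 : ∀ r s t : ℝ, (r - t) ^ 2 ≤ 2 * (r - s) ^ 2 + 2 * (t - s) ^ 2 := fun r s t => by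
    nlinarith [sq_nonneg (r - s + (t - s))]
  have h1 := h0 (b x) (c x) (b₁ x)
  have h2 : ∑ i, (pd i b x - pd i b₁ x) ^ 2 ≤ 2 * ∑ i, (pd i b x - pd i c x) ^ 2
      + 2 * ∑ i, (pd i b₁ x - pd i c x) ^ 2 := by
    rw [Finset.mul_sum, Finset.mul_sum, ← Finset.sum_add_distrib]
    exact Finset.sum_le_sum fun i _ => h0 _ _ _
  have h3 := norm_sub_sq_le (u x) (U x) (u₁ x)
  rw [norm_sub_rev (u x) (U x)] at h3
  have h4 : 0 ≤ α * (a x - c x) ^ 2 := by positivity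
  simp only [errorDensity, distDensity, pd_sub hb hc, pd_sub hb₁ hc]
  linarith

lemma continuous_distDensity (hb : TorusCk 1 b) (hb₁ : TorusCk 1 b₁) (hu : Continuous u)
    (hu₁ : Continuous u₁) : Continuous (distDensity b b₁ u u₁) := by
  have h1 := hb.continuous
  have h2 := hb₁.continuous
  have h3 : Continuous fun x => ∑ i, (pd i b x - pd i b₁ x) ^ 2 :=
    continuous_finsetSum _ fun i _ =>
      ((TorusCk.pd (k := 0) hb i).continuous.sub (TorusCk.pd (k := 0) hb₁ i).continuous).pow 2
  unfold distDensity
  fun_prop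

end Pointwise

/-- Convergence rate with a constant that is uniform in the reference solution. If lower-order
solutions exist for arbitrarily large `α`, then they determine the reference solution. -/
theorem exists_uniform_error_le (hh : ContDiffOn ℝ 3 h (Ioi 0)) (hT : 0 < T) (hmu : 0 < mu)
    (hν : 0 < lam + 2 / 3 * mu) (hCk : 0 < Ck) (hcρ : 0 < cρ) (hK : 0 ≤ K) (ρ₀ : Space → ℝ)
    (u₀ : Space → Vec) :
    ∃ C > 0, ∃ α₁ > 0, ∀ (b : ℝ → Space → ℝ) (u : ℝ → Space → Vec),
      IsStrongNSK h lam mu Ck T ρ₀ u₀ b u → UniformBounds T cρ Cρ cm b u →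
      ∀ α : ℝ, α₁ ≤ α → ∀ (ρ₀α : Space → ℝ) (u₀α : Space → Vec) (a : ℝ → Space → ℝ)
      (U : ℝ → Space → Vec) (c : ℝ → Space → ℝ), CloseInitialData K α ρ₀ u₀ ρ₀α u₀α →
      IsStrongLowerOrder h lam mu Ck T α ρ₀α u₀α a U c → UniformBounds T cρ Cρ cm a U →
      ∀ t ∈ Icc 0 T, ∫ x, errorDensity α (a t) (b t) (c t) (U t) (u t) x ∂torusMeasure ≤ C / α := by
  -- Without a reference solution there is nothing to prove; otherwise one of them, b₁, is fixed and
  -- supplies the constant.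
  by_cases hex : ∃ (b : ℝ → Space → ℝ) (u : ℝ → Space → Vec),
      IsStrongNSK h lam mu Ck T ρ₀ u₀ b u ∧ UniformBounds T cρ Cρ cm b u
  swap
  · exact ⟨1, one_pos, 1, one_pos, fun b u h1 h2 => absurd ⟨b, u, h1, h2⟩ hex⟩
  obtain ⟨b₁, u₁, hbu₁, hbub₁⟩ := hex
  -- If admissible lower-order solutions stop existing beyond some N, then taking α₁ ≥ N makes the
  -- claim vacuous.
  by_cases hun : ∀ N : ℝ, ∃ α, N ≤ α ∧ ∃ (ρ₀α : Space → ℝ) (u₀α : Space → Vec)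
      (a : ℝ → Space → ℝ) (U : ℝ → Space → Vec) (c : ℝ → Space → ℝ),
      CloseInitialData K α ρ₀ u₀ ρ₀α u₀α ∧ IsStrongLowerOrder h lam mu Ck T α ρ₀α u₀α a U c ∧
        UniformBounds T cρ Cρ cm a U
  swap
  · push Not at hun
    obtain ⟨N, hN⟩ := hun
    exact ⟨1, one_pos, max N 1, by positivity, fun b u _ _ α hα ρ₀α u₀α a U c h1 h2 h3 =>
      absurd h3 (hN α ((le_max_left _ _).trans hα) ρ₀α u₀α a U c h1 h2)⟩
  obtain ⟨C₁, hC₁, hE₁⟩ := exists_error_le hh hT hmu hν hCk hcρ hK hbu₁ hbub₁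
  -- Any other reference solution will be at distance zero from b₁, so only the factor 2 of the
  -- squared triangle inequality is lost.
  refine ⟨2 * C₁, by positivity, 1, one_pos, ?_⟩
  intro b u hbu hbub α hα ρ₀α u₀α a U c hcl haU haUb t ht
  obtain ⟨C, hC, hE⟩ := exists_error_le hh hT hmu hν hCk hcρ hK hbu hbub
  have hbt : TorusCk 1 (b t) := (hbu.rho_C0.1 t ht).of_le (by norm_num)
  have hb₁t : TorusCk 1 (b₁ t) := (hbu₁.rho_C0.1 t ht).of_le (by norm_num)
  have hut : Continuous (u t) := (hbu.u_C0.1 t ht).continuous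
  have hu₁t : Continuous (u₁ t) := (hbu₁.u_C0.1 t ht).continuous
  have hD := integrable_torus (continuous_distDensity hbt hb₁t hut hu₁t)
  have hint : ∀ {α : ℝ} {ρ₀α : Space → ℝ} {u₀α : Space → Vec} {a : ℝ → Space → ℝ}
      {U : ℝ → Space → Vec} {c : ℝ → Space → ℝ} {f : Space → ℝ} {v : Space → Vec},
      IsStrongLowerOrder h lam mu Ck T α ρ₀α u₀α a U c → TorusCk 1 f → Continuous v →
      Integrable (errorDensity α (a t) f (c t) (U t) v) torusMeasure := fun haU hf hv =>
    integrable_torus (continuous_errorDensity (haU.rho_C0.1 t ht).continuous hf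
      ((haU.c_C0.1 t ht).of_le (by norm_num)) (haU.u_C0.1 t ht).continuous hv)
  -- The same lower-order solutions approximate both reference solutions, so the squared distance is
  -- at most 2(C + C₁)/α for arbitrarily large α. The constant C depends on b, but it disappears in
  -- the limit.
  have hdist : ∫ x, distDensity (b t) (b₁ t) (u t) (u₁ t) x ∂torusMeasure ≤ 0 := by
    refine le_of_forall_pos_le_add fun ε hε => ?_
    obtain ⟨α, hα, ρ₀α, u₀α, a, U, c, h1, h2, h3⟩ := hun (max 1 (2 * (C + C₁) / ε))
    have hα1 : 1 ≤ α := (le_max_left _ _).trans hα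
    have hα0 : 0 < α := by linarith
    have hαε : 2 * (C + C₁) / α ≤ ε := by
      rw [div_le_iff₀ hα0, ← div_le_iff₀' hε]
      exact (le_max_right _ _).trans hα
    have i1 := hint h2 hbt hut
    have i2 := hint h2 hb₁t hu₁t
    have g1 := hE α hα1 ρ₀α u₀α a U c h1 h2 h3 t ht
    have g2 := hE₁ α hα1 ρ₀α u₀α a U c h1 h2 h3 t ht
    have g3 := integral_mono hD ((i1.const_mul 2).add (i2.const_mul 2)) fun x =>
      distDensity_le_add_errorDensity hα0.le (hbt.differentiable le_rfl)
        (hb₁t.differentiable le_rfl) ((h2.c_C0.1 t ht).differentiable (by norm_num)) x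
    have g4 := integral_add (i1.const_mul 2) (i2.const_mul 2)
    rw [integral_const_mul, integral_const_mul] at g4
    have g5 : 2 * (C + C₁) / α = 2 * (C / α) + 2 * (C₁ / α) := by ring
    refine g3.trans ((le_of_eq g4).trans ?_)
    linarith
  have i1 := (hint haU hb₁t hu₁t).const_mul 2
  have g1 := hE₁ α hα ρ₀α u₀α a U c hcl haU haUb t ht
  have g3 := integral_mono (hint haU hbt hut) (i1.add (hD.const_mul 2)) fun x =>
    errorDensity_le_add_distDensity (by linarith) (hbt.differentiable le_rfl)
      (hb₁t.differentiable le_rfl) ((haU.c_C0.1 t ht).differentiable (by norm_num)) x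
  have g4 := integral_add i1 (hD.const_mul 2)
  rw [integral_const_mul, integral_const_mul] at g4
  refine g3.trans ((le_of_eq g4).trans ?_)
  rw [mul_div_assoc]
  linarith

/-- The norms of the error are controlled by the error density. -/
lemma norms_le_of_error_le {X : ℝ} (hα : 0 < α) {a b c : ℝ → Space → ℝ} {U u : ℝ → Space → Vec}
    (ha : ∀ t ∈ Ioo 0 T, TorusCk 1 (a t)) (hb : ∀ t ∈ Ioo 0 T, TorusCk 1 (b t))
    (hc : ∀ t ∈ Ioo 0 T, TorusCk 1 (c t)) (hU : ∀ t ∈ Ioo 0 T, Continuous (U t))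
    (hu : ∀ t ∈ Ioo 0 T, Continuous (u t))
    (hX : ∀ t ∈ Ioo 0 T, ∫ x, errorDensity α (a t) (b t) (c t) (U t) (u t) x ∂torusMeasure ≤ X) :
    supTime T (fun t => sobolevNorm 1 fun x => b t x - c t x) ^ 2 ≤ ENNReal.ofReal X ∧
      supTime T (fun t => l2Norm fun x => a t x - c t x) ^ 2 ≤ ENNReal.ofReal (X / α) ∧
      supTime T (fun t => l2Norm fun x => U t x - u t x) ^ 2 ≤ ENNReal.ofReal X := by
  have key : ∀ t ∈ Ioo 0 T,
      ∫ x, ((b t x - c t x) ^ 2 + ∑ i, pd i (fun y => b t y - c t y) x ^ 2) ∂torusMeasure ≤ X ∧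
      ∫ x, ‖a t x - c t x‖ ^ 2 ∂torusMeasure ≤ X / α ∧
      ∫ x, ‖U t x - u t x‖ ^ 2 ∂torusMeasure ≤ X := by
    intro t ht
    have hac := (ha t ht).continuous
    have hbc := (hb t ht).continuous
    have hcc := (hc t ht).continuous
    have hUc := hU t ht
    have huc := hu t ht
    have hp : Continuous fun x => ∑ i, pd i (fun y => b t y - c t y) x ^ 2 :=
      continuous_finsetSum _ fun i _ =>
        (TorusCk.pd (k := 0) ((hb t ht).sub (hc t ht)) i).continuous.pow 2
    have hE := integrable_torus (continuous_errorDensity (α := α) hac (hb t ht) (hc t ht) hUc huc)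
    have h1 : ∀ x, 0 ≤ ∑ i, pd i (fun y => b t y - c t y) x ^ 2 := fun x =>
      Finset.sum_nonneg fun i _ => sq_nonneg _
    have h2 : ∀ x, 0 ≤ α * (a t x - c t x) ^ 2 := fun x => by positivity
    refine ⟨(integral_mono (integrable_torus (by fun_prop)) hE fun x => ?_).trans (hX t ht), ?_,
      (integral_mono (integrable_torus (by fun_prop)) hE fun x => ?_).trans (hX t ht)⟩
    · have := h2 x
      have := sq_nonneg ‖U t x - u t x‖
      simp only [errorDensity]
      linarith
    · rw [le_div_iff₀' hα, ← integral_const_mul]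
      refine (integral_mono (integrable_torus (by fun_prop)) hE fun x => ?_).trans (hX t ht)
      have := h1 x
      have := sq_nonneg ‖U t x - u t x‖
      have := sq_nonneg (b t x - c t x)
      simp only [errorDensity, Real.norm_eq_abs, sq_abs]
      linarith
    · have := h2 x
      have := h1 x
      have := sq_nonneg (b t x - c t x)
      simp only [errorDensity]
      linarith
  refine ⟨supTime_sq_le fun t ht => ?_, supTime_sq_le fun t ht => ?_,
    supTime_sq_le fun t ht => ?_⟩
  · rw [sobolevNorm_one_sq ((hb t ht).sub (hc t ht))]
    exact ENNReal.ofReal_le_ofReal (key t ht).1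
  · rw [l2Norm_sq ((ha t ht).continuous.fun_sub (hc t ht).continuous)]
    exact ENNReal.ofReal_le_ofReal (key t ht).2.1
  · rw [l2Norm_sq ((hU t ht).fun_sub (hu t ht))]
    exact ENNReal.ofReal_le_ofReal (key t ht).2.2

end UniformRate

end NSK

theorem mainTheorem6
    (h : ℝ → ℝ) (hh : ContDiffOn ℝ 3 h (Set.Ioi 0)) (hh0 : ∀ r, 0 < r → 0 ≤ h r)
    (T lam mu Ck : ℝ) (hT : 0 < T) (hmu : 0 < mu) (hCk : 0 < Ck)
    (hvisc : 0 < lam + 2 / 3 * mu)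
    (ρ₀ : NSK.Space → ℝ) (u₀ : NSK.Space → NSK.Vec)
    (hρ₀ : NSK.TorusCk 3 ρ₀) (hρ₀pos : ∀ x, 0 < ρ₀ x) (hu₀ : NSK.TorusCk 2 u₀)
    (cρ Cρ cm K : ℝ) (hcρ : 0 < cρ) (hCρ : 0 < Cρ) (hcm : 0 < cm) (hK : 0 < K) :
    ∃ C > 0, ∃ α₁ > 0,
      ∀ (ρ : ℝ → NSK.Space → ℝ) (u : ℝ → NSK.Space → NSK.Vec),
        NSK.IsStrongNSK h lam mu Ck T ρ₀ u₀ ρ u →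
        NSK.UniformBounds T cρ Cρ cm ρ u →
      ∀ α : ℝ, α₁ ≤ α →
      ∀ (ρ₀α : NSK.Space → ℝ) (u₀α : NSK.Space → NSK.Vec)
        (ρα : ℝ → NSK.Space → ℝ) (uα : ℝ → NSK.Space → NSK.Vec) (cα : ℝ → NSK.Space → ℝ),
        NSK.CloseInitialData K α ρ₀ u₀ ρ₀α u₀α →
        NSK.IsStrongLowerOrder h lam mu Ck T α ρ₀α u₀α ρα uα cα →
        NSK.UniformBounds T cρ Cρ cm ρα uα →
        ENNReal.ofReal (Ck / 2)
              * NSK.supTime T (fun t => NSK.sobolevNorm 1 (fun x => ρ t x - cα t x)) ^ 2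
            + ENNReal.ofReal (Ck * α / 2)
              * NSK.supTime T (fun t => NSK.l2Norm (fun x => ρα t x - cα t x)) ^ 2
            + ENNReal.ofReal (cρ / 2)
              * NSK.supTime T (fun t => NSK.l2Norm (fun x => uα t x - u t x)) ^ 2
          ≤ ENNReal.ofReal (C / α) := by
  obtain ⟨C, hC, α₁, hα₁, key⟩ := NSK.exists_uniform_error_le (Cρ := Cρ) (cm := cm) hh hT hmu hvisc
    hCk hcρ hK.le ρ₀ u₀
  -- One summand for each norm. The middle norm has squared bound C/α², and its weight Ck α / 2
  -- restores the order 1/α.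
  refine ⟨Ck / 2 * C + Ck / 2 * C + cρ / 2 * C, by positivity, α₁, hα₁, ?_⟩
  intro ρ u hρu hρub α hα ρ₀α u₀α ρα uα cα hcl hαs hαb
  have hα0 : 0 < α := hα₁.trans_le hα
  have hI : ∀ t ∈ Ioo 0 T, t ∈ Icc 0 T := fun t ht => Ioo_subset_Icc_self ht
  obtain ⟨h1, h2, h3⟩ := NSK.norms_le_of_error_le hα0 (fun t ht => hαs.rho_C0.1 t (hI t ht))
    (fun t ht => (hρu.rho_C0.1 t (hI t ht)).of_le (by norm_num))
    (fun t ht => (hαs.c_C0.1 t (hI t ht)).of_le (by norm_num))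
    (fun t ht => (hαs.u_C0.1 t (hI t ht)).continuous)
    (fun t ht => (hρu.u_C0.1 t (hI t ht)).continuous)
    (fun t ht => key ρ u hρu hρub α hα ρ₀α u₀α ρα uα cα hcl hαs hαb t (hI t ht))
  calc _ ≤ ENNReal.ofReal (Ck / 2) * ENNReal.ofReal (C / α)
        + ENNReal.ofReal (Ck * α / 2) * ENNReal.ofReal (C / α / α)
        + ENNReal.ofReal (cρ / 2) * ENNReal.ofReal (C / α) := by gcongr
    _ = ENNReal.ofReal ((Ck / 2 * C + Ck / 2 * C + cρ / 2 * C) / α) := by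
        rw [← ENNReal.ofReal_mul (by positivity), ← ENNReal.ofReal_mul (by positivity),
          ← ENNReal.ofReal_mul (by positivity), ← ENNReal.ofReal_add (by positivity) (by positivity),
          ← ENNReal.ofReal_add (by positivity) (by positivity)]
        congr 1
        field_simp
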